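/- Let $\mathcal H$ be a separable complex Hilbert space, let $\mathcal T(\mathcal H)$ be the Banach space of trace class operators on $\mathcal H$ with the trace norm $\|A\|_{1}=\mathbf{tr}\,(A^*A)^{1/2}$, and let $\mathcal S(\mathcal H)=\{A\in\mathcal T(\mathcal H): A\ge 0,\ \mathbf{tr}A=1\}$ be the set of density operators. Let $(\mathcal X,\Sigma)$ be a measurable space, let $D:\mathcal X\to\mathcal S(\mathcal H)$ be a classical-quantum channel, i.e. a map that is measurable with respect to $\Sigma$ and the Borel $\sigma$-algebra of the trace norm, and let $P$ be a probability distribution on $\mathcal X$ and $X$ a random variable with distribution $P$. Put $D_P:=\mathbb E\,D(X)$ (expectations of operators are Bochner integrals in $\mathcal T(\mathcal H)$) and $$I(P,D):=\mathbb E\,\mathbf{tr}\big(D(X)\log D(X)\big)-\mathbf{tr}\big(D_P\log D_P\big),$$ with the convention $I(P,D):=\infty$ if $D(X)\log D(X)\notin\mathcal T(\mathcal H)$ on a non-null set or $D_P\log D_P\notin\mathcal T(\mathcal H)$; here $\log$ is the natural logarithm and $0\log 0=0$. For $n,M\in\mathbb N$, $M\ge 1$, the standard random codebook of block length $n$ and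 size $M$ is $\mathcal C=(\mathcal C(m))_{m=1}^M$, where the codewords $\mathcal C(m)\in\mathcal X^n$ are independent and each has $n$ i.i.d. components with distribution $P$. It induces the channel output density $$D_{\mathcal C}:=\frac1M\sum_{m=1}^M D^n(\mathcal C(m)),\qquad D^n(x_1,\dots,x_n):=D(x_1)\otimes\dots\otimes D(x_n),$$ on the Hilbert space tensor power $\mathcal H^{\otimes n}$. Let $R\in\mathbb R$ with $R>I(P,D)$. Assume that there is $\alpha_{\min}\in(0,1)$ such that $D_P^{\alpha_{\min}}\in\mathcal T(\mathcal H)$, such that $D(x)^{\alpha_{\min}}\in\mathcal T(\mathcal H)$ for $P$-almost all $x$, and such that the Bochner integral $\mathbb E\,(D(X)^{\alpha_{\min}})\in\mathcal T(\mathcal H)$ exists. Then there are $\gamma_1,\gamma_2\in(0,\infty)$ such that, for all sufficiently large $n$ and for every $M\in\mathbb N$ with $M\ge\exp(nR)$, $$\mathbb P_{\mathcal C}\Big(\big\|D_{\mathcal C}-D_P^{\otimes n}\big\|_{1}\ge\exp(-\gamma_1 n)\Big)\le\exp\big(-\exp(\gamma_2 n)\big).$$ -/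

import Mathlib

open MeasureTheory Filter Topology
open scoped ENNReal InnerProductSpace TensorProduct

noncomputable section

namespace CQ

universe u v

/-! ## Trace and trace norm of bounded operators on a complex Hilbert space -/

section TraceNorm

set_option linter.unusedSectionVars false

variable {H : Type u} [NormedAddCommGroup H] [InnerProductSpace ℂ H] [CompleteSpace H]

variable (H) in
/-- Index set of a fixed Hilbert (orthonormal) basis of `H`. -/
def BasisIndex : Set H := (exists_hilbertBasis ℂ H).choose

variable (H) in
/-- A fixed Hilbert (orthonormal) basis of `H`. The trace and the trace norm defined with it do not
depend on the choice. -/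
def stdBasis : HilbertBasis (BasisIndex H) ℂ H := (exists_hilbertBasis ℂ H).choose_spec.choose

/-- The trace in `[0, ∞]` of an operator (meant for positive operators). -/
def posTrace (T : H →L[ℂ] H) : ℝ≥0∞ :=
  ∑' i, ENNReal.ofReal (⟪stdBasis H i, T (stdBasis H i)⟫_ℂ).re

/-- The trace norm `tr (A* A)^(1/2)`, with values in `[0, ∞]`; note that
`CFC.abs A = CFC.sqrt (star A * A)`. -/
def traceNorm (A : H →L[ℂ] H) : ℝ≥0∞ := posTrace (CFC.abs A)

lemma enorm_sq_eq_tsum {ι : Type*} (b : HilbertBasis ι ℂ H) (x : H) :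
    ‖x‖ₑ ^ 2 = ∑' i, ‖⟪b i, x⟫_ℂ‖ₑ ^ 2 := by
  have h1 : HasSum (fun i => ‖⟪b i, x⟫_ℂ‖ ^ 2) (‖x‖ ^ 2) := by
    have h := Complex.hasSum_re (b.hasSum_inner_mul_inner x x)
    rw [inner_self_eq_norm_sq_to_K] at h
    convert h using 1
    · funext i
      rw [← inner_conj_symm x (b i), ← Complex.normSq_eq_conj_mul_self, Complex.ofReal_re,
        Complex.normSq_eq_norm_sq]
    · norm_cast
  calc ‖x‖ₑ ^ 2 = ENNReal.ofReal (‖x‖ ^ 2) := by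
        rw [ENNReal.ofReal_pow (norm_nonneg _), ofReal_norm]
    _ = ∑' i, ENNReal.ofReal (‖⟪b i, x⟫_ℂ‖ ^ 2) := by
        rw [← h1.tsum_eq, ENNReal.ofReal_tsum_of_nonneg (fun _ => by positivity) h1.summable]
    _ = _ := by
        congr 1; funext i
        rw [ENNReal.ofReal_pow (norm_nonneg _), ofReal_norm]

lemma tsum_adjoint {ι κ : Type*} (b : HilbertBasis ι ℂ H) (c : HilbertBasis κ ℂ H)
    (B : H →L[ℂ] H) :
    ∑' i, ‖B (b i)‖ₑ ^ 2 = ∑' j, ‖(star B) (c j)‖ₑ ^ 2 := by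
  simp_rw [enorm_sq_eq_tsum c (B _), enorm_sq_eq_tsum b ((star B) _)]
  rw [ENNReal.tsum_comm]
  refine tsum_congr fun j => tsum_congr fun i => ?_
  rw [ContinuousLinearMap.star_eq_adjoint, ContinuousLinearMap.adjoint_inner_right,
    ← inner_conj_symm, ← ofReal_norm, ← ofReal_norm, RCLike.norm_conj]

/-- The square of the Hilbert-Schmidt norm. -/
def hsSq (B : H →L[ℂ] H) : ℝ≥0∞ := ∑' i, ‖B (stdBasis H i)‖ₑ ^ 2

lemma hsSq_eq_tsum {ι : Type*} (b : HilbertBasis ι ℂ H) (B : H →L[ℂ] H) :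
    hsSq B = ∑' i, ‖B (b i)‖ₑ ^ 2 := by
  rw [hsSq, tsum_adjoint _ b, tsum_adjoint b b, star_star]

lemma hsSq_star (B : H →L[ℂ] H) : hsSq (star B) = hsSq B := (tsum_adjoint _ _ B).symm

lemma hsSq_mul_le_left {C : H →L[ℂ] H} (hC : ‖C‖ ≤ 1) (B : H →L[ℂ] H) :
    hsSq (C * B) ≤ hsSq B := by
  refine ENNReal.tsum_le_tsum fun i => ?_
  gcongr
  rw [enorm_le_iff_norm_le]
  calc ‖C (B (stdBasis H i))‖ ≤ ‖C‖ * ‖B (stdBasis H i)‖ := C.le_opNorm _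
    _ ≤ 1 * ‖B (stdBasis H i)‖ := by gcongr
    _ = _ := one_mul _

lemma hsSq_mul_le_right {C : H →L[ℂ] H} (hC : ‖C‖ ≤ 1) (B : H →L[ℂ] H) :
    hsSq (B * C) ≤ hsSq B := by
  rw [← hsSq_star, star_mul, ← hsSq_star B]
  exact hsSq_mul_le_left (by rwa [norm_star]) _

lemma posTrace_eq_hsSq {T : H →L[ℂ] H} (hT : 0 ≤ T) : posTrace T = hsSq (CFC.sqrt T) := by
  have hs : star (CFC.sqrt T) = CFC.sqrt T := (CFC.sqrt_nonneg T).isSelfAdjoint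
  refine tsum_congr fun i => ?_
  conv_lhs => rw [← CFC.sqrt_mul_sqrt_self T hT]
  rw [mul_apply_eq_comp]
  nth_rw 1 [← hs]
  rw [ContinuousLinearMap.star_eq_adjoint, ContinuousLinearMap.adjoint_inner_right,
    inner_self_eq_norm_sq_to_K]
  rw [← ofReal_norm, ← ENNReal.ofReal_pow (norm_nonneg _)]
  norm_cast

lemma traceNorm_eq_hsSq (A : H →L[ℂ] H) : traceNorm A = hsSq (CFC.sqrt (CFC.abs A)) :=
  posTrace_eq_hsSq (CFC.abs_nonneg A)

lemma norm_abs_apply (A : H →L[ℂ] H) (x : H) : ‖(CFC.abs A) x‖ = ‖A x‖ := by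
  have hs : star (CFC.abs A) = CFC.abs A := (CFC.abs_nonneg A).isSelfAdjoint
  have h : ⟪(CFC.abs A) x, (CFC.abs A) x⟫_ℂ = ⟪A x, A x⟫_ℂ := by
    rw [← ContinuousLinearMap.adjoint_inner_right, ← ContinuousLinearMap.adjoint_inner_right,
      ← ContinuousLinearMap.star_eq_adjoint, ← ContinuousLinearMap.star_eq_adjoint, hs,
      ← mul_apply_eq_comp, ← mul_apply_eq_comp, CFC.abs_mul_abs]
  rw [inner_self_eq_norm_sq_to_K, inner_self_eq_norm_sq_to_K] at h
  have h' : ‖(CFC.abs A) x‖ ^ 2 = ‖A x‖ ^ 2 := by exact_mod_cast h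
  exact (sq_eq_sq₀ (norm_nonneg _) (norm_nonneg _)).1 h'

/-- Polar decomposition. -/
lemma exists_polar (A : H →L[ℂ] H) :
    ∃ W : H →L[ℂ] H, ‖W‖ ≤ 1 ∧ W * CFC.abs A = A ∧ star W * A = CFC.abs A := by
  set P := CFC.abs A with hP
  set K : Submodule ℂ H := (LinearMap.range P.toLinearMap).topologicalClosure with hK
  have hPK : ∀ x, P x ∈ K := fun x =>
    Submodule.le_topologicalClosure _ (LinearMap.mem_range_self P.toLinearMap x)
  have : CompleteSpace K := (Submodule.isClosed_topologicalClosure _).completeSpace_coe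
  let e : H →ₗ[ℂ] K := LinearMap.codRestrict K P.toLinearMap hPK
  have hdense : DenseRange e := by
    intro y
    have hy : (y : H) ∈ closure (Set.range P) := y.2
    rw [Metric.mem_closure_iff] at hy ⊢
    intro ε hε
    obtain ⟨_, ⟨x, rfl⟩, hx⟩ := hy ε hε
    exact ⟨e x, ⟨x, rfl⟩, hx⟩
  have hnorm : ∀ x, ‖A.toLinearMap x‖ ≤ 1 * ‖e x‖ := fun x => by
    rw [one_mul]; exact (norm_abs_apply A x).ge
  let W₀ : K →L[ℂ] H := A.toLinearMap.extendOfNorm e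
  have hW₀ : ‖W₀‖ ≤ 1 := LinearMap.opNorm_extendOfNorm_le hdense zero_le_one hnorm
  let W : H →L[ℂ] H := W₀ ∘L K.orthogonalProjectionOnto
  have hW : ‖W‖ ≤ 1 := by
    refine (ContinuousLinearMap.opNorm_comp_le _ _).trans ?_
    exact mul_le_one₀ hW₀ (norm_nonneg _) (K.orthogonalProjectionOnto_norm_le)
  have hWP : ∀ x, W (P x) = A x := fun x => by
    have h1 : K.orthogonalProjectionOnto (P x) = e x :=
      Submodule.orthogonalProjectionOnto_mem_subspace_eq_self (e x)
    change W₀ (K.orthogonalProjectionOnto (P x)) = A x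
    rw [h1]
    exact LinearMap.extendOfNorm_eq hdense ⟨1, hnorm⟩ x
  refine ⟨W, hW, ContinuousLinearMap.ext hWP, ContinuousLinearMap.ext fun x => ?_⟩
  have hv : ‖W (P x)‖ = ‖P x‖ := by rw [hWP, norm_abs_apply]
  change (star W) (A x) = P x
  rw [← hWP, ← sub_eq_zero, ← norm_eq_zero]
  have h1 : ‖(star W) (W (P x))‖ ≤ ‖P x‖ := by
    calc ‖(star W) (W (P x))‖ ≤ ‖star W‖ * ‖W (P x)‖ := (star W).le_opNorm _
      _ ≤ 1 * ‖W (P x)‖ := by rw [norm_star]; gcongr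
      _ = ‖P x‖ := by rw [one_mul, hv]
  have h2 : ‖(star W) (W (P x)) - P x‖ ^ 2
      = ‖(star W) (W (P x))‖ ^ 2 - 2 * ‖W (P x)‖ ^ 2 + ‖P x‖ ^ 2 := by
    rw [@norm_sub_sq ℂ, ContinuousLinearMap.star_eq_adjoint,
      ContinuousLinearMap.adjoint_inner_left, inner_self_eq_norm_sq]
  have h3 : ‖(star W) (W (P x))‖ ^ 2 ≤ ‖P x‖ ^ 2 := by gcongr
  rw [hv] at h2
  have h4 : ‖(star W) (W (P x)) - P x‖ ^ 2 ≤ 0 := by linarith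
  exact pow_eq_zero_iff two_ne_zero |>.1 (le_antisymm h4 (by positivity))

lemma tsum_enorm_inner_le {V : H →L[ℂ] H} (hV : ‖V‖ ≤ 1) (A : H →L[ℂ] H) :
    ∑' i, ‖⟪stdBasis H i, V (A (stdBasis H i))⟫_ℂ‖ₑ ≤ traceNorm A := by
  obtain ⟨W, hW, hWA, -⟩ := exists_polar A
  set S := CFC.sqrt (CFC.abs A) with hS
  have hs : star S = S := (CFC.sqrt_nonneg _).isSelfAdjoint
  have hSS : S * S = CFC.abs A := CFC.sqrt_mul_sqrt_self _ (CFC.abs_nonneg A)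
  have hVW : ‖star (V * W)‖ ≤ 1 := by
    rw [norm_star]
    exact (norm_mul_le _ _).trans (mul_le_one₀ hV (norm_nonneg _) hW)
  have key : ∀ x : H, 2 * ‖⟪x, V (A x)⟫_ℂ‖ₑ ≤ ‖(S * star (V * W)) x‖ₑ ^ 2 + ‖S x‖ₑ ^ 2 := by
    intro x
    have h1 : ⟪x, V (A x)⟫_ℂ = ⟪(S * star (V * W)) x, S x⟫_ℂ := by
      have : V (A x) = (V * W) (S (S x)) := by
        conv_lhs => rw [← hWA, ← hSS]
        rfl
      rw [this, mul_apply_eq_comp S, ← ContinuousLinearMap.adjoint_inner_right S,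
        ← ContinuousLinearMap.star_eq_adjoint, hs, ContinuousLinearMap.star_eq_adjoint,
        ContinuousLinearMap.adjoint_inner_left]
    have h2 : 2 * ‖⟪x, V (A x)⟫_ℂ‖ ≤ ‖(S * star (V * W)) x‖ ^ 2 + ‖S x‖ ^ 2 := by
      rw [h1]
      have := norm_inner_le_norm (𝕜 := ℂ) ((S * star (V * W)) x) (S x)
      nlinarith [two_mul_le_add_sq ‖(S * star (V * W)) x‖ ‖S x‖]
    have h3 := ENNReal.ofReal_le_ofReal h2
    rw [ENNReal.ofReal_mul zero_le_two, ENNReal.ofReal_add (by positivity) (by positivity),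
      ENNReal.ofReal_pow (norm_nonneg _), ENNReal.ofReal_pow (norm_nonneg _),
      ofReal_norm, ofReal_norm, ofReal_norm] at h3
    simpa using h3
  have h5 : 2 * ∑' i, ‖⟪stdBasis H i, V (A (stdBasis H i))⟫_ℂ‖ₑ ≤ 2 * traceNorm A := by
    rw [← ENNReal.tsum_mul_left]
    calc _ ≤ ∑' i, (‖(S * star (V * W)) (stdBasis H i)‖ₑ ^ 2 + ‖S (stdBasis H i)‖ₑ ^ 2) :=
          ENNReal.tsum_le_tsum fun i => key _
      _ = hsSq (S * star (V * W)) + hsSq S := ENNReal.tsum_add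
      _ ≤ hsSq S + hsSq S := by gcongr; exact hsSq_mul_le_right hVW S
      _ = 2 * traceNorm A := by rw [traceNorm_eq_hsSq, two_mul]
  exact (ENNReal.mul_le_mul_iff_right (by simp) (by simp)).1 h5

lemma ofReal_re_le_enorm (z : ℂ) : ENNReal.ofReal z.re ≤ ‖z‖ₑ := by
  rw [← ofReal_norm]
  exact ENNReal.ofReal_le_ofReal (Complex.re_le_norm z)

lemma traceNorm_add_le (A B : H →L[ℂ] H) : traceNorm (A + B) ≤ traceNorm A + traceNorm B := by
  obtain ⟨W, hW, -, hW2⟩ := exists_polar (A + B)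
  have hW' : ‖star W‖ ≤ 1 := by rwa [norm_star]
  calc traceNorm (A + B)
      ≤ ∑' i, (‖⟪stdBasis H i, (star W) (A (stdBasis H i))⟫_ℂ‖ₑ
          + ‖⟪stdBasis H i, (star W) (B (stdBasis H i))⟫_ℂ‖ₑ) := by
        rw [traceNorm, posTrace, ← hW2]
        refine ENNReal.tsum_le_tsum fun i => (ofReal_re_le_enorm _).trans ?_
        rw [mul_apply_eq_comp, add_apply, map_add, inner_add_right]
        exact enorm_add_le _ _
    _ ≤ traceNorm A + traceNorm B := by
        rw [ENNReal.tsum_add]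
        exact add_le_add (tsum_enorm_inner_le hW' A) (tsum_enorm_inner_le hW' B)

lemma traceNorm_smul (c : ℂ) (A : H →L[ℂ] H) : traceNorm (c • A) = ‖c‖ₑ * traceNorm A := by
  rw [traceNorm, traceNorm, posTrace, posTrace, CFC.abs_smul, ← ENNReal.tsum_mul_left]
  refine tsum_congr fun i => ?_
  rw [← ofReal_norm, ← ENNReal.ofReal_mul (norm_nonneg _)]
  congr 1
  rw [smul_apply, inner_smul_right_eq_smul]
  simp

lemma traceNorm_zero : traceNorm (0 : H →L[ℂ] H) = 0 := by
  simp [traceNorm, posTrace]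

/-- The operator norm is bounded by the trace norm. -/
lemma enorm_le_traceNorm (A : H →L[ℂ] H) : ‖A‖ₑ ≤ traceNorm A := by
  set S := CFC.sqrt (CFC.abs A) with hS
  have hs : star S = S := (CFC.sqrt_nonneg _).isSelfAdjoint
  have hSS : S * S = CFC.abs A := CFC.sqrt_mul_sqrt_self _ (CFC.abs_nonneg A)
  have h1 : ‖A‖ = ‖S‖ ^ 2 := by
    rw [← CFC.norm_abs (a := A), ← hSS, sq, ← CStarRing.norm_star_mul_self, hs]
  rw [traceNorm_eq_hsSq, ← hS]
  by_cases htop : hsSq S = ∞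
  · rw [htop]; exact le_top
  have h2 : ∀ x : H, ‖S x‖ₑ ^ 2 ≤ hsSq S * ‖x‖ₑ ^ 2 := by
    intro x
    rw [enorm_sq_eq_tsum (stdBasis H) (S x), hsSq, ← ENNReal.tsum_mul_right]
    refine ENNReal.tsum_le_tsum fun i => ?_
    rw [← mul_pow]
    gcongr
    have : ⟪stdBasis H i, S x⟫_ℂ = ⟪S (stdBasis H i), x⟫_ℂ := by
      rw [← ContinuousLinearMap.adjoint_inner_right, ← ContinuousLinearMap.star_eq_adjoint, hs]
    rw [this, ← ofReal_norm, ← ofReal_norm, ← ofReal_norm,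
      ← ENNReal.ofReal_mul (norm_nonneg _)]
    exact ENNReal.ofReal_le_ofReal (norm_inner_le_norm _ _)
  have h3 : ‖S‖ ≤ Real.sqrt (hsSq S).toReal := by
    refine S.opNorm_le_bound (Real.sqrt_nonneg _) fun x => ?_
    have h4 := ENNReal.toReal_mono (ENNReal.mul_ne_top htop (by simp)) (h2 x)
    rw [ENNReal.toReal_mul, ENNReal.toReal_pow, ENNReal.toReal_pow, toReal_enorm,
      toReal_enorm] at h4
    calc ‖S x‖ = Real.sqrt (‖S x‖ ^ 2) := (Real.sqrt_sq (norm_nonneg _)).symm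
      _ ≤ Real.sqrt ((hsSq S).toReal * ‖x‖ ^ 2) := Real.sqrt_le_sqrt h4
      _ = _ := by rw [Real.sqrt_mul ENNReal.toReal_nonneg, Real.sqrt_sq (norm_nonneg _)]
  rw [← ofReal_norm, h1, ← ENNReal.ofReal_toReal htop]
  refine ENNReal.ofReal_le_ofReal ?_
  calc ‖S‖ ^ 2 ≤ Real.sqrt (hsSq S).toReal ^ 2 := by gcongr
    _ = _ := Real.sq_sqrt ENNReal.toReal_nonneg

/-- The trace norm is lower semicontinuous along sequences converging in operator norm. -/
lemma traceNorm_le_of_tendsto {u : ℕ → H →L[ℂ] H} {A : H →L[ℂ] H} {c : ℝ≥0∞}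
    (hu : Tendsto u atTop (𝓝 A)) (hc : ∀ᶠ n in atTop, traceNorm (u n) ≤ c) :
    traceNorm A ≤ c := by
  obtain ⟨W, hW, -, hW2⟩ := exists_polar A
  have hW' : ‖star W‖ ≤ 1 := by rwa [norm_star]
  rw [traceNorm, posTrace, ← hW2, ENNReal.tsum_eq_iSup_sum]
  refine iSup_le fun s => ?_
  have ht : Tendsto (fun n => ∑ i ∈ s, ENNReal.ofReal
      (⟪stdBasis H i, (star W * u n) (stdBasis H i)⟫_ℂ).re) atTop
      (𝓝 (∑ i ∈ s, ENNReal.ofReal (⟪stdBasis H i, (star W * A) (stdBasis H i)⟫_ℂ).re)) := by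
    refine tendsto_finsetSum _ fun i _ => ?_
    have hcont : Continuous fun T : H →L[ℂ] H =>
        ENNReal.ofReal (⟪stdBasis H i, (star W * T) (stdBasis H i)⟫_ℂ).re := by
      refine ENNReal.continuous_ofReal.comp (Complex.continuous_re.comp ?_)
      refine continuous_const.inner ?_
      exact (star W).continuous.comp
        (ContinuousLinearMap.apply ℂ H (stdBasis H i)).continuous
    exact (hcont.tendsto A).comp hu
  refine le_of_tendsto ht (hc.mono fun n hn => ?_)
  calc ∑ i ∈ s, ENNReal.ofReal (⟪stdBasis H i, (star W * u n) (stdBasis H i)⟫_ℂ).re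
      ≤ ∑ i ∈ s, ‖⟪stdBasis H i, (star W) (u n (stdBasis H i))⟫_ℂ‖ₑ :=
        Finset.sum_le_sum fun i _ => ofReal_re_le_enorm _
    _ ≤ ∑' i, ‖⟪stdBasis H i, (star W) (u n (stdBasis H i))⟫_ℂ‖ₑ := ENNReal.sum_le_tsum s
    _ ≤ traceNorm (u n) := tsum_enorm_inner_le hW' _
    _ ≤ c := hn

/-- `A` is of trace class: `tr (A* A)^(1/2) < ∞`. -/
def IsTraceClass (A : H →L[ℂ] H) : Prop := traceNorm A < ∞

end TraceNorm

/-! ## The Banach space of trace class operators -/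

section TraceClass

variable (H : Type u) [NormedAddCommGroup H] [InnerProductSpace ℂ H] [CompleteSpace H]

/-- The trace class operators, as a linear subspace of the bounded operators. -/
def traceClassSubmodule : Submodule ℂ (H →L[ℂ] H) where
  carrier := {A | IsTraceClass A}
  add_mem' {A B} hA hB := (traceNorm_add_le A B).trans_lt (ENNReal.add_lt_top.2 ⟨hA, hB⟩)
  zero_mem' := by simp [IsTraceClass, traceNorm_zero]
  smul_mem' c A hA := by
    change traceNorm (c • A) < ∞
    rw [traceNorm_smul]
    exact ENNReal.mul_lt_top (by simp) hA

/-- The type of trace class operators on `H`; it carries the trace norm. -/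
structure TraceClass : Type u where
  /-- the underlying bounded operator -/
  op : H →L[ℂ] H
  isTraceClass : IsTraceClass op

variable {H}

lemma TraceClass.op_injective : Function.Injective (TraceClass.op (H := H)) := by
  rintro ⟨S, _⟩ ⟨T, _⟩ h
  cases h
  rfl

instance : Zero (TraceClass H) := ⟨⟨0, (traceClassSubmodule H).zero_mem⟩⟩
instance : Add (TraceClass H) :=
  ⟨fun S T => ⟨S.op + T.op, (traceClassSubmodule H).add_mem S.isTraceClass T.isTraceClass⟩⟩
instance : Neg (TraceClass H) :=
  ⟨fun S => ⟨-S.op, (traceClassSubmodule H).neg_mem S.isTraceClass⟩⟩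
instance : Sub (TraceClass H) :=
  ⟨fun S T => ⟨S.op - T.op, (traceClassSubmodule H).sub_mem S.isTraceClass T.isTraceClass⟩⟩
instance : SMul ℂ (TraceClass H) :=
  ⟨fun c S => ⟨c • S.op, (traceClassSubmodule H).smul_mem c S.isTraceClass⟩⟩
instance : SMul ℕ (TraceClass H) :=
  ⟨fun c S => ⟨c • S.op, (traceClassSubmodule H).nsmul_mem S.isTraceClass c⟩⟩
instance : SMul ℤ (TraceClass H) :=
  ⟨fun c S => ⟨c • S.op, (traceClassSubmodule H).toAddSubgroup.zsmul_mem S.isTraceClass c⟩⟩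

lemma TraceClass.op_zero : (0 : TraceClass H).op = 0 := rfl
lemma TraceClass.op_add (S T : TraceClass H) : (S + T).op = S.op + T.op := rfl
lemma TraceClass.op_sub (S T : TraceClass H) : (S - T).op = S.op - T.op := rfl
lemma TraceClass.op_smul (c : ℂ) (T : TraceClass H) : (c • T).op = c • T.op := rfl

instance : AddCommGroup (TraceClass H) :=
  TraceClass.op_injective.addCommGroup _ rfl (fun _ _ => rfl) (fun _ => rfl) (fun _ _ => rfl)
    (fun _ _ => rfl) (fun _ _ => rfl)

/-- The inclusion of the trace class into the bounded operators, as an additive map. -/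
def TraceClass.opHom : TraceClass H →+ (H →L[ℂ] H) where
  toFun := TraceClass.op
  map_zero' := rfl
  map_add' _ _ := rfl

instance : Module ℂ (TraceClass H) :=
  TraceClass.op_injective.module ℂ TraceClass.opHom fun _ _ => rfl

instance : Norm (TraceClass H) := ⟨fun T => (traceNorm T.op).toReal⟩

lemma TraceClass.traceNorm_ne_top (T : TraceClass H) : traceNorm T.op ≠ ∞ :=
  ne_of_lt T.isTraceClass

lemma TraceClass.norm_def (T : TraceClass H) : ‖T‖ = (traceNorm T.op).toReal := rfl

lemma TraceClass.opNorm_le (T : TraceClass H) : ‖T.op‖ ≤ ‖T‖ := by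
  have h := ENNReal.toReal_mono T.traceNorm_ne_top (enorm_le_traceNorm T.op)
  rwa [toReal_enorm] at h

lemma TraceClass.normCore : NormedSpace.Core ℂ (TraceClass H) where
  norm_nonneg _ := ENNReal.toReal_nonneg
  norm_smul c T := by
    rw [TraceClass.norm_def, TraceClass.norm_def, TraceClass.op_smul, traceNorm_smul,
      ENNReal.toReal_mul, toReal_enorm]
  norm_triangle S T := by
    rw [TraceClass.norm_def, TraceClass.norm_def, TraceClass.norm_def, TraceClass.op_add,
      ← ENNReal.toReal_add S.traceNorm_ne_top T.traceNorm_ne_top]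
    exact ENNReal.toReal_mono (ENNReal.add_ne_top.2 ⟨S.traceNorm_ne_top, T.traceNorm_ne_top⟩)
      (traceNorm_add_le _ _)
  norm_eq_zero_iff T := by
    constructor
    · intro h
      have h1 := T.opNorm_le
      rw [h] at h1
      exact TraceClass.op_injective (norm_le_zero_iff.1 h1)
    · rintro rfl
      rw [TraceClass.norm_def, TraceClass.op_zero, traceNorm_zero, ENNReal.toReal_zero]

instance : NormedAddCommGroup (TraceClass H) := NormedAddCommGroup.ofCore TraceClass.normCore

instance : NormedSpace ℂ (TraceClass H) := NormedSpace.ofCore TraceClass.normCore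

instance : CompleteSpace (TraceClass H) := by
  refine Metric.complete_of_cauchySeq_tendsto fun u hu => ?_
  have hop : CauchySeq fun n => (u n).op := by
    rw [Metric.cauchySeq_iff] at hu ⊢
    intro ε hε
    obtain ⟨N, hN⟩ := hu ε hε
    refine ⟨N, fun m hm n hn => lt_of_le_of_lt ?_ (hN m hm n hn)⟩
    rw [dist_eq_norm, dist_eq_norm]
    exact (u m - u n).opNorm_le
  obtain ⟨A, hA⟩ := cauchySeq_tendsto_of_complete hop
  have key : ∀ ε : ℝ, 0 < ε → ∃ N, ∀ m ≥ N, traceNorm ((u m).op - A) ≤ ENNReal.ofReal ε := by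
    intro ε hε
    obtain ⟨N, hN⟩ := Metric.cauchySeq_iff.1 hu ε hε
    refine ⟨N, fun m hm => traceNorm_le_of_tendsto (tendsto_const_nhds.sub hA) ?_⟩
    filter_upwards [eventually_ge_atTop N] with n hn
    have h := (hN m hm n hn).le
    rw [dist_eq_norm, TraceClass.norm_def] at h
    rw [← TraceClass.op_sub, ← ENNReal.ofReal_toReal (u m - u n).traceNorm_ne_top]
    exact ENNReal.ofReal_le_ofReal h
  have hAmem : A ∈ traceClassSubmodule H := by
    obtain ⟨N, hN⟩ := key 1 one_pos
    have h1 : (u N).op - A ∈ traceClassSubmodule H :=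
      lt_of_le_of_lt (hN N le_rfl) ENNReal.ofReal_lt_top
    have h2 := (traceClassSubmodule H).sub_mem (u N).isTraceClass h1
    have h3 : (u N).op - ((u N).op - A) = A := by abel
    exact h3 ▸ h2
  refine ⟨⟨A, hAmem⟩, Metric.tendsto_atTop.2 fun ε hε => ?_⟩
  obtain ⟨N, hN⟩ := key (ε / 2) (half_pos hε)
  refine ⟨N, fun m hm => ?_⟩
  rw [dist_eq_norm, TraceClass.norm_def]
  refine lt_of_le_of_lt (ENNReal.toReal_mono ENNReal.ofReal_ne_top (hN m hm)) ?_
  rw [ENNReal.toReal_ofReal (half_pos hε).le]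
  exact half_lt_self hε

/-- The Borel σ-algebra of the trace norm. -/
instance : MeasurableSpace (TraceClass H) := borel _

instance : BorelSpace (TraceClass H) := ⟨rfl⟩

/-- The trace of a trace class operator (an absolutely convergent sum). -/
def TraceClass.trace (T : TraceClass H) : ℂ := ∑' i, ⟪stdBasis H i, T.op (stdBasis H i)⟫_ℂ

open Classical in
/-- A bounded operator, regarded as an element of the trace class if it is one (and `0` if not). -/
def toTraceClass (A : H →L[ℂ] H) : TraceClass H := if h : IsTraceClass A then ⟨A, h⟩ else 0

variable (H) in
/-- The density operators (quantum states) on `H`. -/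
def densityOperators : Set (TraceClass H) := {T | 0 ≤ T.op ∧ T.trace = 1}

end TraceClass

/-! ## Classical-quantum channels and their information quantity -/

section Channel

variable {X : Type v} [MeasurableSpace X]
  {H : Type u} [NormedAddCommGroup H] [InnerProductSpace ℂ H] [CompleteSpace H]

/-- The output `D_P = E D(X)` of the channel `D` under the input distribution `P`, a Bochner integral
in the trace class. -/
def outputState (P : Measure X) (D : X → TraceClass H) : TraceClass H := ∫ x, D x ∂P

/-- The operator `T log T` (with `0 log 0 = 0`) of a self-adjoint bounded operator `T`. -/
def mulLog (T : H →L[ℂ] H) : H →L[ℂ] H := cfc (fun t : ℝ => t * Real.log t) T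

open Classical in
/-- The information `I(P, D) = E tr (D(X) log D(X)) - tr (D_P log D_P)`, which is `∞` by convention
if `D(X) log D(X)` fails to be of trace class on a non-null set or `D_P log D_P` is not of trace
class. -/
def information (P : Measure X) (D : X → TraceClass H) : EReal :=
  if (∀ᵐ x ∂P, IsTraceClass (mulLog (D x).op)) ∧ IsTraceClass (mulLog (outputState P D).op) then
    (((∫ x, (toTraceClass (mulLog (D x).op)).trace.re ∂P)
      - (toTraceClass (mulLog (outputState P D).op)).trace.re : ℝ) : EReal)
  else ⊤

end Channel

/-! ## Tensor powers of Hilbert spaces and tensor products of operators -/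

section Tensor

/-- A complex inner product space, bundled. -/
structure PreHilb : Type (u + 1) where
  /-- the underlying type -/
  carrier : Type u
  [group : NormedAddCommGroup carrier]
  [inner : InnerProductSpace ℂ carrier]

attribute [instance] PreHilb.group PreHilb.inner

variable (H : Type u) [NormedAddCommGroup H] [InnerProductSpace ℂ H]

/-- The algebraic tensor power `H ⊗ (H ⊗ (⋯ ⊗ ℂ))` with its inner product, where the factor `ℂ` is
realized in the universe of `H`. -/
def algTensorPower : ℕ → PreHilb.{u}
  | 0 => ⟨EuclideanSpace ℂ PUnit.{u + 1}⟩
  | n + 1 => ⟨H ⊗[ℂ] (algTensorPower n).carrier⟩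

/-- The Hilbert space tensor power `H^{⊗n}`: the completion of the algebraic one. -/
abbrev TensorPower (n : ℕ) : Type u := UniformSpace.Completion (algTensorPower H n).carrier

variable {H}

/-- The tensor product of `n` bounded operators on the algebraic tensor power. -/
def algTensorOp : (n : ℕ) → (Fin n → (H →L[ℂ] H)) →
    ((algTensorPower H n).carrier →L[ℂ] (algTensorPower H n).carrier)
  | 0, _ => ContinuousLinearMap.id ℂ _
  | n + 1, A => TensorProduct.mapL (A 0) (algTensorOp n fun i => A i.succ)

/-- The tensor product `A_1 ⊗ ⋯ ⊗ A_n` of bounded operators, on the Hilbert space `H^{⊗n}`. -/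
def tensorOp {n : ℕ} (A : Fin n → (H →L[ℂ] H)) : TensorPower H n →L[ℂ] TensorPower H n :=
  (algTensorOp n A).completion

end Tensor

/-! ## Random codebooks -/

section Codebook

variable {X : Type v} {H : Type u} [NormedAddCommGroup H] [InnerProductSpace ℂ H] [CompleteSpace H]

/-- The channel output density `D_C = (1 / M) ∑_m D^n(C(m))` induced by a codebook `C` of block
length `n` and size `M`, where `D^n(x^n) = D(x_1) ⊗ ⋯ ⊗ D(x_n)`. -/
def codebookOutput (D : X → TraceClass H) {n M : ℕ} (C : Fin M → Fin n → X) :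
    TensorPower H n →L[ℂ] TensorPower H n :=
  (1 / M : ℂ) • ∑ m, tensorOp fun i => (D (C m i)).op

/-- The law of the standard random codebook of block length `n` and size `M`: the codewords are
independent, each with i.i.d. components distributed according to `P`. -/
def codebookLaw [MeasurableSpace X] (P : Measure X) (n M : ℕ) : Measure (Fin M → Fin n → X) :=
  Measure.pi fun _ => Measure.pi fun _ => P

end Codebook

end CQ

end

noncomputable section

namespace CQ

set_option linter.unusedSectionVars false

universe u v

/-! ### Hölder-type bounds for the trace norm; spectral decomposition of positive trace class
operators. -/

section TraceIdeal

variable {H : Type u} [NormedAddCommGroup H] [InnerProductSpace ℂ H] [CompleteSpace H]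

/-! Write `ρ` for the `n`-letter output of a random codeword and `σ = D_P^{⊗n}` for its mean. The
quantity to control is the trace norm of the fluctuation `(1/M) ∑ ρ(C(m)) - σ`. The proof bounds its
expectation by a decaying exponential and then shows that it concentrates.

Concentration: replacing one codeword changes the norm by at most `2/M`, so the bounded differences
inequality gives `P(norm ≥ mean + s) ≤ exp(-M s² / 8)`. With `s` of order `exp(-γ₁ n)`, `M ≥
exp(nR)` and `2 γ₁ < R` this is doubly exponential (`measureReal_le_norm_fluctuation_le`,
`eventually_exponential_bounds`). It requires `R > 0`, which follows from the nonnegativity of the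
information (`trace_mulLog_outputState_le`).

Expectation (`lintegral_enorm_fluctuation_le_of_damp`): typical projections are replaced by the
smooth cutoffs `T = σ(σ+c)⁻¹`, which suppresses the eigenvalues of `σ` below `c`, and `g = c'
ρ(ρ+c')⁻¹`, which caps the eigenvalues of `ρ` at `c'`. The fluctuation of `ρ` is the sum of the
fluctuation of `(1-T)ρ`, `T` times that of `ρ - g`, and `T` times that of `g`. The first two are
small because their summands are: the first by a gentle measurement argument, with bound `2 √(tr
(1-T)² σ)`, the second by `2 E‖ρ - g‖₁`. In the third, `‖T F‖₁ ≤ ‖T‖₂ ‖F‖₂` and the variance of an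
i.i.d. average give `√(c'/(cM))`.

Rates: let `L = tr D_P log D_P`, `E = 𝔼 tr D(X) log D(X)`, so that `I = E - L`, and put `R = I +
4η`, `c = exp(-n(-L+η))`, `c' = exp(n(E+η))`. Then `c'/(cM) ≤ exp(-2ηn)`. The two tails are
estimated by Chernoff bounds: they are dominated by sums of powers `t^(1∓s)` of product eigenvalues,
which factor over the letters. The moment assumption with exponent `α` gives the second order
expansion `∑ a^(1∓s) ≤ 1 ∓ s ∑ a log a + K s² ∑ a^α` (`rpow_one_sub_le`, `rpow_one_add_le`), so for
small `s` both tails decay like `exp(-n s η / 2)`. -/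

lemma two_mul_traceNorm_mul_le (B C : H →L[ℂ] H) :
    2 * traceNorm (B * C) ≤ hsSq B + hsSq C := by
  obtain ⟨W, hW, -, hW2⟩ := exists_polar (B * C)
  have key : ∀ x : H, 2 * ENNReal.ofReal (⟪x, (CFC.abs (B * C)) x⟫_ℂ).re
      ≤ ‖(star B * W) x‖ₑ ^ 2 + ‖C x‖ₑ ^ 2 := by
    intro x
    -- With the polar factor `W`, `|BC| = W* B C`. Moving `W* B` to the left entry prepares
    -- Cauchy–Schwarz.
    have h1 : ⟪x, (CFC.abs (B * C)) x⟫_ℂ = ⟪(star B * W) x, C x⟫_ℂ := by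
      rw [← hW2, ContinuousLinearMap.star_eq_adjoint, ContinuousLinearMap.star_eq_adjoint,
        mul_apply_eq_comp, mul_apply_eq_comp, mul_apply_eq_comp,
        ContinuousLinearMap.adjoint_inner_right, ContinuousLinearMap.adjoint_inner_left]
    have h2 : 2 * ‖⟪x, (CFC.abs (B * C)) x⟫_ℂ‖ ≤ ‖(star B * W) x‖ ^ 2 + ‖C x‖ ^ 2 := by
      rw [h1]
      have := norm_inner_le_norm (𝕜 := ℂ) ((star B * W) x) (C x)
      nlinarith [two_mul_le_add_sq ‖(star B * W) x‖ ‖C x‖]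
    have h3 := ENNReal.ofReal_le_ofReal h2
    rw [ENNReal.ofReal_mul zero_le_two, ENNReal.ofReal_add (by positivity) (by positivity),
      ENNReal.ofReal_pow (norm_nonneg _), ENNReal.ofReal_pow (norm_nonneg _),
      ofReal_norm, ofReal_norm, ofReal_norm] at h3
    refine le_trans ?_ (by simpa using h3)
    gcongr
    exact ofReal_re_le_enorm _
  calc 2 * traceNorm (B * C)
      ≤ ∑' i, (‖(star B * W) (stdBasis H i)‖ₑ ^ 2 + ‖C (stdBasis H i)‖ₑ ^ 2) := by
        rw [traceNorm, posTrace, ← ENNReal.tsum_mul_left]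
        exact ENNReal.tsum_le_tsum fun i => key _
    _ = hsSq (star B * W) + hsSq C := ENNReal.tsum_add
    _ ≤ hsSq B + hsSq C := by
        gcongr
        exact (hsSq_mul_le_right hW _).trans (hsSq_star B).le

lemma hsSq_smul (c : ℂ) (B : H →L[ℂ] H) : hsSq (c • B) = ‖c‖ₑ ^ 2 * hsSq B := by
  rw [hsSq, hsSq, ← ENNReal.tsum_mul_left]
  refine tsum_congr fun i => ?_
  rw [smul_apply, enorm_smul, mul_pow]

/-- Rescaling the factors by `√ε` and `1/√ε`. Optimizing over `ε` would give `‖B‖₂ ‖C‖₂`; the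
weighted form avoids square roots and products in `[0, ∞]` and can be integrated directly. -/
lemma traceNorm_mul_le_of_pos {ε : ℝ} (hε : 0 < ε) (B C : H →L[ℂ] H) :
    2 * traceNorm (B * C) ≤ ENNReal.ofReal ε * hsSq B + ENNReal.ofReal (1 / ε) * hsSq C := by
  have h := two_mul_traceNorm_mul_le (((Real.sqrt ε : ℝ) : ℂ) • B) (((Real.sqrt ε : ℝ) : ℂ)⁻¹ • C)
  have hs : ((Real.sqrt ε : ℝ) : ℂ) ≠ 0 := by
    exact_mod_cast (Real.sqrt_pos.2 hε).ne'
  rw [smul_mul_smul_comm, mul_inv_cancel₀ hs, one_smul, hsSq_smul, hsSq_smul] at h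
  convert h using 3
  · rw [← ofReal_norm, ← ENNReal.ofReal_pow (norm_nonneg _), Complex.norm_real,
      Real.norm_of_nonneg (Real.sqrt_nonneg _), Real.sq_sqrt hε.le]
  · rw [← ofReal_norm, ← ENNReal.ofReal_pow (norm_nonneg _), norm_inv, Complex.norm_real,
      Real.norm_of_nonneg (Real.sqrt_nonneg _), inv_pow, Real.sq_sqrt hε.le, one_div]

lemma traceNorm_mul_le_of_norm_le_one {B : H →L[ℂ] H} (hB : ‖B‖ ≤ 1) (A : H →L[ℂ] H) :
    traceNorm (B * A) ≤ traceNorm A := by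
  obtain ⟨W, hW, hWA, -⟩ := exists_polar A
  set S := CFC.sqrt (CFC.abs A) with hS
  have hSS : S * S = CFC.abs A := CFC.sqrt_mul_sqrt_self _ (CFC.abs_nonneg A)
  have h : 2 * traceNorm (B * A) ≤ 2 * traceNorm A := by
    calc 2 * traceNorm (B * A) = 2 * traceNorm ((B * W * S) * S) := by
          rw [mul_assoc, hSS, mul_assoc, hWA]
      _ ≤ hsSq (B * W * S) + hsSq S := two_mul_traceNorm_mul_le _ _
      _ ≤ hsSq S + hsSq S := by
          gcongr
          exact hsSq_mul_le_left ((norm_mul_le _ _).trans (mul_le_one₀ hB (norm_nonneg _) hW)) _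
      _ = 2 * traceNorm A := by rw [traceNorm_eq_hsSq, two_mul]
  exact (ENNReal.mul_le_mul_iff_right (by simp) (by simp)).1 h

lemma traceNorm_mul_le (B A : H →L[ℂ] H) : traceNorm (B * A) ≤ ‖B‖ₑ * traceNorm A := by
  by_cases hB : ‖B‖ = 0
  · rw [norm_eq_zero] at hB
    simp [hB, traceNorm_zero]
  have hc : (‖B‖ : ℂ) ≠ 0 := by exact_mod_cast hB
  have h1 : B = (‖B‖ : ℂ) • ((‖B‖ : ℂ)⁻¹ • B) := by rw [smul_smul, mul_inv_cancel₀ hc, one_smul]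
  have h2 : ‖(‖B‖ : ℂ)⁻¹ • B‖ ≤ 1 := by
    rw [norm_smul, norm_inv, Complex.norm_real, norm_norm, inv_mul_cancel₀ hB]
  calc traceNorm (B * A) = traceNorm ((‖B‖ : ℂ) • (((‖B‖ : ℂ)⁻¹ • B) * A)) := by
        rw [← smul_mul_assoc, ← h1]
    _ = ‖B‖ₑ * traceNorm (((‖B‖ : ℂ)⁻¹ • B) * A) := by
        rw [traceNorm_smul]
        congr 1
        rw [← ofReal_norm, Complex.norm_real, norm_norm, ofReal_norm]
    _ ≤ _ := by gcongr; exact traceNorm_mul_le_of_norm_le_one h2 A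

/-- For positive operators the trace is the squared Hilbert–Schmidt norm of the square root, which
does not depend on the basis. -/
lemma posTrace_eq_tsum {ι : Type*} (b : HilbertBasis ι ℂ H) {T : H →L[ℂ] H} (hT : 0 ≤ T) :
    posTrace T = ∑' i, ENNReal.ofReal (⟪b i, T (b i)⟫_ℂ).re := by
  have hs : star (CFC.sqrt T) = CFC.sqrt T := (CFC.sqrt_nonneg T).isSelfAdjoint
  rw [posTrace_eq_hsSq hT, hsSq_eq_tsum b]
  refine tsum_congr fun i => ?_
  conv_rhs => rw [← CFC.sqrt_mul_sqrt_self T hT]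
  rw [mul_apply_eq_comp]
  nth_rw 2 [← hs]
  rw [ContinuousLinearMap.star_eq_adjoint, ContinuousLinearMap.adjoint_inner_right,
    inner_self_eq_norm_sq_to_K]
  rw [← ofReal_norm, ← ENNReal.ofReal_pow (norm_nonneg _)]
  norm_cast

lemma traceNorm_of_nonneg {T : H →L[ℂ] H} (hT : 0 ≤ T) : traceNorm T = posTrace T := by
  rw [traceNorm, CFC.abs_of_nonneg T hT]

lemma traceNorm_eq_tsum_of_diag {ι : Type*} (b : HilbertBasis ι ℂ H) {T : H →L[ℂ] H} (hT : 0 ≤ T)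
    {a : ι → ℝ} (ha : ∀ i, T (b i) = (a i : ℂ) • b i) :
    traceNorm T = ∑' i, ENNReal.ofReal (a i) := by
  rw [traceNorm_of_nonneg hT, posTrace_eq_tsum b hT]
  refine tsum_congr fun i => ?_
  rw [ha, inner_smul_right, inner_self_eq_norm_sq_to_K, b.orthonormal.1 i]
  simp

lemma hsSq_eq_tsum_of_diag {ι : Type*} (b : HilbertBasis ι ℂ H) {T : H →L[ℂ] H}
    {a : ι → ℝ} (ha : ∀ i, T (b i) = (a i : ℂ) • b i) :
    hsSq T = ∑' i, ENNReal.ofReal (a i ^ 2) := by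
  rw [hsSq_eq_tsum b]
  refine tsum_congr fun i => ?_
  rw [ha, enorm_smul, mul_pow, ← ofReal_norm (b i), b.orthonormal.1 i, ← ofReal_norm,
    ← ENNReal.ofReal_pow (norm_nonneg _), Complex.norm_real, Real.norm_eq_abs, sq_abs]
  simp

/-- The quadratic form at `x` is `∑ a_i |⟨b_i, x⟩|²`, hence real and nonnegative; on a complex space
this already implies self-adjointness. -/
lemma nonneg_of_diag {ι : Type*} (b : HilbertBasis ι ℂ H) {T : H →L[ℂ] H}
    {a : ι → ℝ} (ha0 : ∀ i, 0 ≤ a i) (ha : ∀ i, T (b i) = (a i : ℂ) • b i) : 0 ≤ T := by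
  rw [ContinuousLinearMap.nonneg_iff_isPositive, ContinuousLinearMap.isPositive_iff_complex]
  intro x
  have h1 : HasSum (fun i => ((a i * ‖⟪b i, x⟫_ℂ‖ ^ 2 : ℝ) : ℂ)) ⟪T x, x⟫_ℂ := by
    have h2 := (b.hasSum_repr x).mapL T
    have h3 := h2.mapL (innerSL ℂ x)
    have h4 := h3.star
    simp only [innerSL_apply_apply] at h4
    convert! h4 using 1
    · funext i
      rw [map_smul, ha, inner_smul_right, inner_smul_right, b.repr_apply_apply,
        ← inner_conj_symm x (b i)]
      simp only [RCLike.star_def, map_mul, Complex.conj_conj, Complex.conj_ofReal]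
      rw [← inner_conj_symm (b i) x]
      push_cast
      rw [← Complex.conj_mul']
      ring
    · exact (inner_conj_symm _ _).symm
  have hre := Complex.hasSum_re h1
  have him := Complex.hasSum_im h1
  simp only [Complex.ofReal_re, Complex.ofReal_im] at hre him
  have h0 := him.unique hasSum_zero
  refine ⟨?_, ?_⟩
  · apply Complex.ext
    · simp
    · simp [h0]
  · exact hre.nonneg fun i => mul_nonneg (ha0 i) (by positivity)

open scoped ComplexOrder in
/-- The spectral theorem for positive compact operators, in terms of a Hilbert basis. -/
lemma exists_hilbertBasis_of_isCompactOperator {T : H →L[ℂ] H} (hT : 0 ≤ T)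
    (hc : IsCompactOperator T) :
    ∃ (ι : Type u) (b : HilbertBasis ι ℂ H) (a : ι → ℝ), (∀ i, 0 ≤ a i) ∧
      ∀ i, T (b i) = (a i : ℂ) • b i := by
  have hpos := (ContinuousLinearMap.nonneg_iff_isPositive T).1 hT
  have hsym : (T : H →ₗ[ℂ] H).IsSymmetric := hpos.isSymmetric
  have hclosed : ∀ μ : ℂ,
      IsClosed ((Module.End.eigenspace (T : H →ₗ[ℂ] H) μ : Submodule ℂ H) : Set H) := by
    intro μ
    have : ((Module.End.eigenspace (T : H →ₗ[ℂ] H) μ : Submodule ℂ H) : Set H)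
        = {x | T x = μ • x} := by
      ext x
      exact Module.End.mem_eigenspace_iff
    rw [this]
    exact isClosed_eq T.continuous (continuous_const_smul μ)
  have hcs : ∀ μ : ℂ, CompleteSpace (Module.End.eigenspace (T : H →ₗ[ℂ] H) μ) := fun μ =>
    (hclosed μ).completeSpace_coe
  choose w c hcw using fun μ : ℂ => exists_hilbertBasis ℂ (Module.End.eigenspace (T : H →ₗ[ℂ] H) μ)
  have hon : Orthonormal ℂ fun p : Σ μ : ℂ, w μ => ((c p.1 p.2 : _) : H) :=
    hsym.orthogonalFamily_eigenspaces.orthonormal_sigma_orthonormal fun μ => (c μ).orthonormal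
  -- A vector orthogonal to the chosen bases of all eigenspaces is orthogonal to the eigenspaces
  -- themselves, and for a compact symmetric operator these have trivial common orthogonal
  -- complement.
  have hbot :
      (Submodule.span ℂ (Set.range fun p : Σ μ : ℂ, w μ => ((c p.1 p.2 : _) : H)))ᗮ = ⊥ := by
    have hS := ContinuousLinearMap.orthogonalComplement_iSup_eigenspaces_eq_bot hc hsym
    rw [eq_bot_iff, ← hS, ← Submodule.iInf_orthogonal]
    intro x hx
    rw [Submodule.mem_iInf]
    intro μ y hy
    have hdense := (c μ).dense_span
    have hy' : (⟨y, hy⟩ : Module.End.eigenspace (T : H →ₗ[ℂ] H) μ) ∈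
        (Submodule.span ℂ (Set.range (c μ))).topologicalClosure := by rw [hdense]; trivial
    have hcl : IsClosed {z : Module.End.eigenspace (T : H →ₗ[ℂ] H) μ | ⟪(z : H), x⟫_ℂ = 0} :=
      isClosed_eq (by fun_prop) continuous_const
    refine closure_minimal ?_ hcl hy'
    intro z hz
    change ⟪(z : H), x⟫_ℂ = 0
    induction hz using Submodule.span_induction with
    | mem z hz =>
      obtain ⟨k, rfl⟩ := hz
      exact hx _ (Submodule.subset_span ⟨⟨μ, k⟩, rfl⟩)
    | zero => simp
    | add z z' _ _ h1 h2 => simp [h1, h2]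
    | smul r z _ h1 => simp [h1]
  refine ⟨_, HilbertBasis.mkOfOrthogonalEqBot hon hbot, fun p => p.1.re, fun p => ?_, fun p => ?_⟩
  all_goals
    have hp : T (c p.1 p.2 : H) = p.1 • (c p.1 p.2 : H) :=
      Module.End.mem_eigenspace_iff.1 (c p.1 p.2).2
    have hp1 : ‖(c p.1 p.2 : H)‖ = 1 := (c p.1).orthonormal.1 p.2
    have hp2 : (0 : ℂ) ≤ p.1 := by
      have h := hpos.inner_nonneg_right (c p.1 p.2 : H)
      rw [hp, inner_smul_right, inner_self_eq_norm_sq_to_K, hp1] at h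
      simpa using h
  · exact (Complex.le_def.1 hp2).1
  · rw [HilbertBasis.coe_mkOfOrthogonalEqBot, hp]
    congr 1
    apply Complex.ext
    · simp
    · simpa using (Complex.le_def.1 hp2).2.symm

/-- The finite sum is `A P_F`, with `P_F` the projection onto the span of `b i`, `i ∈ F`. Factoring
`A = (W S) S` with `S = √|A|` reduces the error to the Hilbert–Schmidt norm of `S (1 - P_F)`, a tail
of the convergent series `∑ ‖S b_i‖²`. -/
lemma exists_traceNorm_sub_sum_rankOne_le {ι : Type*} (b : HilbertBasis ι ℂ H) {A : H →L[ℂ] H}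
    (hA : IsTraceClass A) {ε : ℝ} (hε : 0 < ε) :
    ∃ F : Finset ι, traceNorm (A - ∑ i ∈ F, InnerProductSpace.rankOne ℂ (A (b i)) (b i))
      ≤ ENNReal.ofReal ε := by
  classical
  obtain ⟨W, hW, hWA, -⟩ := exists_polar A
  set S := CFC.sqrt (CFC.abs A) with hS
  have hSS : S * S = CFC.abs A := CFC.sqrt_mul_sqrt_self _ (CFC.abs_nonneg A)
  have hSt : hsSq S = traceNorm A := (traceNorm_eq_hsSq A).symm
  set t : ℝ := (traceNorm A).toReal with ht
  have htt : traceNorm A = ENNReal.ofReal t := (ENNReal.ofReal_toReal hA.ne).symm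
  have ht0 : 0 ≤ t := ENNReal.toReal_nonneg
  -- Weight of the product inequality: `δ t ≤ ε` for the first term, and a tail below `ε δ` makes
  -- the second term at most `ε`. The `+ 1` covers `t = 0`.
  set δ : ℝ := ε / (t + 1) with hδ
  have hδ0 : 0 < δ := by positivity
  have hsum : ∑' i, ‖S (b i)‖ₑ ^ 2 ≠ ∞ := by
    rw [← hsSq_eq_tsum b, hSt]; exact hA.ne
  have htail := ENNReal.tendsto_tsum_compl_atTop_zero hsum
  have hpos : (0 : ℝ≥0∞) < ENNReal.ofReal (ε * δ) := ENNReal.ofReal_pos.2 (by positivity)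
  obtain ⟨F, hF⟩ := (htail.eventually (eventually_le_nhds hpos)).exists
  refine ⟨F, ?_⟩
  set Q : H →L[ℂ] H := ∑ i ∈ F, InnerProductSpace.rankOne ℂ (S (b i)) (b i) with hQ
  have hrank : ∀ i j, InnerProductSpace.rankOne ℂ (S (b i)) (b i) (b j)
      = if i = j then S (b i) else 0 := by
    intro i j
    rw [InnerProductSpace.rankOne_apply, orthonormal_iff_ite.1 b.orthonormal i j]
    split_ifs <;> simp
  have hQb : ∀ j, (S - Q) (b j) = if j ∈ F then 0 else S (b j) := by
    intro j
    rw [sub_apply, hQ, sum_apply]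
    simp only [hrank]
    rw [Finset.sum_ite_eq' F j]
    split_ifs <;> simp
  have hSQ : hsSq (S - Q) ≤ ENNReal.ofReal (ε * δ) := by
    refine le_trans (le_of_eq ?_) hF
    rw [hsSq_eq_tsum b]
    rw [← tsum_subtype_eq_of_support_subset (s := {x | x ∉ F})]
    · refine tsum_congr fun i => ?_
      rw [hQb, if_neg i.2]
    · intro j hj
      by_contra hjF
      simp only [Set.mem_ofPred_eq, not_not] at hjF
      simp [hQb, hjF] at hj
  have heq : A - ∑ i ∈ F, InnerProductSpace.rankOne ℂ (A (b i)) (b i) = (W * S) * (S - Q) := by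
    have hA' : A = W * S * S := by rw [mul_assoc, hSS, hWA]
    rw [mul_sub, ← hA', hQ, Finset.mul_sum]
    congr 1
    refine Finset.sum_congr rfl fun i _ => ?_
    ext x
    conv_lhs => rw [hA']
    simp [InnerProductSpace.rankOne_apply]
  rw [heq]
  have h1 := traceNorm_mul_le_of_pos hδ0 (W * S) (S - Q)
  have h2 : 2 * traceNorm (W * S * (S - Q)) ≤ 2 * ENNReal.ofReal ε := by
    refine h1.trans ?_
    calc _ ≤ ENNReal.ofReal δ * ENNReal.ofReal t
          + ENNReal.ofReal (1 / δ) * ENNReal.ofReal (ε * δ) := by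
          gcongr
          exact (hsSq_mul_le_left hW S).trans (hSt.trans htt).le
      _ ≤ 2 * ENNReal.ofReal ε := by
          rw [← ENNReal.ofReal_mul hδ0.le, ← ENNReal.ofReal_mul (by positivity), two_mul]
          gcongr
          · rw [hδ, div_mul_eq_mul_div, div_le_iff₀ (by positivity)]
            nlinarith
          · rw [one_div, mul_comm ε, ← mul_assoc, inv_mul_cancel₀ hδ0.ne', one_mul]
  exact (ENNReal.mul_le_mul_iff_right (by simp) (by simp)).1 h2

lemma isCompactOperator_rankOne (x y : H) :
    IsCompactOperator (InnerProductSpace.rankOne ℂ x y : H →L[ℂ] H) := by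
  have h : IsCompactOperator (ContinuousLinearMap.toSpanSingleton ℂ x) :=
    isCompactOperator_of_locallyCompactSpace_rng _
  exact h.comp_clm (innerSL ℂ y)

/-- Finite rank approximation in trace norm is also approximation in operator norm. Compactness
makes the spectral theorem available. -/
lemma IsTraceClass.isCompactOperator {A : H →L[ℂ] H} (hA : IsTraceClass A) :
    IsCompactOperator A := by
  choose F hF using fun n : ℕ => exists_traceNorm_sub_sum_rankOne_le (stdBasis H) hA
    (ε := 1 / ((n : ℝ) + 1)) (by positivity)
  have hlim : Tendsto (fun n => ∑ i ∈ F n,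
      InnerProductSpace.rankOne ℂ (A (stdBasis H i)) (stdBasis H i)) atTop (𝓝 A) := by
    rw [tendsto_iff_norm_sub_tendsto_zero]
    refine squeeze_zero (fun _ => norm_nonneg _) (fun n => ?_)
      tendsto_one_div_add_atTop_nhds_zero_nat
    have h := (enorm_le_traceNorm _).trans (hF n)
    rw [← ofReal_norm, norm_sub_rev] at h
    exact (ENNReal.ofReal_le_ofReal_iff (by positivity)).1 h
  refine isCompactOperator_of_tendsto hlim (Eventually.of_forall fun n => ?_)
  have : (∑ i ∈ F n, InnerProductSpace.rankOne ℂ (A (stdBasis H i)) (stdBasis H i) : H →L[ℂ] H)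
      ∈ compactOperator (RingHom.id ℂ) H H :=
    Submodule.sum_mem _ fun i _ => isCompactOperator_rankOne _ _
  exact this

lemma exists_eigenbasis {T : H →L[ℂ] H} (hT : 0 ≤ T) (hc : IsTraceClass T) :
    ∃ (ι : Type u) (b : HilbertBasis ι ℂ H) (a : ι → ℝ), (∀ i, 0 ≤ a i) ∧
      ∀ i, T (b i) = (a i : ℂ) • b i :=
  exists_hilbertBasis_of_isCompactOperator hT hc.isCompactOperator

/-- The continuous functional calculus acts on eigenvectors through the eigenvalue. -/
lemma cfc_apply_of_eigenvector {T : H →L[ℂ] H} (hT : IsSelfAdjoint T) {f : ℝ → ℝ}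
    (hf : ContinuousOn f (spectrum ℝ T)) {v : H} {p : ℝ} (hv : T v = (p : ℂ) • v) (hv0 : v ≠ 0) :
    cfc f T v = (f p : ℂ) • v := by
  -- `p - T` kills `v ≠ 0`, so it is not invertible.
  have hp : p ∈ spectrum ℝ T := by
    intro hu
    apply hv0
    obtain ⟨R, hR⟩ := hu
    have h1 : (algebraMap ℝ (H →L[ℂ] H) p - T) v = 0 := by
      rw [sub_apply, hv, Algebra.algebraMap_eq_smul_one]
      simp
    have h2 : ((↑R⁻¹ : H →L[ℂ] H) * (↑R : H →L[ℂ] H)) v = 0 := by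
      rw [hR, mul_apply_eq_comp, h1, map_zero]
    simpa using h2
  rw [cfc_apply f T hT hf]
  -- The functions acting on `v` as evaluation at `p` form a closed subalgebra containing the
  -- identity, hence are all continuous functions on the compact spectrum.
  have key : ∀ g : C(spectrum ℝ T, ℝ), cfcHom hT g v = (g ⟨p, hp⟩ : ℂ) • v := by
    intro g
    have : CompactSpace (spectrum ℝ T) := by infer_instance
    induction g using ContinuousMap.induction_on_of_compact with
    | const r =>
      have : ContinuousMap.const (spectrum ℝ T) r
          = algebraMap ℝ C(spectrum ℝ T, ℝ) r := rfl
      rw [this, AlgHomClass.commutes, Algebra.algebraMap_eq_smul_one]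
      simp
    | id =>
      rw [cfcHom_id hT, hv]
      simp
    | star_id =>
      have : star (ContinuousMap.restrict (spectrum ℝ T) (.id ℝ))
          = ContinuousMap.restrict (spectrum ℝ T) (.id ℝ) := by ext; simp
      rw [this, cfcHom_id hT, hv]
      simp
    | add g h hg hh => rw [map_add, add_apply, hg, hh, ← add_smul]; simp
    | mul g h hg hh =>
      rw [map_mul, mul_apply_eq_comp, hh, map_smul, hg, smul_smul]
      simp [mul_comm]
    | frequently g hg =>
      have hcl : IsClosed {g : C(spectrum ℝ T, ℝ) | cfcHom hT g v = (g ⟨p, hp⟩ : ℂ) • v} := by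
        refine isClosed_eq ?_ ?_
        · exact (ContinuousLinearMap.apply ℂ H v).continuous.comp (cfcHom_continuous hT)
        · exact (Complex.continuous_ofReal.comp (continuous_eval_const _)).smul
            continuous_const
      exact hcl.closure_subset (mem_closure_iff_frequently.2 hg)
  exact key _

lemma rpow_apply_of_eigenvector {T : H →L[ℂ] H} (hT : 0 ≤ T) {α : ℝ} (hα : 0 < α)
    {v : H} {p : ℝ} (hv : T v = (p : ℂ) • v) (hv0 : v ≠ 0) :
    (T ^ α) v = ((p ^ α : ℝ) : ℂ) • v := by
  rw [CFC.rpow_eq_cfc_real hT]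
  exact cfc_apply_of_eigenvector hT.isSelfAdjoint
    (Real.continuous_rpow_const hα.le).continuousOn hv hv0

lemma mulLog_apply_of_eigenvector {T : H →L[ℂ] H} (hT : 0 ≤ T)
    {v : H} {p : ℝ} (hv : T v = (p : ℂ) • v) (hv0 : v ≠ 0) :
    mulLog T v = ((p * Real.log p : ℝ) : ℂ) • v :=
  cfc_apply_of_eigenvector hT.isSelfAdjoint Real.continuous_mul_log.continuousOn hv hv0

end TraceIdeal

/-! ### Continuous maps on the trace class and its separability. -/

section TraceClassSpace

variable {H : Type u} [NormedAddCommGroup H] [InnerProductSpace ℂ H] [CompleteSpace H]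

namespace TraceClass

/-- The inclusion of the trace class into the bounded operators. -/
def opL : TraceClass H →L[ℂ] (H →L[ℂ] H) :=
  LinearMap.mkContinuous ⟨⟨op, op_add⟩, op_smul⟩ 1 fun T => by
    rw [one_mul]; exact T.opNorm_le

@[simp] lemma opL_apply (T : TraceClass H) : opL T = T.op := rfl

/-- The matrix element `⟨u, T v⟩` of a trace class operator, as a continuous functional. -/
def matrixElement (u v : H) : TraceClass H →L[ℂ] ℂ :=
  (innerSL ℂ u) ∘L (ContinuousLinearMap.apply ℂ H v) ∘L opL

@[simp] lemma matrixElement_apply (u v : H) (T : TraceClass H) :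
    matrixElement u v T = ⟪u, T.op v⟫_ℂ := rfl

lemma ofReal_norm_eq (T : TraceClass H) : ENNReal.ofReal ‖T‖ = traceNorm T.op :=
  ENNReal.ofReal_toReal T.traceNorm_ne_top

lemma norm_le_of_traceNorm_le {T : TraceClass H} {c : ℝ} (hc : 0 ≤ c)
    (h : traceNorm T.op ≤ ENNReal.ofReal c) : ‖T‖ ≤ c := by
  rw [← ofReal_norm_eq] at h
  exact (ENNReal.ofReal_le_ofReal_iff hc).1 h

lemma isTraceClass_mul (B : H →L[ℂ] H) (T : TraceClass H) : IsTraceClass (B * T.op) :=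
  (traceNorm_mul_le B T.op).trans_lt (ENNReal.mul_lt_top (by simp) T.isTraceClass)

/-- Left multiplication of trace class operators by bounded operators. -/
def mulLeft : (H →L[ℂ] H) →L[ℂ] TraceClass H →L[ℂ] TraceClass H :=
  LinearMap.mkContinuous₂
    (LinearMap.mk₂ ℂ (fun B T => (⟨B * T.op, isTraceClass_mul B T⟩ : TraceClass H))
      (fun _ _ _ => op_injective (add_mul _ _ _))
      (fun _ _ _ => op_injective (smul_mul_assoc _ _ _))
      (fun _ _ _ => op_injective (mul_add _ _ _))
      (fun _ _ _ => op_injective (mul_smul_comm _ _ _))) 1 fun B T => by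
    refine norm_le_of_traceNorm_le (by positivity) ?_
    rw [one_mul, ENNReal.ofReal_mul (norm_nonneg _), ofReal_norm, ofReal_norm_eq]
    exact traceNorm_mul_le B T.op

@[simp] lemma op_mulLeft (B : H →L[ℂ] H) (T : TraceClass H) : (mulLeft B T).op = B * T.op := rfl

lemma norm_mulLeft_le (B : H →L[ℂ] H) (T : TraceClass H) : ‖mulLeft B T‖ ≤ ‖B‖ * ‖T‖ := by
  refine norm_le_of_traceNorm_le (by positivity) ?_
  rw [ENNReal.ofReal_mul (norm_nonneg _), ofReal_norm, ofReal_norm_eq]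
  exact traceNorm_mul_le B T.op

lemma hasSum_trace (T : TraceClass H) :
    HasSum (fun i => ⟪stdBasis H i, T.op (stdBasis H i)⟫_ℂ) T.trace := by
  refine Summable.hasSum (Summable.of_norm ?_)
  have h : ∑' i, ‖⟪stdBasis H i, T.op (stdBasis H i)⟫_ℂ‖ₑ ≠ ∞ := by
    have h1 := tsum_enorm_inner_le (V := (1 : H →L[ℂ] H)) ContinuousLinearMap.norm_id_le T.op
    exact (h1.trans_lt T.isTraceClass).ne
  simpa using ENNReal.summable_toReal h

lemma norm_trace_le (T : TraceClass H) : ‖T.trace‖ ≤ ‖T‖ := by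
  have h1 := tsum_enorm_inner_le (V := (1 : H →L[ℂ] H)) ContinuousLinearMap.norm_id_le T.op
  have h2 : ‖T.trace‖ₑ ≤ traceNorm T.op := (enorm_tsum_le_tsum_enorm).trans h1
  rw [← ofReal_norm, ← ofReal_norm_eq] at h2
  exact (ENNReal.ofReal_le_ofReal_iff (norm_nonneg _)).1 h2

/-- The trace as a continuous linear functional. -/
def traceL : TraceClass H →L[ℂ] ℂ :=
  LinearMap.mkContinuous
    ⟨⟨trace, fun S T => ((hasSum_trace (S + T)).unique
      (by simpa [op_add, inner_add_right] using! (hasSum_trace S).add (hasSum_trace T)))⟩,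
      fun c T => ((hasSum_trace (c • T)).unique
      (by simpa [op_smul, inner_smul_right] using! (hasSum_trace T).mul_left c))⟩ 1 fun T => by
    rw [one_mul]; exact norm_trace_le T

@[simp] lemma traceL_apply (T : TraceClass H) : traceL T = T.trace := rfl

lemma trace_re_eq_norm {T : TraceClass H} (hT : 0 ≤ T.op) : T.trace.re = ‖T‖ := by
  have h := Complex.hasSum_re (hasSum_trace T)
  have hpos := (ContinuousLinearMap.nonneg_iff_isPositive T.op).1 hT
  have h0 : ∀ i, 0 ≤ (⟪stdBasis H i, T.op (stdBasis H i)⟫_ℂ).re := fun i =>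
    hpos.re_inner_nonneg_right _
  rw [norm_def, traceNorm_of_nonneg hT, posTrace, ← h.tsum_eq,
    ← ENNReal.ofReal_tsum_of_nonneg h0 h.summable, ENNReal.toReal_ofReal (tsum_nonneg h0)]

lemma ext_matrixElement {ι : Type*} (b : HilbertBasis ι ℂ H) {S T : TraceClass H}
    (h : ∀ i j, ⟪b i, S.op (b j)⟫_ℂ = ⟪b i, T.op (b j)⟫_ℂ) : S = T := by
  apply op_injective
  refine ContinuousLinearMap.ext_on
    (Submodule.dense_iff_topologicalClosure_eq_top.2 b.dense_span) ?_
  rintro _ ⟨j, rfl⟩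
  apply b.repr.injective
  ext i
  rw [b.repr_apply_apply, b.repr_apply_apply, h]

end TraceClass

lemma toTraceClass_op {A : H →L[ℂ] H} (hA : IsTraceClass A) : (toTraceClass A).op = A := by
  rw [toTraceClass, dif_pos hA]

lemma norm_of_mem_densityOperators {T : TraceClass H} (hT : T ∈ densityOperators H) : ‖T‖ = 1 := by
  rw [← TraceClass.trace_re_eq_norm hT.1, hT.2, Complex.one_re]

/-- The spectral decomposition of a density operator. -/
lemma exists_eigenbasis_of_mem_densityOperators {T : TraceClass H}
    (hT : T ∈ densityOperators H) :
    ∃ (ι : Type u) (b : HilbertBasis ι ℂ H) (a : ι → ℝ), (∀ i, a i ∈ Set.Icc (0 : ℝ) 1) ∧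
      HasSum a 1 ∧ ∀ i, T.op (b i) = (a i : ℂ) • b i := by
  obtain ⟨ι, b, a, ha0, ha⟩ := exists_eigenbasis hT.1 T.isTraceClass
  have h := traceNorm_eq_tsum_of_diag b hT.1 ha
  rw [← TraceClass.ofReal_norm_eq, norm_of_mem_densityOperators hT, ENNReal.ofReal_one] at h
  have hs : HasSum a 1 := by
    have h1 : Summable fun i => (ENNReal.ofReal (a i)).toReal :=
      ENNReal.summable_toReal (by rw [← h]; simp)
    simp only [ENNReal.toReal_ofReal (ha0 _)] at h1
    have h2 := ENNReal.ofReal_tsum_of_nonneg ha0 h1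
    rw [← h, ENNReal.ofReal_eq_one] at h2
    exact h2 ▸ h1.hasSum
  exact ⟨ι, b, a, fun i => ⟨ha0 i, le_hasSum hs i fun j _ => ha0 j⟩, hs, ha⟩

section Separable

variable [TopologicalSpace.SeparableSpace H]

/-- The operator `|x⟩⟨b_i|` equals `|x⟩⟨b_i|` times `|b_i⟩⟨b_i|`, a product of two Hilbert–Schmidt
operators. The crude bound suffices: only finiteness and boundedness on the unit sphere are needed.
-/
lemma norm_rankOne_traceClass_le {ι : Type*} (b : HilbertBasis ι ℂ H) (i : ι) (x : H) :
    traceNorm (InnerProductSpace.rankOne ℂ x (b i) : H →L[ℂ] H)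
      ≤ ENNReal.ofReal (‖x‖ ^ 2 + 1) := by
  classical
  have hsq : ∀ y : H, hsSq (InnerProductSpace.rankOne ℂ y (b i) : H →L[ℂ] H)
      = ENNReal.ofReal (‖y‖ ^ 2) := by
    intro y
    rw [hsSq_eq_tsum b, tsum_eq_single i]
    · rw [InnerProductSpace.rankOne_apply, inner_self_eq_norm_sq_to_K, b.orthonormal.1 i,
        ← ofReal_norm, ← ENNReal.ofReal_pow (norm_nonneg _)]
      simp
    · intro j hj
      rw [InnerProductSpace.rankOne_apply, b.orthonormal.2 hj.symm]
      simp
  have heq : (InnerProductSpace.rankOne ℂ x (b i) : H →L[ℂ] H)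
      = InnerProductSpace.rankOne ℂ x (b i) * InnerProductSpace.rankOne ℂ (b i) (b i) := by
    ext y
    rw [mul_apply_eq_comp, InnerProductSpace.rankOne_apply, InnerProductSpace.rankOne_apply,
      InnerProductSpace.rankOne_apply, inner_smul_right, inner_self_eq_norm_sq_to_K,
      b.orthonormal.1 i]
    simp
  have h2 := two_mul_traceNorm_mul_le (InnerProductSpace.rankOne ℂ x (b i) : H →L[ℂ] H)
    (InnerProductSpace.rankOne ℂ (b i) (b i))
  rw [← heq] at h2
  refine le_trans ?_ (h2.trans_eq ?_)
  · rw [two_mul]; exact le_self_add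
  · rw [hsq, hsq, ← ENNReal.ofReal_add (by positivity) (by positivity), b.orthonormal.1 i]
    simp

/-- Basis vectors are at mutual distance `√2`, so balls of radius `1/2` around them are disjoint
open sets in a separable space. Countability later permits exchanging basis sums and integrals. -/
lemma countable_of_hilbertBasis {ι : Type*} (b : HilbertBasis ι ℂ H) : Countable ι := by
  have hsep : TopologicalSpace.IsSeparable (Set.univ : Set H) :=
    TopologicalSpace.isSeparable_univ_iff.2 inferInstance
  refine Pairwise.countable_of_isOpen_disjoint (s := fun i => Metric.ball (b i) (1 / 2)) ?_
    (fun i => Metric.isOpen_ball) (fun i => ⟨b i, by simp⟩)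
  intro i j hij
  refine Metric.ball_disjoint_ball ?_
  have h : ‖b i - b j‖ ^ 2 = 2 := by
    rw [@norm_sub_sq ℂ, b.orthonormal.2 hij, b.orthonormal.1 i, b.orthonormal.1 j]
    norm_num
  rw [dist_eq_norm]
  nlinarith [norm_nonneg (b i - b j)]

/-- The operators `|x⟩⟨b_i|` form countably many continuous images of the separable space `H`, and
their span is dense by the finite rank approximation. Consequently Borel measurable channels are
strongly measurable and can be Bochner integrated. -/
instance : SecondCountableTopology (TraceClass H) := by
  have hc : Countable (BasisIndex H) := countable_of_hilbertBasis (stdBasis H)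
  set b := stdBasis H
  have htc : ∀ (x : H) i, IsTraceClass (InnerProductSpace.rankOne ℂ x (b i) : H →L[ℂ] H) :=
    fun x i => (norm_rankOne_traceClass_le b i x).trans_lt ENNReal.ofReal_lt_top
  let φ : BasisIndex H → H → TraceClass H := fun i x => ⟨_, htc x i⟩
  let φL : BasisIndex H → H →ₗ[ℂ] TraceClass H := fun i =>
    { toFun := φ i
      map_add' := fun x y => TraceClass.op_injective (by ext; simp [φ, TraceClass.op_add])
      map_smul' := fun c x => TraceClass.op_injective (by
        rw [TraceClass.op_smul]; simp [φ]) }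
  have hφ : ∀ i, Continuous (φ i) := by
    intro i
    refine (LinearMap.mkContinuousOfExistsBound (φL i) ⟨2, fun x => ?_⟩).continuous
    by_cases hx : ‖x‖ = 0
    · rw [norm_eq_zero] at hx
      simp [hx]
    have h1 : ∀ y : H, ‖y‖ = 1 → ‖φL i y‖ ≤ 2 := fun y hy => by
      refine TraceClass.norm_le_of_traceNorm_le zero_le_two
        ((norm_rankOne_traceClass_le b i y).trans_eq ?_)
      rw [hy]; norm_num
    have h2 : x = (‖x‖ : ℂ) • ((‖x‖ : ℂ)⁻¹ • x) := by
      rw [smul_smul, mul_inv_cancel₀ (by exact_mod_cast hx), one_smul]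
    have h3 : ‖(‖x‖ : ℂ)⁻¹ • x‖ = 1 := by
      rw [norm_smul, norm_inv, Complex.norm_real, norm_norm, inv_mul_cancel₀ hx]
    calc ‖φL i x‖ = ‖x‖ * ‖φL i ((‖x‖ : ℂ)⁻¹ • x)‖ := by
          conv_lhs => rw [h2]
          rw [map_smul, norm_smul, Complex.norm_real, norm_norm]
      _ ≤ ‖x‖ * 2 := by gcongr; exact h1 _ h3
      _ = 2 * ‖x‖ := mul_comm _ _
  have hsep : TopologicalSpace.IsSeparable (⋃ i, Set.range (φ i)) :=
    .iUnion fun i => TopologicalSpace.isSeparable_range (hφ i)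
  have hspan := (hsep.span (R := ℂ)).closure
  have huniv : closure (Submodule.span ℂ (⋃ i, Set.range (φ i)) : Set (TraceClass H))
      = Set.univ := by
    refine Set.eq_univ_of_forall fun T => Metric.mem_closure_iff.2 fun ε hε => ?_
    obtain ⟨F, hF⟩ := exists_traceNorm_sub_sum_rankOne_le b T.isTraceClass (half_pos hε)
    refine ⟨∑ i ∈ F, φ i (T.op (b i)), Submodule.sum_mem _ fun i _ =>
      Submodule.subset_span (Set.mem_iUnion.2 ⟨i, _, rfl⟩), ?_⟩
    rw [dist_eq_norm]
    refine lt_of_le_of_lt (TraceClass.norm_le_of_traceNorm_le (half_pos hε).le ?_)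
      (half_lt_self hε)
    convert hF using 2
    rw [TraceClass.op_sub]
    congr 1
    exact map_sum TraceClass.opHom _ _
  rw [huniv] at hspan
  have : TopologicalSpace.SeparableSpace (TraceClass H) :=
    TopologicalSpace.isSeparable_univ_iff.1 hspan
  exact UniformSpace.secondCountable_of_separable _

end Separable

end TraceClassSpace

/-! ### Elementary tensors, product bases and tensor products of trace class operators. -/

section TensorPowers

variable {H : Type u} [NormedAddCommGroup H] [InnerProductSpace ℂ H]

/-- The elementary tensor `v_1 ⊗ ⋯ ⊗ v_n` in the algebraic tensor power. -/
def algTens : (n : ℕ) → (Fin n → H) → (algTensorPower H n).carrier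
  | 0, _ => (EuclideanSpace.single default 1 : EuclideanSpace ℂ PUnit.{u + 1})
  | n + 1, v => (v 0 ⊗ₜ[ℂ] algTens n fun i => v i.succ : H ⊗[ℂ] (algTensorPower H n).carrier)

lemma algTens_succ {n : ℕ} (v : Fin (n + 1) → H) :
    algTens (n + 1) v
      = (v 0 ⊗ₜ[ℂ] algTens n fun i => v i.succ : H ⊗[ℂ] (algTensorPower H n).carrier) := rfl

lemma inner_algTens {n : ℕ} (v w : Fin n → H) :
    ⟪algTens n v, algTens n w⟫_ℂ = ∏ i, ⟪v i, w i⟫_ℂ := by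
  induction n with
  | zero =>
    change ⟪(EuclideanSpace.single default 1 : EuclideanSpace ℂ PUnit.{u + 1}),
      EuclideanSpace.single default 1⟫_ℂ = _
    simp
  | succ n ih =>
    rw [Fin.prod_univ_succ, ← ih]
    exact TensorProduct.inner_tmul (𝕜 := ℂ) (v 0) (w 0) (algTens n fun i => v i.succ)
      (algTens n fun i => w i.succ)

lemma algTensorOp_algTens {n : ℕ} (A : Fin n → (H →L[ℂ] H)) (v : Fin n → H) :
    algTensorOp n A (algTens n v) = algTens n fun i => A i (v i) := by
  induction n with
  | zero => rfl
  | succ n ih =>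
    rw [algTens_succ, algTens_succ, ← ih]
    exact TensorProduct.mapL_apply _ _ _

lemma algTens_update_add {n : ℕ} (v : Fin n → H) (i : Fin n) (x y : H) :
    algTens n (Function.update v i (x + y))
      = algTens n (Function.update v i x) + algTens n (Function.update v i y) := by
  induction n with
  | zero => exact i.elim0
  | succ n ih =>
    rw [algTens_succ, algTens_succ, algTens_succ]
    refine Fin.cases ?_ (fun j => ?_) i
    · simp only [Function.update_self, ne_eq, Fin.succ_ne_zero, not_false_eq_true,
        Function.update_of_ne]
      exact TensorProduct.add_tmul _ _ _
    · have h : ∀ z : H, (fun k : Fin n => Function.update v j.succ z k.succ)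
          = Function.update (fun k : Fin n => v k.succ) j z := fun z => Fin.tail_update_succ v j z
      rw [h, h, h, ih]
      simp only [ne_eq, (Fin.succ_ne_zero j).symm, not_false_eq_true, Function.update_of_ne]
      exact TensorProduct.tmul_add _ _ _

lemma algTens_update_smul {n : ℕ} (v : Fin n → H) (i : Fin n) (c : ℂ) (x : H) :
    algTens n (Function.update v i (c • x)) = c • algTens n (Function.update v i x) := by
  induction n with
  | zero => exact i.elim0
  | succ n ih =>
    rw [algTens_succ, algTens_succ]
    refine Fin.cases ?_ (fun j => ?_) i
    · simp only [Function.update_self, ne_eq, Fin.succ_ne_zero, not_false_eq_true,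
        Function.update_of_ne]
      exact TensorProduct.smul_tmul' _ _ _
    · have h : ∀ z : H, (fun k : Fin n => Function.update v j.succ z k.succ)
          = Function.update (fun k : Fin n => v k.succ) j z := fun z => Fin.tail_update_succ v j z
      rw [h, h, ih]
      simp only [ne_eq, (Fin.succ_ne_zero j).symm, not_false_eq_true, Function.update_of_ne]
      exact TensorProduct.tmul_smul _ _ _

/-- One factor at a time: the closed span contains `x ⊗ t_k` for all `x` by continuity in `x`, and
then `x ⊗ y` by continuity in `y`. -/
lemma span_tmul_dense {E F : Type*} [NormedAddCommGroup E] [InnerProductSpace ℂ E]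
    [NormedAddCommGroup F] [InnerProductSpace ℂ F] {ι κ : Type*} (s : ι → E) (t : κ → F)
    (hs : (Submodule.span ℂ (Set.range s)).topologicalClosure = ⊤)
    (ht : (Submodule.span ℂ (Set.range t)).topologicalClosure = ⊤) :
    (Submodule.span ℂ (Set.range fun p : ι × κ => s p.1 ⊗ₜ[ℂ] t p.2)).topologicalClosure = ⊤ := by
  set S := (Submodule.span ℂ (Set.range fun p : ι × κ => s p.1 ⊗ₜ[ℂ] t p.2)).topologicalClosure
    with hS
  have hScl : IsClosed (S : Set (E ⊗[ℂ] F)) := Submodule.isClosed_topologicalClosure _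
  have h1 : ∀ (k : κ) (x : E), x ⊗ₜ[ℂ] t k ∈ S := by
    intro k x
    set L : E →L[ℂ] E ⊗[ℂ] F := (TensorProduct.mkL ℂ E F).flip (t k) with hL
    have h2 : (Submodule.span ℂ (Set.range s)).topologicalClosure ≤ S.comap L.toLinearMap := by
      refine Submodule.topologicalClosure_minimal _ ?_ (hScl.preimage L.continuous)
      rw [Submodule.span_le]
      rintro _ ⟨j, rfl⟩
      exact Submodule.le_topologicalClosure _ (Submodule.subset_span ⟨(j, k), rfl⟩)
    rw [hs] at h2
    exact h2 (Submodule.mem_top (x := x))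
  have h3 : ∀ (x : E) (y : F), x ⊗ₜ[ℂ] y ∈ S := by
    intro x y
    set L : F →L[ℂ] E ⊗[ℂ] F := TensorProduct.mkL ℂ E F x with hL
    have h2 : (Submodule.span ℂ (Set.range t)).topologicalClosure ≤ S.comap L.toLinearMap := by
      refine Submodule.topologicalClosure_minimal _ ?_ (hScl.preimage L.continuous)
      rw [Submodule.span_le]
      rintro _ ⟨k, rfl⟩
      exact h1 k x
    rw [ht] at h2
    exact h2 (Submodule.mem_top (x := y))
  rw [eq_top_iff, ← TensorProduct.span_tmul_eq_top, Submodule.span_le]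
  rintro _ ⟨x, y, rfl⟩
  exact h3 x y

lemma span_algTens_dense {n : ℕ} {ι : Fin n → Type*} (b : ∀ i, ι i → H)
    (hb : ∀ i, (Submodule.span ℂ (Set.range (b i))).topologicalClosure = ⊤) :
    (Submodule.span ℂ
      (Set.range fun k : ∀ i, ι i => algTens n fun i => b i (k i))).topologicalClosure = ⊤ := by
  induction n with
  | zero =>
    refine eq_top_iff.2 fun x _ => Submodule.le_topologicalClosure _ ?_
    have hx : ∀ y : EuclideanSpace ℂ PUnit.{u + 1},
        y = y default • EuclideanSpace.single default 1 := by
      intro y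
      ext j
      simp
    have hx' : x = (show EuclideanSpace ℂ PUnit.{u + 1} from x) default •
        algTens 0 (fun i => b i (i.elim0)) := hx x
    rw [hx']
    refine Submodule.smul_mem _ _ (Submodule.subset_span ⟨fun i => i.elim0, ?_⟩)
    rfl
  | succ n ih =>
    have h := span_tmul_dense (b 0) (fun k : ∀ i : Fin n, ι i.succ =>
      algTens n fun i => b i.succ (k i)) (hb 0) (ih (fun i => b i.succ) fun i => hb i.succ)
    rw [← (Fin.consEquiv ι).surjective.range_comp]
    exact h

/-- The elementary tensor `v_1 ⊗ ⋯ ⊗ v_n` in the Hilbert space tensor power. -/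
def tens {n : ℕ} (v : Fin n → H) : TensorPower H n := (algTens n v : TensorPower H n)

lemma inner_tens {n : ℕ} (v w : Fin n → H) : ⟪tens v, tens w⟫_ℂ = ∏ i, ⟪v i, w i⟫_ℂ := by
  rw [tens, tens, UniformSpace.Completion.inner_coe, inner_algTens]

lemma tensorOp_tens {n : ℕ} (A : Fin n → (H →L[ℂ] H)) (v : Fin n → H) :
    tensorOp A (tens v) = tens fun i => A i (v i) := by
  rw [tensorOp, tens, tens, ContinuousLinearMap.completion_apply_coe, algTensorOp_algTens]

lemma tens_update_add {n : ℕ} (v : Fin n → H) (i : Fin n) (x y : H) :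
    tens (Function.update v i (x + y))
      = tens (Function.update v i x) + tens (Function.update v i y) := by
  rw [tens, algTens_update_add, UniformSpace.Completion.coe_add]; rfl

lemma tens_update_smul {n : ℕ} (v : Fin n → H) (i : Fin n) (c : ℂ) (x : H) :
    tens (Function.update v i (c • x)) = c • tens (Function.update v i x) := by
  rw [tens, algTens_update_smul, UniformSpace.Completion.coe_smul]; rfl

lemma tens_smul {n : ℕ} (c : Fin n → ℂ) (v : Fin n → H) :
    tens (fun i => c i • v i) = (∏ i, c i) • tens v := by
  let f : MultilinearMap ℂ (fun _ : Fin n => H) (TensorPower H n) :=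
    MultilinearMap.mk' tens (fun v i x y => tens_update_add v i x y)
      (fun v i c x => tens_update_smul v i c x)
  exact f.map_smul_univ c v

/-- The product Hilbert basis of the tensor power. -/
def prodBasis {n : ℕ} {ι : Fin n → Type*} (b : ∀ i, HilbertBasis (ι i) ℂ H) :
    HilbertBasis (∀ i, ι i) ℂ (TensorPower H n) :=
  HilbertBasis.mk (v := fun k => tens fun i => b i (k i)) (by
    classical
    rw [orthonormal_iff_ite]
    intro k l
    rw [inner_tens]
    simp only [orthonormal_iff_ite.1 (b _).orthonormal]
    by_cases h : k = l
    · simp [h]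
    · rw [if_neg h]
      obtain ⟨i, hi⟩ := Function.ne_iff.1 h
      exact Finset.prod_eq_zero (Finset.mem_univ i) (if_neg hi)) (by
    have h := span_algTens_dense (fun i => b i) fun i => (b i).dense_span
    have hd := (Submodule.dense_iff_topologicalClosure_eq_top.2 h)
    refine (Submodule.dense_iff_topologicalClosure_eq_top.1 ?_).ge
    refine ((UniformSpace.Completion.denseRange_coe).dense_image
      (UniformSpace.Completion.continuous_coe _) hd).mono ?_
    rintro _ ⟨x, hx, rfl⟩
    have h2 := Submodule.mem_map_of_mem (f := (UniformSpace.Completion.toComplL (𝕜 := ℂ)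
      (E := (algTensorPower H n).carrier)).toLinearMap) hx
    rw [Submodule.map_span, ← Set.range_comp] at h2
    exact h2)

lemma prodBasis_apply {n : ℕ} {ι : Fin n → Type*} (b : ∀ i, HilbertBasis (ι i) ℂ H)
    (k : ∀ i, ι i) : prodBasis b k = tens fun i => b i (k i) := by
  rw [prodBasis, HilbertBasis.coe_mk]

lemma tensorOp_prodBasis {n : ℕ} {ι : Fin n → Type*} (b : ∀ i, HilbertBasis (ι i) ℂ H)
    {A : Fin n → (H →L[ℂ] H)} {a : ∀ i, ι i → ℝ} (ha : ∀ i j, A i (b i j) = (a i j : ℂ) • b i j)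
    (k : ∀ i, ι i) :
    tensorOp A (prodBasis b k) = ((∏ i, a i (k i) : ℝ) : ℂ) • prodBasis b k := by
  rw [prodBasis_apply, tensorOp_tens]
  simp only [ha]
  rw [tens_smul]
  push_cast
  rfl

/-- Source of all single-letter formulas: the spectrum of a product operator consists of products of
eigenvalues, so sums of multiplicative functions over it factor. -/
lemma tsum_pi_prod {n : ℕ} {ι : Fin n → Type*} (f : ∀ i, ι i → ℝ≥0∞) :
    ∑' k : ∀ i, ι i, ∏ i, f i (k i) = ∏ i, ∑' j, f i j := by
  induction n with
  | zero => simp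
  | succ n ih =>
    rw [Fin.prod_univ_succ, ← ih, ← (Fin.consEquiv ι).tsum_eq, ENNReal.tsum_prod',
      ← ENNReal.tsum_mul_right]
    refine tsum_congr fun j => ?_
    rw [← ENNReal.tsum_mul_left]
    refine tsum_congr fun k => ?_
    rw [Fin.prod_univ_succ]
    rfl

variable [CompleteSpace H]

lemma clm_ext_tens {n : ℕ} {S T : TensorPower H n →L[ℂ] TensorPower H n}
    (h : ∀ v : Fin n → H, S (tens v) = T (tens v)) : S = T := by
  let b := prodBasis fun _ : Fin n => stdBasis H
  refine ContinuousLinearMap.ext_on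
    (Submodule.dense_iff_topologicalClosure_eq_top.2 b.dense_span) ?_
  rintro _ ⟨k, rfl⟩
  rw [prodBasis_apply]
  exact h _

lemma tensorOp_mul {n : ℕ} (A B : Fin n → (H →L[ℂ] H)) :
    tensorOp (fun i => A i * B i) = tensorOp A * tensorOp B :=
  clm_ext_tens fun v => by
    rw [mul_apply_eq_comp, tensorOp_tens, tensorOp_tens, tensorOp_tens]
    rfl

lemma hsSq_tensorOp {n : ℕ} (A : Fin n → (H →L[ℂ] H)) :
    hsSq (tensorOp A) = ∏ i, hsSq (A i) := by
  rw [hsSq_eq_tsum (prodBasis fun _ : Fin n => stdBasis H)]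
  simp only [hsSq]
  rw [← tsum_pi_prod]
  refine tsum_congr fun k => ?_
  rw [prodBasis_apply, tensorOp_tens, Finset.prod_pow]
  congr 1
  rw [← ofReal_norm]
  simp only [← ofReal_norm]
  rw [← ENNReal.ofReal_prod_of_nonneg fun _ _ => norm_nonneg _]
  congr 1
  rw [← sq_eq_sq₀ (norm_nonneg _) (Finset.prod_nonneg fun _ _ => norm_nonneg _),
    ← Finset.prod_pow]
  have h := inner_tens (fun i => A i (stdBasis H (k i))) (fun i => A i (stdBasis H (k i)))
  simp only [inner_self_eq_norm_sq_to_K] at h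
  exact_mod_cast h

/-- Factor each `A_i` as `(W_i S_i) S_i` with `S_i = √|A_i|`. Both tensor factors are
Hilbert–Schmidt, where the norm is exactly multiplicative. -/
lemma traceNorm_tensorOp_le {n : ℕ} (A : Fin n → (H →L[ℂ] H)) :
    traceNorm (tensorOp A) ≤ ∏ i, traceNorm (A i) := by
  choose W hW hWA _ using fun i => exists_polar (A i)
  set S := fun i => CFC.sqrt (CFC.abs (A i)) with hS
  have hSS : ∀ i, S i * S i = CFC.abs (A i) := fun i =>
    CFC.sqrt_mul_sqrt_self _ (CFC.abs_nonneg (A i))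
  have hA : A = fun i => (W i * S i) * S i := by
    funext i
    rw [mul_assoc, hSS, hWA]
  have h : 2 * traceNorm (tensorOp A) ≤ 2 * ∏ i, traceNorm (A i) := by
    calc 2 * traceNorm (tensorOp A)
        = 2 * traceNorm (tensorOp (fun i => W i * S i) * tensorOp S) := by
          conv_lhs => rw [hA, tensorOp_mul]
      _ ≤ hsSq (tensorOp fun i => W i * S i) + hsSq (tensorOp S) := two_mul_traceNorm_mul_le _ _
      _ ≤ ∏ i, hsSq (S i) + ∏ i, hsSq (S i) := by
          rw [hsSq_tensorOp, hsSq_tensorOp]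
          gcongr with i
          exact hsSq_mul_le_left (hW i) _
      _ = 2 * ∏ i, traceNorm (A i) := by
          rw [two_mul]
          simp only [traceNorm_eq_hsSq]
          rfl
  exact (ENNReal.mul_le_mul_iff_right (by simp) (by simp)).1 h

/-- The tensor product of trace class operators. -/
def tensorTC (H : Type u) [NormedAddCommGroup H] [InnerProductSpace ℂ H] [CompleteSpace H] (n : ℕ) :
    ContinuousMultilinearMap ℂ (fun _ : Fin n => TraceClass H) (TraceClass (TensorPower H n)) :=
  MultilinearMap.mkContinuous
    (MultilinearMap.mk' (fun A => ⟨tensorOp fun i => (A i).op,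
        (traceNorm_tensorOp_le _).trans_lt
          (ENNReal.prod_lt_top fun i _ => (A i).isTraceClass)⟩)
      (fun A i S T => TraceClass.op_injective (by
        rw [TraceClass.op_add]
        refine clm_ext_tens fun v => ?_
        rw [add_apply]
        simp only [tensorOp_tens]
        have h : ∀ R : TraceClass H, (fun j => (Function.update A i R j).op (v j))
            = Function.update (fun j => (A j).op (v j)) i (R.op (v i)) := by
          intro R
          funext j
          by_cases hj : j = i
          · subst hj; simp
          · simp [hj]
        rw [h, h, h, TraceClass.op_add, add_apply, tens_update_add]))
      (fun A i c S => TraceClass.op_injective (by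
        rw [TraceClass.op_smul]
        refine clm_ext_tens fun v => ?_
        rw [smul_apply]
        simp only [tensorOp_tens]
        have h : ∀ R : TraceClass H, (fun j => (Function.update A i R j).op (v j))
            = Function.update (fun j => (A j).op (v j)) i (R.op (v i)) := by
          intro R
          funext j
          by_cases hj : j = i
          · subst hj; simp
          · simp [hj]
        rw [h, h, TraceClass.op_smul, smul_apply, tens_update_smul]))) 1 fun A => by
    rw [one_mul]
    refine TraceClass.norm_le_of_traceNorm_le (Finset.prod_nonneg fun _ _ => norm_nonneg _) ?_
    rw [ENNReal.ofReal_prod_of_nonneg fun _ _ => norm_nonneg _]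
    simp only [TraceClass.ofReal_norm_eq]
    exact traceNorm_tensorOp_le _

@[simp] lemma op_tensorTC {n : ℕ} (A : Fin n → TraceClass H) :
    (tensorTC H n A).op = tensorOp fun i => (A i).op := rfl

/-- The spectral decomposition of a product of density operators. -/
lemma exists_eigenbasis_tensorTC {n : ℕ} {A : Fin n → TraceClass H}
    (hA : ∀ i, A i ∈ densityOperators H) :
    ∃ (ι : Fin n → Type u) (a : ∀ i, ι i → ℝ) (b : HilbertBasis (∀ i, ι i) ℂ (TensorPower H n)),
      (∀ i j, a i j ∈ Set.Icc (0 : ℝ) 1) ∧ (∀ i, HasSum (a i) 1) ∧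
      (∀ i, ∃ c : HilbertBasis (ι i) ℂ H, ∀ j, (A i).op (c j) = (a i j : ℂ) • c j) ∧
      ∀ k, (tensorTC H n A).op (b k) = ((∏ i, a i (k i) : ℝ) : ℂ) • b k := by
  choose ι b a ha0 hsum ha using fun i => exists_eigenbasis_of_mem_densityOperators (hA i)
  exact ⟨ι, a, prodBasis b, ha0, hsum, fun i => ⟨b i, ha i⟩, tensorOp_prodBasis b ha⟩

lemma tensorTC_nonneg {n : ℕ} {A : Fin n → TraceClass H}
    (hA : ∀ i, A i ∈ densityOperators H) : 0 ≤ (tensorTC H n A).op := by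
  obtain ⟨ι, a, b, ha, -, -, hb⟩ := exists_eigenbasis_tensorTC hA
  exact nonneg_of_diag b (fun k => Finset.prod_nonneg fun i _ => (ha i _).1) hb

lemma norm_tensorTC {n : ℕ} {A : Fin n → TraceClass H}
    (hA : ∀ i, A i ∈ densityOperators H) : ‖tensorTC H n A‖ = 1 := by
  obtain ⟨ι, a, b, ha, hs, -, hb⟩ := exists_eigenbasis_tensorTC hA
  have h := traceNorm_eq_tsum_of_diag b (tensorTC_nonneg hA) hb
  simp only [ENNReal.ofReal_prod_of_nonneg fun i _ => (ha i _).1] at h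
  rw [tsum_pi_prod fun i j => ENNReal.ofReal (a i j)] at h
  have h1 : ∀ i, ∑' j, ENNReal.ofReal (a i j) = 1 := fun i => by
    rw [← ENNReal.ofReal_tsum_of_nonneg (fun j => (ha i j).1) (hs i).summable, (hs i).tsum_eq,
      ENNReal.ofReal_one]
  simp only [h1, Finset.prod_const_one] at h
  rw [TraceClass.norm_def, h, ENNReal.toReal_one]

section Integral

variable {X : Type v} [MeasurableSpace X]

/-- In a product basis the matrix elements of a tensor product are products of one-letter matrix
elements, so the identity reduces to Fubini for scalar functions of independent letters. -/
lemma integral_tensorTC {n : ℕ} (P : Measure X) [IsProbabilityMeasure P] {D : X → TraceClass H}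
    (hD : Integrable D P)
    (hint : Integrable (fun x : Fin n → X => tensorTC H n fun i => D (x i))
      (Measure.pi fun _ => P)) :
    ∫ x : Fin n → X, tensorTC H n (fun i => D (x i)) ∂(Measure.pi fun _ => P)
      = tensorTC H n fun _ => ∫ x, D x ∂P := by
  refine TraceClass.ext_matrixElement (prodBasis fun _ : Fin n => stdBasis H) fun k l => ?_
  rw [← TraceClass.matrixElement_apply, ← ContinuousLinearMap.integral_comp_comm _ hint]
  simp only [TraceClass.matrixElement_apply, op_tensorTC, prodBasis_apply, tensorOp_tens,
    inner_tens]
  rw [integral_fintype_prod_eq_prod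
    (f := fun (i : Fin n) (x : X) => ⟪stdBasis H (k i), (D x).op (stdBasis H (l i))⟫_ℂ)]
  refine Finset.prod_congr rfl fun i _ => ?_
  simp only [← TraceClass.matrixElement_apply]
  exact ContinuousLinearMap.integral_comp_comm _ hD

end Integral

end TensorPowers

/-! ### Bounded differences inequality and variance of empirical means. -/

section Concentration

open ProbabilityTheory

variable {Y : Type*} [MeasurableSpace Y] (μ : Measure Y) [IsProbabilityMeasure μ]

lemma integrable_of_abs_le {Z : Type*} [MeasurableSpace Z] {ν : Measure Z} [IsFiniteMeasure ν]
    {f : Z → ℝ} (hf : Measurable f) {B : ℝ} (hB : ∀ z, |f z| ≤ B) : Integrable f ν :=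
  Integrable.of_bound hf.aestronglyMeasurable B (Eventually.of_forall hB)

/-- Exponential moments of functions with bounded differences. -/
lemma integral_exp_le_of_bounded_differences {c B : ℝ} (hc : 0 ≤ c) (t : ℝ) (M : ℕ) :
    ∀ f : (Fin M → Y) → ℝ, Measurable f → (∀ C, |f C| ≤ B) →
      (∀ C i y, |f (Function.update C i y) - f C| ≤ c) →
      ∫ C, Real.exp (t * (f C - ∫ C', f C' ∂(Measure.pi fun _ => μ))) ∂(Measure.pi fun _ => μ)
        ≤ Real.exp (M * (c ^ 2 * t ^ 2 / 2)) := by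
  induction M with
  | zero =>
    intro f _ _ _
    have h : ∀ C, f C = f default := fun C => congrArg f (Subsingleton.elim _ _)
    simp [h]
  | succ M ih =>
    intro f hf hB hdiff
    set ν : Measure (Fin M → Y) := Measure.pi fun _ => μ with hν
    have mp := (measurePreserving_piFinSuccAbove (fun _ : Fin (M + 1) => μ) 0).symm
    have heq : ∀ p : Y × (Fin M → Y), (MeasurableEquiv.piFinSuccAbove
        (fun _ : Fin (M + 1) => Y) 0).symm p = Fin.cons p.1 p.2 := fun p =>
      Fin.insertNth_zero' p.1 p.2
    have hint : ∀ F : (Fin (M + 1) → Y) → ℝ, ∫ C, F C ∂(Measure.pi fun _ => μ)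
        = ∫ p : Y × (Fin M → Y), F (Fin.cons p.1 p.2) ∂(μ.prod ν) := by
      intro F
      rw [← mp.integral_comp']
      simp only [heq]
      rfl
    have hcons : Measurable fun p : Y × (Fin M → Y) => (Fin.cons p.1 p.2 : Fin (M + 1) → Y) := by
      simpa only [← heq] using!
        (MeasurableEquiv.piFinSuccAbove (fun _ : Fin (M + 1) => Y) 0).symm.measurable
    have hg : Measurable fun p : Y × (Fin M → Y) => f (Fin.cons p.1 p.2) := hf.comp hcons
    -- Averaging out one coordinate preserves the bounded differences, so the induction hypothesis
    -- applies to `h`; the remainder `f - h` is centred in that coordinate. The bound `B` serves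
    -- only integrability.
    set h : (Fin M → Y) → ℝ := fun r => ∫ y, f (Fin.cons y r) ∂μ with hh
    have hgr : ∀ r, Measurable fun y => f (Fin.cons y r) := fun r =>
      hg.comp (measurable_id.prodMk measurable_const)
    have hi : ∀ r, Integrable (fun y => f (Fin.cons y r)) μ := fun r =>
      integrable_of_abs_le (hgr r) fun y => hB _
    have hhm : Measurable h :=
      (hg.stronglyMeasurable.integral_prod_left' (μ := μ)).measurable
    have hhB : ∀ r, |h r| ≤ B := fun r => by
      have := norm_integral_le_of_norm_le_const (μ := μ) (f := fun y => f (Fin.cons y r)) (C := B)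
        (Eventually.of_forall fun y => hB _)
      simpa using this
    have hhd : ∀ r i y, |h (Function.update r i y) - h r| ≤ c := fun r i y => by
      rw [hh]
      simp only
      rw [← integral_sub (hi _) (hi _)]
      have := norm_integral_le_of_norm_le_const (μ := μ)
        (f := fun z => f (Fin.cons z (Function.update r i y)) - f (Fin.cons z r)) (C := c)
        (Eventually.of_forall fun z => by
          rw [Fin.cons_update]; exact hdiff _ _ _)
      simpa using this
    have hEf : ∫ C, f C ∂(Measure.pi fun _ => μ) = ∫ r, h r ∂ν := by
      rw [hint, integral_prod_symm]
      exact integrable_of_abs_le hg fun p => hB _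
    have hosc : ∀ r y, f (Fin.cons y r) - h r ∈ Set.Icc (-c) c := fun r y => by
      rw [Set.mem_Icc, ← abs_le]
      have h1 : f (Fin.cons y r) - h r = ∫ z, (f (Fin.cons y r) - f (Fin.cons z r)) ∂μ := by
        rw [integral_sub (integrable_const _) (hi r)]
        simp [hh]
      rw [h1]
      have := norm_integral_le_of_norm_le_const (μ := μ)
        (f := fun z => f (Fin.cons y r) - f (Fin.cons z r)) (C := c)
        (Eventually.of_forall fun z => by
          have h2 := hdiff (Fin.cons z r) 0 y
          rwa [Fin.update_cons_zero] at h2)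
      simpa using this
    -- Hoeffding's lemma for a centred variable in `[-c, c]`, an interval of length `2c`. The
    -- sharper length `c` is not exploited.
    have hmgf : ∀ r, ∫ y, Real.exp (t * (f (Fin.cons y r) - h r)) ∂μ
        ≤ Real.exp (c ^ 2 * t ^ 2 / 2) := fun r => by
      have h1 := (hasSubgaussianMGF_of_mem_Icc_of_integral_eq_zero (μ := μ)
        (X := fun y => f (Fin.cons y r) - h r) (a := -c) (b := c)
        ((hgr r).sub_const _).aemeasurable (Eventually.of_forall (hosc r)) (by
          rw [integral_sub (hi r) (integrable_const _)]; simp [hh])).mgf_le t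
      refine h1.trans_eq ?_
      congr 1
      simp only [NNReal.coe_pow, NNReal.coe_div, coe_nnnorm, sub_neg_eq_add, Real.norm_eq_abs]
      rw [abs_of_nonneg (by positivity)]
      push_cast
      ring
    have hB0 : 0 ≤ B := by
      obtain ⟨C⟩ : Nonempty (Fin (M + 1) → Y) :=
        (Measure.pi fun _ : Fin (M + 1) => μ).nonempty_of_neZero
      exact (abs_nonneg _).trans (hB C)
    rw [hEf, hint]
    set e : ℝ := ∫ r, h r ∂ν with he
    have hee : |e| ≤ B := by
      have := norm_integral_le_of_norm_le_const (μ := ν) (f := h) (C := B)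
        (Eventually.of_forall fun y => hhB _)
      simpa using this
    have hexpb : ∀ x : ℝ, |x| ≤ 2 * B → |Real.exp (t * x)| ≤ Real.exp (|t| * (2 * B)) := by
      intro x hx
      rw [abs_of_pos (Real.exp_pos _), Real.exp_le_exp]
      exact (le_abs_self _).trans (by rw [abs_mul]; gcongr)
    rw [integral_prod_symm]
    · have h1 : ∀ r, ∫ y, Real.exp (t * (f (Fin.cons y r) - e)) ∂μ
          = (∫ y, Real.exp (t * (f (Fin.cons y r) - h r)) ∂μ) * Real.exp (t * (h r - e)) := by
        intro r
        rw [← integral_mul_const]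
        congr 1
        funext y
        rw [← Real.exp_add]
        congr 1
        ring
      simp only [h1]
      have hiexp : Integrable (fun r => Real.exp (t * (h r - e))) ν := by
        refine integrable_of_abs_le (by fun_prop) (B := Real.exp (|t| * (2 * B))) fun r => ?_
        exact hexpb _ ((abs_sub _ _).trans (by linarith [hhB r]))
      calc _ ≤ ∫ r, Real.exp (c ^ 2 * t ^ 2 / 2) * Real.exp (t * (h r - e)) ∂ν := by
            refine integral_mono_of_nonneg (Eventually.of_forall fun r => by positivity)
              (hiexp.const_mul _) (Eventually.of_forall fun r => ?_)
            exact mul_le_mul_of_nonneg_right (hmgf r) (Real.exp_pos _).le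
        _ = Real.exp (c ^ 2 * t ^ 2 / 2) * ∫ r, Real.exp (t * (h r - e)) ∂ν :=
            integral_const_mul _ _
        _ ≤ Real.exp (c ^ 2 * t ^ 2 / 2) * Real.exp (M * (c ^ 2 * t ^ 2 / 2)) := by
            gcongr
            exact ih h hhm hhB hhd
        _ = _ := by
            rw [← Real.exp_add]
            congr 1
            push_cast
            ring
    · refine integrable_of_abs_le (by fun_prop) (B := Real.exp (|t| * (2 * B))) fun p => ?_
      exact hexpb _ ((abs_sub _ _).trans (by linarith [hB (Fin.cons p.1 p.2)]))

/-- The bounded differences inequality, for differences of order `1 / M`. -/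
lemma measureReal_ge_le_of_bounded_differences {M : ℕ} (hM : 0 < M) {f : (Fin M → Y) → ℝ}
    (hf : Measurable f) {B : ℝ} (hB : ∀ C, |f C| ≤ B)
    (hdiff : ∀ C i y, |f (Function.update C i y) - f C| ≤ 2 / M) {s : ℝ} (hs : 0 ≤ s) :
    (Measure.pi fun _ : Fin M => μ).real {C | (∫ C', f C' ∂(Measure.pi fun _ => μ)) + s ≤ f C}
      ≤ Real.exp (-(M * s ^ 2 / 8)) := by
  have hM' : (0 : ℝ) < M := by exact_mod_cast hM
  set e := ∫ C', f C' ∂(Measure.pi fun _ : Fin M => μ) with he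
  -- Minimizer of the Chernoff exponent `-t s + 2 t² / M`.
  set t : ℝ := M * s / 4 with ht
  have hB0 : 0 ≤ B := by
    obtain ⟨C⟩ : Nonempty (Fin M → Y) := (Measure.pi fun _ : Fin M => μ).nonempty_of_neZero
    exact (abs_nonneg _).trans (hB C)
  have h1 := integral_exp_le_of_bounded_differences μ (by positivity) t M f hf hB hdiff
  have hexp : Integrable (fun C => Real.exp (t * (f C - e))) (Measure.pi fun _ : Fin M => μ) := by
    refine integrable_of_abs_le (by fun_prop) (B := Real.exp (t * (B - e))) fun C => ?_
    rw [abs_of_pos (Real.exp_pos _), Real.exp_le_exp]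
    gcongr
    exact (le_abs_self _).trans (hB C)
  have h2 := measure_ge_le_exp_mul_mgf (μ := Measure.pi fun _ : Fin M => μ)
    (X := fun C => f C - e) s (by positivity : 0 ≤ t) hexp
  have hset : {C : Fin M → Y | e + s ≤ f C} = {C | s ≤ f C - e} := by
    ext C
    simp only [Set.mem_ofPred_eq]
    constructor <;> intro h <;> linarith
  rw [hset]
  refine h2.trans ?_
  calc _ ≤ Real.exp (-t * s) * Real.exp (M * ((2 / M) ^ 2 * t ^ 2 / 2)) := by
        gcongr; exact h1
    _ = _ := by
        rw [← Real.exp_add]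
        congr 1
        rw [ht]
        field_simp
        ring

/-- The cross terms vanish by independence, and the variance is at most the second moment. -/
lemma integral_sq_average_sub_le {M : ℕ} (hM : 0 < M) {a : Y → ℝ} (ha : Measurable a) {B : ℝ}
    (hB : ∀ y, |a y| ≤ B) :
    ∫ C : Fin M → Y, ((1 / M) * ∑ m, a (C m) - ∫ y, a y ∂μ) ^ 2 ∂(Measure.pi fun _ => μ)
      ≤ (1 / M) * ∫ y, a y ^ 2 ∂μ := by
  have hM' : (M : ℝ) ≠ 0 := by exact_mod_cast hM.ne'
  set ν := Measure.pi fun _ : Fin M => μ with hν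
  have haL : MemLp a 2 μ := MemLp.of_bound ha.aestronglyMeasurable B (Eventually.of_forall hB)
  have hmp : ∀ m : Fin M, MeasurePreserving (fun C : Fin M → Y => C m) ν μ := fun m =>
    measurePreserving_eval (fun _ : Fin M => μ) m
  have hmem : ∀ m : Fin M, MemLp (fun C : Fin M → Y => a (C m)) 2 ν := fun m =>
    haL.comp_measurePreserving (hmp m)
  have hind : iIndepFun (fun (m : Fin M) (C : Fin M → Y) => a (C m)) ν :=
    iIndepFun_pi (μ := fun _ : Fin M => μ) (X := fun _ => a) fun _ => ha.aemeasurable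
  have hvar : Var[∑ m, fun C : Fin M → Y => a (C m); ν] = M * Var[a; μ] := by
    rw [IndepFun.variance_sum (fun m _ => hmem m) fun i _ j _ hij => hind.indepFun hij]
    have : ∀ m : Fin M, Var[fun C : Fin M → Y => a (C m); ν] = Var[a; μ] := fun m =>
      (hmp m).variance_fun_comp ha.aemeasurable
    simp [this]
  have hmean : ∫ C, (∑ m, fun C : Fin M → Y => a (C m)) C ∂ν = M * ∫ y, a y ∂μ := by
    simp only [Finset.sum_apply]
    rw [integral_finsetSum _ fun m _ => (hmem m).integrable (by norm_num)]
    have : ∀ m : Fin M, ∫ C : Fin M → Y, a (C m) ∂ν = ∫ y, a y ∂μ := fun m => by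
      rw [← (hmp m).map_eq, integral_map (hmp m).measurable.aemeasurable
        ha.aestronglyMeasurable]
    simp [this]
  have h1 : ∫ C : Fin M → Y, ((1 / M) * ∑ m, a (C m) - ∫ y, a y ∂μ) ^ 2 ∂ν
      = (1 / M) ^ 2 * Var[∑ m, fun C : Fin M → Y => a (C m); ν] := by
    rw [variance_eq_integral, hmean, ← integral_const_mul]
    · congr 1
      funext C
      rw [Finset.sum_apply, ← mul_pow]
      congr 1
      field_simp
    · exact Finset.aemeasurable_sum _ fun m _ => (hmem m).aestronglyMeasurable.aemeasurable
  rw [h1, hvar]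
  have h2 : Var[a; μ] ≤ ∫ y, a y ^ 2 ∂μ := variance_le_expectation_sq ha.aestronglyMeasurable
  calc (1 / (M : ℝ)) ^ 2 * (M * Var[a; μ]) = 1 / M * Var[a; μ] := by field_simp
    _ ≤ _ := by gcongr

lemma lintegral_enorm_sq_average_sub_le {M : ℕ} (hM : 0 < M) {a : Y → ℂ} (ha : Measurable a)
    {B : ℝ} (hB : ∀ y, ‖a y‖ ≤ B) :
    ∫⁻ C : Fin M → Y, ‖(1 / M : ℂ) * ∑ m, a (C m) - ∫ y, a y ∂μ‖ₑ ^ 2 ∂(Measure.pi fun _ => μ)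
      ≤ ENNReal.ofReal (1 / M) * ∫⁻ y, ‖a y‖ₑ ^ 2 ∂μ := by
  set ν := Measure.pi fun _ : Fin M => μ with hν
  have hconv : ∀ z : ℂ, ‖z‖ₑ ^ 2 = ENNReal.ofReal (‖z‖ ^ 2) := fun z => by
    rw [ENNReal.ofReal_pow (norm_nonneg _), ofReal_norm]
  have hnsq : ∀ z : ℂ, ‖z‖ ^ 2 = z.re ^ 2 + z.im ^ 2 := fun z => by
    rw [← Complex.normSq_eq_norm_sq, Complex.normSq_apply]; ring
  have hai : Integrable a μ := Integrable.of_bound ha.aestronglyMeasurable B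
    (Eventually.of_forall hB)
  have hre := integral_sq_average_sub_le μ hM (a := fun y => (a y).re) (by fun_prop) (B := B)
    fun y => (Complex.abs_re_le_norm _).trans (hB y)
  have him := integral_sq_average_sub_le μ hM (a := fun y => (a y).im) (by fun_prop) (B := B)
    fun y => (Complex.abs_im_le_norm _).trans (hB y)
  have hM' : (0 : ℝ) < M := by exact_mod_cast hM
  have h1re : ∀ C : Fin M → Y, ((1 / M : ℂ) * ∑ m, a (C m) - ∫ y, a y ∂μ).re
      = (1 / M : ℝ) * ∑ m, (a (C m)).re - ∫ y, (a y).re ∂μ := fun C => by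
    have h2 : ∫ y, (a y).re ∂μ = (∫ y, a y ∂μ).re := integral_re hai
    have h3 : (1 / M : ℂ) = ((1 / M : ℝ) : ℂ) := by push_cast; rfl
    rw [h2, h3, Complex.sub_re, Complex.re_ofReal_mul, Complex.re_sum]
  have h1im : ∀ C : Fin M → Y, ((1 / M : ℂ) * ∑ m, a (C m) - ∫ y, a y ∂μ).im
      = (1 / M : ℝ) * ∑ m, (a (C m)).im - ∫ y, (a y).im ∂μ := fun C => by
    have h2 : ∫ y, (a y).im ∂μ = (∫ y, a y ∂μ).im := integral_im hai
    have h3 : (1 / M : ℂ) = ((1 / M : ℝ) : ℂ) := by push_cast; rfl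
    rw [h2, h3, Complex.sub_im, Complex.im_ofReal_mul, Complex.im_sum]
  have hbd : ∀ (b : Y → ℝ) (_ : Measurable b) (_ : ∀ y, |b y| ≤ B),
      Integrable (fun C : Fin M → Y => ((1 / M : ℝ) * ∑ m, b (C m) - ∫ y, b y ∂μ) ^ 2) ν := by
    intro b hb hbB
    have hL : MemLp (fun C : Fin M → Y => (1 / M : ℝ) * ∑ m, b (C m) - ∫ y, b y ∂μ) 2 ν := by
      refine MemLp.sub (MemLp.const_mul ?_ _) (memLp_const _)
      exact memLp_finsetSum _ fun m _ => MemLp.of_bound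
        (hb.comp (measurable_pi_apply m)).aestronglyMeasurable B
        (Eventually.of_forall fun C => hbB _)
    exact hL.integrable_sq
  have hbre := hbd (fun y => (a y).re) (by fun_prop)
    fun y => (Complex.abs_re_le_norm _).trans (hB y)
  have hbim := hbd (fun y => (a y).im) (by fun_prop)
    fun y => (Complex.abs_im_le_norm _).trans (hB y)
  have hL2 : ∀ b : Y → ℝ, Measurable b → (∀ y, |b y| ≤ B) → Integrable (fun y => b y ^ 2) μ :=
    fun b hb hbB => (MemLp.of_bound hb.aestronglyMeasurable B
      (Eventually.of_forall hbB) : MemLp b 2 μ).integrable_sq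
  have hLre := hL2 (fun y => (a y).re) (by fun_prop)
    fun y => (Complex.abs_re_le_norm _).trans (hB y)
  have hLim := hL2 (fun y => (a y).im) (by fun_prop)
    fun y => (Complex.abs_im_le_norm _).trans (hB y)
  simp only [hconv, hnsq, h1re, h1im]
  have e1 := ofReal_integral_eq_lintegral_ofReal (hbre.add hbim)
    (Eventually.of_forall fun C => add_nonneg (sq_nonneg _) (sq_nonneg _))
  have e2 := ofReal_integral_eq_lintegral_ofReal (hLre.add hLim)
    (Eventually.of_forall fun C => add_nonneg (sq_nonneg _) (sq_nonneg _))
  simp only [Pi.add_apply] at e1 e2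
  rw [← e1, ← e2, ← ENNReal.ofReal_mul (by positivity)]
  refine ENNReal.ofReal_le_ofReal ?_
  rw [integral_add hbre hbim, integral_add hLre hLim, mul_add]
  exact add_le_add hre him

end Concentration

/-! ### The resolvent cutoff `T (T + c)⁻¹`. -/

section Damping

variable {K : Type u} [NormedAddCommGroup K] [InnerProductSpace ℂ K] [CompleteSpace K]

/-- The operator `T (T + c)⁻¹`. -/
def damp (c : ℝ) (T : TraceClass K) : TraceClass K :=
  TraceClass.mulLeft (Ring.inverse (T.op + (c : ℂ) • 1)) T

lemma isUnit_add_smul_one {T : K →L[ℂ] K} (hT : 0 ≤ T) {c : ℝ} (hc : 0 < c) :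
    IsUnit (T + (c : ℂ) • 1) := by
  have h : -c ∉ spectrum ℝ T := fun h => by
    have := spectrum_nonneg_of_nonneg hT h
    linarith
  rw [spectrum.notMem_iff] at h
  have h2 := h.neg
  convert h2 using 1
  rw [Algebra.algebraMap_eq_smul_one, neg_smul]
  ext x
  simp [add_comm]

lemma damp_op_apply {T : TraceClass K} (hT : 0 ≤ T.op) {c : ℝ} (hc : 0 < c) {v : K} {p : ℝ}
    (hp : 0 ≤ p) (hv : T.op v = (p : ℂ) • v) :
    (damp c T).op v = ((p / (p + c) : ℝ) : ℂ) • v := by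
  have hu := isUnit_add_smul_one hT hc
  have hpc : ((p + c : ℝ) : ℂ) ≠ 0 := by exact_mod_cast (by positivity : p + c ≠ 0)
  have h1 : (T.op + (c : ℂ) • 1) v = ((p + c : ℝ) : ℂ) • v := by
    rw [add_apply, hv, smul_apply, one_apply_eq_self, ← add_smul]
    push_cast
    rfl
  have h2 : Ring.inverse (T.op + (c : ℂ) • 1) (((p + c : ℝ) : ℂ) • v) = v := by
    rw [← h1, ← mul_apply_eq_comp, Ring.inverse_mul_cancel _ hu, one_apply_eq_self]
  rw [damp, TraceClass.op_mulLeft, mul_apply_eq_comp, hv]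
  have h3 : (p : ℂ) • v = ((p / (p + c) : ℝ) : ℂ) • (((p + c : ℝ) : ℂ) • v) := by
    rw [smul_smul]
    congr 1
    rw [← Complex.ofReal_mul, div_mul_cancel₀]
    positivity
  rw [h3, map_smul, h2]

/-- The reason for a resolvent in place of a sharp spectral projection: it depends continuously on
`T`, so the truncation of a random operator stays measurable. -/
lemma continuousOn_damp {c : ℝ} (hc : 0 < c) :
    ContinuousOn (damp (K := K) c) {T | 0 ≤ T.op} := by
  intro T hT
  refine ContinuousAt.continuousWithinAt ?_
  have h1 : ContinuousAt (fun T : TraceClass K => Ring.inverse (T.op + (c : ℂ) • 1)) T := by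
    obtain ⟨U, hU⟩ := isUnit_add_smul_one hT hc
    have h2 := NormedRing.inverse_continuousAt U
    rw [hU] at h2
    exact ContinuousAt.comp (f := fun T : TraceClass K => T.op + (c : ℂ) • 1) h2
      (TraceClass.opL.continuous.add continuous_const).continuousAt
  exact (TraceClass.mulLeft.continuous.continuousAt.comp h1).clm_apply continuousAt_id

lemma damp_nonneg {T : TraceClass K} (hT : 0 ≤ T.op) {c : ℝ} (hc : 0 < c) :
    0 ≤ (damp c T).op := by
  obtain ⟨ι, b, a, ha0, ha⟩ := exists_eigenbasis hT T.isTraceClass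
  exact nonneg_of_diag b (fun i => div_nonneg (ha0 i) (by linarith [ha0 i]))
    fun i => damp_op_apply hT hc (ha0 i) (ha i)

lemma norm_op_damp_le {T : TraceClass K} (hT : 0 ≤ T.op) {c : ℝ} (hc : 0 < c) :
    ‖(damp c T).op‖ ≤ 1 := by
  rw [CStarAlgebra.norm_le_one_iff_of_nonneg _ (damp_nonneg hT hc), ← sub_nonneg]
  obtain ⟨ι, b, a, ha0, ha⟩ := exists_eigenbasis hT T.isTraceClass
  refine nonneg_of_diag b (a := fun i => 1 - a i / (a i + c)) (fun i => ?_) fun i => ?_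
  · rw [sub_nonneg, div_le_one (by linarith [ha0 i])]
    linarith
  · rw [sub_apply, damp_op_apply hT hc (ha0 i) (ha i)]
    push_cast
    rw [sub_smul, one_smul]
    rfl

lemma tsum_ofReal_div_le {ι : Type*} {T : TraceClass K} (hT : 0 ≤ T.op) (b : HilbertBasis ι ℂ K)
    {a : ι → ℝ} (ha : ∀ i, T.op (b i) = (a i : ℂ) • b i) {c : ℝ} (hc : 0 < c) :
    ∑' i, ENNReal.ofReal (a i / c) = ENNReal.ofReal (‖T‖ / c) := by
  have h := traceNorm_eq_tsum_of_diag b hT ha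
  simp only [div_eq_inv_mul]
  simp only [ENNReal.ofReal_mul (inv_nonneg.2 hc.le)]
  rw [ENNReal.tsum_mul_left, ← h, TraceClass.ofReal_norm_eq]

/-- Since `(t/(t+c))² ≤ t/(t+c) ≤ t/c`. This plays the role of the rank bound for the projection
onto the eigenvalues above `c`. -/
lemma hsSq_damp_le {T : TraceClass K} (hT : 0 ≤ T.op) {c : ℝ} (hc : 0 < c) :
    hsSq (damp c T).op ≤ ENNReal.ofReal (‖T‖ / c) := by
  obtain ⟨ι, b, a, ha0, ha⟩ := exists_eigenbasis hT T.isTraceClass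
  rw [hsSq_eq_tsum_of_diag b fun i => damp_op_apply hT hc (ha0 i) (ha i),
    ← tsum_ofReal_div_le hT b ha hc]
  refine ENNReal.tsum_le_tsum fun i => ENNReal.ofReal_le_ofReal ?_
  have h1 : 0 < a i + c := by linarith [ha0 i]
  have h2 : a i / (a i + c) ≤ 1 := by rw [div_le_one h1]; linarith
  have h3 : 0 ≤ a i / (a i + c) := div_nonneg (ha0 i) h1.le
  calc (a i / (a i + c)) ^ 2 ≤ a i / (a i + c) := by nlinarith
    _ ≤ a i / c := by
      have := ha0 i
      gcongr
      linarith

lemma norm_damp_le {T : TraceClass K} (hT : 0 ≤ T.op) {c : ℝ} (hc : 0 < c) :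
    ‖damp c T‖ ≤ ‖T‖ / c := by
  obtain ⟨ι, b, a, ha0, ha⟩ := exists_eigenbasis hT T.isTraceClass
  refine TraceClass.norm_le_of_traceNorm_le (by positivity) ?_
  rw [traceNorm_eq_tsum_of_diag b (damp_nonneg hT hc)
    fun i => damp_op_apply hT hc (ha0 i) (ha i), ← tsum_ofReal_div_le hT b ha hc]
  refine ENNReal.tsum_le_tsum fun i => ENNReal.ofReal_le_ofReal ?_
  have := ha0 i
  gcongr
  linarith

end Damping

/-! ### One-shot covering bound for the expected trace norm. -/

section OneShot

variable {K : Type u} [NormedAddCommGroup K] [InnerProductSpace ℂ K] [CompleteSpace K]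
  {Y : Type v} [MeasurableSpace Y] (μ : Measure Y) [IsProbabilityMeasure μ]

/-- The fluctuation of the empirical average of `h` along a codebook around the mean of `h`. -/
def fluctuation (h : Y → TraceClass K) {M : ℕ} (C : Fin M → Y) : TraceClass K :=
  (1 / M : ℂ) • ∑ m, h (C m) - ∫ y, h y ∂μ

lemma fluctuation_clm {h : Y → TraceClass K} (hh : Integrable h μ)
    (L : TraceClass K →L[ℂ] TraceClass K) {M : ℕ} (C : Fin M → Y) :
    L (fluctuation μ h C) = fluctuation μ (fun y => L (h y)) C := by
  rw [fluctuation, fluctuation, ContinuousLinearMap.integral_comp_comm L hh, map_sub, map_smul,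
    map_sum]

lemma fluctuation_add {g h : Y → TraceClass K} (hg : Integrable g μ) (hh : Integrable h μ)
    {M : ℕ} (C : Fin M → Y) :
    fluctuation μ (fun y => g y + h y) C = fluctuation μ g C + fluctuation μ h C := by
  rw [fluctuation, fluctuation, fluctuation, integral_add hg hh, Finset.sum_add_distrib, smul_add]
  abel

lemma stronglyMeasurable_fluctuation {h : Y → TraceClass K} (hh : StronglyMeasurable h) {M : ℕ} :
    StronglyMeasurable (fun C : Fin M → Y => fluctuation μ h C) := by
  unfold fluctuation
  have h1 : StronglyMeasurable fun C : Fin M → Y => ∑ m, h (C m) :=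
    Finset.stronglyMeasurable_fun_sum _ fun m _ => hh.comp_measurable (measurable_pi_apply m)
  exact (h1.fun_const_smul (1 / M : ℂ)).sub stronglyMeasurable_const

/-- Triangle inequality only, with no gain from `M`; meant for the pieces of the output that are
already small on average. -/
lemma lintegral_enorm_fluctuation_le {h : Y → TraceClass K} (hh : StronglyMeasurable h) {M : ℕ}
    (hM : 0 < M) :
    ∫⁻ C : Fin M → Y, ‖fluctuation μ h C‖ₑ ∂(Measure.pi fun _ => μ)
      ≤ 2 * ∫⁻ y, ‖h y‖ₑ ∂μ := by
  have hmeas : ∀ m : Fin M, Measurable fun C : Fin M → Y => ‖h (C m)‖ₑ := fun m =>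
    (hh.comp_measurable (measurable_pi_apply m)).enorm
  have hc : ‖(1 / M : ℂ)‖ₑ = (M : ℝ≥0∞)⁻¹ := by
    rw [one_div, enorm_inv (by exact_mod_cast hM.ne')]
    congr 1
    rw [← ofReal_norm]
    simp
  calc ∫⁻ C : Fin M → Y, ‖fluctuation μ h C‖ₑ ∂(Measure.pi fun _ => μ)
      ≤ ∫⁻ C : Fin M → Y, ((M : ℝ≥0∞)⁻¹ * ∑ m, ‖h (C m)‖ₑ + ∫⁻ y, ‖h y‖ₑ ∂μ)
          ∂(Measure.pi fun _ => μ) := by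
        refine lintegral_mono fun C => ?_
        rw [fluctuation]
        refine (enorm_sub_le).trans (add_le_add ?_ (enorm_integral_le_lintegral_enorm _))
        rw [enorm_smul, hc]
        gcongr
        exact enorm_sum_le _ _
    _ = (M : ℝ≥0∞)⁻¹ * ∑ m : Fin M, ∫⁻ y, ‖h y‖ₑ ∂μ + ∫⁻ y, ‖h y‖ₑ ∂μ := by
        rw [lintegral_add_right _ measurable_const, lintegral_const_mul _ (by fun_prop),
          lintegral_finsetSum _ fun m _ => hmeas m]
        simp only [lintegral_const, measure_univ, mul_one]
        congr 3
        funext m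
        exact (measurePreserving_eval (fun _ : Fin M => μ) m).lintegral_comp hh.enorm
    _ = 2 * ∫⁻ y, ‖h y‖ₑ ∂μ := by
        rw [Finset.sum_const, Finset.card_univ, Fintype.card_fin, nsmul_eq_mul, ← mul_assoc,
          ENNReal.inv_mul_cancel (by exact_mod_cast hM.ne') (by simp), one_mul, two_mul]

variable [TopologicalSpace.SeparableSpace K]

/-- The squared Hilbert–Schmidt norm is the sum of the squared matrix entries, and each entry is a
scalar empirical mean. The bound `B` ensures integrability and does not enter the estimate. -/
lemma lintegral_hsSq_fluctuation_le {h : Y → TraceClass K} (hh : StronglyMeasurable h) {M : ℕ}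
    (hM : 0 < M) {B : ℝ} (hB : ∀ y, ‖h y‖ ≤ B) :
    ∫⁻ C : Fin M → Y, hsSq (fluctuation μ h C).op ∂(Measure.pi fun _ => μ)
      ≤ ENNReal.ofReal (1 / M) * ∫⁻ y, hsSq (h y).op ∂μ := by
  have hcount : Countable (BasisIndex K) := countable_of_hilbertBasis (stdBasis K)
  have hint : Integrable h μ := Integrable.of_bound hh.aestronglyMeasurable B
    (Eventually.of_forall hB)
  have hexp : ∀ A : K →L[ℂ] K, hsSq A = ∑' p : BasisIndex K × BasisIndex K,
      ‖⟪stdBasis K p.2, A (stdBasis K p.1)⟫_ℂ‖ₑ ^ 2 := fun A => by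
    rw [ENNReal.tsum_prod', hsSq]
    exact tsum_congr fun i => enorm_sq_eq_tsum _ _
  have hentry : ∀ p : BasisIndex K × BasisIndex K,
      StronglyMeasurable fun y => ⟪stdBasis K p.2, (h y).op (stdBasis K p.1)⟫_ℂ := fun p =>
    (TraceClass.matrixElement (stdBasis K p.2) (stdBasis K p.1)).continuous.comp_stronglyMeasurable
      hh
  have hfl : ∀ (p : BasisIndex K × BasisIndex K) (C : Fin M → Y),
      ⟪stdBasis K p.2, (fluctuation μ h C).op (stdBasis K p.1)⟫_ℂ
        = (1 / M : ℂ) * ∑ m, ⟪stdBasis K p.2, (h (C m)).op (stdBasis K p.1)⟫_ℂ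
          - ∫ y, ⟪stdBasis K p.2, (h y).op (stdBasis K p.1)⟫_ℂ ∂μ := fun p C => by
    simp only [← TraceClass.matrixElement_apply]
    rw [fluctuation, map_sub, map_smul, map_sum, smul_eq_mul,
      ContinuousLinearMap.integral_comp_comm _ hint]
  simp only [hexp]
  rw [lintegral_tsum, lintegral_tsum, ← ENNReal.tsum_mul_left]
  · refine ENNReal.tsum_le_tsum fun p => ?_
    have hbd : ∀ y, ‖⟪stdBasis K p.2, (h y).op (stdBasis K p.1)⟫_ℂ‖ ≤ B := fun y => by
      refine (norm_inner_le_norm _ _).trans ?_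
      rw [(stdBasis K).orthonormal.1, one_mul]
      refine ((h y).op.le_opNorm _).trans ?_
      rw [(stdBasis K).orthonormal.1, mul_one]
      exact (h y).opNorm_le.trans (hB y)
    have key := lintegral_enorm_sq_average_sub_le μ hM (hentry p).measurable hbd
    simp only [← hfl p] at key
    exact key
  · exact fun p => ((hentry p).enorm.pow_const 2).aemeasurable
  · intro p
    have := (TraceClass.matrixElement (stdBasis K p.2)
      (stdBasis K p.1)).continuous.comp_stronglyMeasurable
      (stronglyMeasurable_fluctuation (M := M) μ hh)
    exact (this.enorm.pow_const 2).aemeasurable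

/-- Gentle measurement: with `S = √ρ` and `N = 1 - damp c σ`, write `Nρ = (N S) S`. Here `‖S‖₂ = 1`,
while `‖N S‖₂²` has mean `tr N² σ = ∑ (c/(a_i+c))² a_i`, because `N` is diagonal in the eigenbasis
of `σ`. -/
lemma lintegral_enorm_mulLeft_one_sub_damp_le {ρ : Y → TraceClass K} (hρ : StronglyMeasurable ρ)
    (hpos : ∀ y, 0 ≤ (ρ y).op) (hnorm : ∀ y, ‖ρ y‖ = 1) (hσ : 0 ≤ (∫ y, ρ y ∂μ).op) {ι : Type*}
    (b : HilbertBasis ι ℂ K) {a : ι → ℝ} (ha0 : ∀ i, 0 ≤ a i)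
    (ha : ∀ i, (∫ y, ρ y ∂μ).op (b i) = (a i : ℂ) • b i) {c δ : ℝ} (hc : 0 < c) (hδ : 0 < δ)
    (hle : ∑' i, ENNReal.ofReal ((c / (a i + c)) ^ 2 * a i) ≤ ENNReal.ofReal δ) :
    ∫⁻ y, ‖TraceClass.mulLeft (1 - (damp c (∫ y, ρ y ∂μ)).op) (ρ y)‖ₑ ∂μ
      ≤ ENNReal.ofReal (Real.sqrt δ) := by
  set σ := ∫ y, ρ y ∂μ with hσdef
  have hcount : Countable ι := countable_of_hilbertBasis b
  have hint : Integrable ρ μ := Integrable.of_bound hρ.aestronglyMeasurable 1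
    (Eventually.of_forall fun y => (hnorm y).le)
  set N : K →L[ℂ] K := 1 - (damp c σ).op with hN
  have hNb : ∀ i, N (b i) = ((c / (a i + c) : ℝ) : ℂ) • b i := fun i => by
    rw [hN, sub_apply, damp_op_apply hσ hc (ha0 i) (ha i), one_apply_eq_self]
    have h1 : c / (a i + c) = 1 - a i / (a i + c) := by
      have : a i + c ≠ 0 := by linarith [ha0 i]
      field_simp
      ring
    rw [h1]
    push_cast
    rw [sub_smul, one_smul]
  have hNs : star N = N :=
    (nonneg_of_diag b (fun i => div_nonneg hc.le (by linarith [ha0 i])) hNb).isSelfAdjoint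
  -- The weight that balances `δ/ε` against `ε`.
  set ε := Real.sqrt δ with hε
  have hε0 : 0 < ε := Real.sqrt_pos.2 hδ
  have hpt : ∀ y, 2 * ‖TraceClass.mulLeft N (ρ y)‖ₑ ≤ ENNReal.ofReal (1 / ε) *
      (∑' i, ENNReal.ofReal ((c / (a i + c)) ^ 2) * ‖⟪b i, (ρ y).op (b i)⟫_ℂ‖ₑ)
        + ENNReal.ofReal ε := by
    intro y
    set S := CFC.sqrt (ρ y).op with hS
    have hs : star S = S := (CFC.sqrt_nonneg _).isSelfAdjoint
    have hSS : S * S = (ρ y).op := CFC.sqrt_mul_sqrt_self _ (hpos y)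
    have h1 := traceNorm_mul_le_of_pos (one_div_pos.2 hε0) (N * S) S
    rw [mul_assoc, hSS, one_div_one_div] at h1
    have h2 : hsSq S = 1 := by
      rw [hS, ← posTrace_eq_hsSq (hpos y), ← traceNorm_of_nonneg (hpos y),
        ← TraceClass.ofReal_norm_eq, hnorm, ENNReal.ofReal_one]
    have h3 : hsSq (N * S)
        ≤ ∑' i, ENNReal.ofReal ((c / (a i + c)) ^ 2) * ‖⟪b i, (ρ y).op (b i)⟫_ℂ‖ₑ := by
      rw [← hsSq_star, star_mul, hs, hNs, hsSq_eq_tsum b]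
      refine ENNReal.tsum_le_tsum fun i => le_of_eq ?_
      have h4 : ⟪b i, (ρ y).op (b i)⟫_ℂ = ((‖S (b i)‖ ^ 2 : ℝ) : ℂ) := by
        rw [← hSS, mul_apply_eq_comp]
        nth_rw 1 [← hs]
        rw [ContinuousLinearMap.star_eq_adjoint, ContinuousLinearMap.adjoint_inner_right,
          inner_self_eq_norm_sq_to_K]
        push_cast
        rfl
      rw [mul_apply_eq_comp, hNb, map_smul, enorm_smul, mul_pow, h4, ← ofReal_norm, ← ofReal_norm,
        ← ofReal_norm, ← ENNReal.ofReal_pow (norm_nonneg _), ← ENNReal.ofReal_pow (norm_nonneg _),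
        Complex.norm_real, Complex.norm_real, Real.norm_eq_abs, sq_abs, Real.norm_eq_abs,
        abs_of_nonneg (sq_nonneg ‖S (b i)‖)]
    have h5 : ‖TraceClass.mulLeft N (ρ y)‖ₑ = traceNorm (N * (ρ y).op) := by
      rw [← ofReal_norm, TraceClass.ofReal_norm_eq, TraceClass.op_mulLeft]
    rw [h5]
    refine h1.trans ?_
    rw [h2, mul_one]
    gcongr
  have hmean : ∀ i, ∫⁻ y, ‖⟪b i, (ρ y).op (b i)⟫_ℂ‖ₑ ∂μ = ENNReal.ofReal (a i) := by
    intro i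
    have hre : ∀ y, ‖⟪b i, (ρ y).op (b i)⟫_ℂ‖ₑ = ENNReal.ofReal (⟪b i, (ρ y).op (b i)⟫_ℂ).re := by
      intro y
      have hp := (ContinuousLinearMap.nonneg_iff_isPositive _).1 (hpos y)
      have h0 : 0 ≤ (⟪b i, (ρ y).op (b i)⟫_ℂ).re := hp.re_inner_nonneg_right _
      have him : (⟪b i, (ρ y).op (b i)⟫_ℂ).im = 0 := by
        have := hp.isSymmetric.im_inner_self_apply (b i)
        simpa using! this
      have hz : ⟪b i, (ρ y).op (b i)⟫_ℂ = (((⟪b i, (ρ y).op (b i)⟫_ℂ).re : ℝ) : ℂ) :=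
        Complex.ext rfl (by simpa using him)
      conv_lhs => rw [hz]
      rw [← ofReal_norm, Complex.norm_real, Real.norm_of_nonneg h0]
    simp only [hre]
    have hi : Integrable (fun y => ⟪b i, (ρ y).op (b i)⟫_ℂ) μ :=
      (TraceClass.matrixElement (b i) (b i)).integrable_comp hint
    have hire : Integrable (fun y => (⟪b i, (ρ y).op (b i)⟫_ℂ).re) μ := hi.re
    rw [← ofReal_integral_eq_lintegral_ofReal hire]
    · congr 1
      have h1 : ∫ y, (⟪b i, (ρ y).op (b i)⟫_ℂ).re ∂μ = (∫ y, ⟪b i, (ρ y).op (b i)⟫_ℂ ∂μ).re :=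
        integral_re hi
      have h2 : ∫ y, ⟪b i, (ρ y).op (b i)⟫_ℂ ∂μ = ⟪b i, σ.op (b i)⟫_ℂ :=
        ContinuousLinearMap.integral_comp_comm (TraceClass.matrixElement (b i) (b i)) hint
      refine h1.trans ?_
      rw [h2, ha, inner_smul_right, inner_self_eq_norm_sq_to_K, b.orthonormal.1 i]
      simp
    · refine Eventually.of_forall fun y => ?_
      exact ((ContinuousLinearMap.nonneg_iff_isPositive _).1 (hpos y)).re_inner_nonneg_right _
  have hmeas : ∀ i, Measurable fun y => ‖⟪b i, (ρ y).op (b i)⟫_ℂ‖ₑ := fun i =>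
    ((TraceClass.matrixElement (b i) (b i)).continuous.comp_stronglyMeasurable hρ).enorm
  have h2 : 2 * ∫⁻ y, ‖TraceClass.mulLeft N (ρ y)‖ₑ ∂μ ≤ 2 * ENNReal.ofReal ε := by
    rw [← lintegral_const_mul' _ _ (by simp)]
    calc _ ≤ ∫⁻ y, (ENNReal.ofReal (1 / ε) * (∑' i, ENNReal.ofReal ((c / (a i + c)) ^ 2) *
          ‖⟪b i, (ρ y).op (b i)⟫_ℂ‖ₑ) + ENNReal.ofReal ε) ∂μ := lintegral_mono hpt
      _ = ENNReal.ofReal (1 / ε) * (∑' i, ENNReal.ofReal ((c / (a i + c)) ^ 2 * a i))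
          + ENNReal.ofReal ε := by
        rw [lintegral_add_right _ measurable_const, lintegral_const_mul' _ _ (by simp),
          lintegral_tsum fun i => ((hmeas i).const_mul _).aemeasurable]
        simp only [lintegral_const, measure_univ, mul_one]
        congr 3
        funext i
        rw [lintegral_const_mul _ (hmeas i), hmean, ENNReal.ofReal_mul (by positivity)]
      _ ≤ ENNReal.ofReal (1 / ε) * ENNReal.ofReal δ + ENNReal.ofReal ε := by gcongr
      _ = 2 * ENNReal.ofReal ε := by
        rw [← ENNReal.ofReal_mul (by positivity), two_mul]
        congr 2
        rw [one_div, inv_mul_eq_div, div_eq_iff hε0.ne', hε, Real.mul_self_sqrt hδ.le]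
  exact (ENNReal.mul_le_mul_iff_right (by simp) (by simp)).1 h2

/-- One-shot covering: the expected trace norm distance between the output induced by a random
codebook and the mean output. -/
lemma lintegral_enorm_fluctuation_le_of_damp {ρ : Y → TraceClass K} (hρ : StronglyMeasurable ρ)
    (hpos : ∀ y, 0 ≤ (ρ y).op) (hnorm : ∀ y, ‖ρ y‖ = 1) (hσ : 0 ≤ (∫ y, ρ y ∂μ).op)
    (hσ1 : ‖∫ y, ρ y ∂μ‖ ≤ 1)
    {ι : Type*} (b : HilbertBasis ι ℂ K) {a : ι → ℝ} (ha0 : ∀ i, 0 ≤ a i)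
    (ha : ∀ i, (∫ y, ρ y ∂μ).op (b i) = (a i : ℂ) • b i) {c c' δ δ' : ℝ} (hc : 0 < c)
    (hc' : 0 < c') (hδ : 0 < δ)
    (hle : ∑' i, ENNReal.ofReal ((c / (a i + c)) ^ 2 * a i) ≤ ENNReal.ofReal δ)
    (hle' : ∫⁻ y, ‖ρ y - (c' : ℂ) • damp c' (ρ y)‖ₑ ∂μ ≤ ENNReal.ofReal δ') {M : ℕ} (hM : 0 < M) :
    ∫⁻ C : Fin M → Y, ‖fluctuation μ ρ C‖ₑ ∂(Measure.pi fun _ => μ)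
      ≤ 2 * ENNReal.ofReal (Real.sqrt δ) + 2 * ENNReal.ofReal δ'
        + ENNReal.ofReal (Real.sqrt (c' / (c * M))) := by
  have hM' : (0 : ℝ) < M := by exact_mod_cast hM
  set ν := Measure.pi fun _ : Fin M => μ with hν
  set σ := ∫ y, ρ y ∂μ with hσdef
  have hint : Integrable ρ μ := Integrable.of_bound hρ.aestronglyMeasurable 1
    (Eventually.of_forall fun y => (hnorm y).le)
  set T : K →L[ℂ] K := (damp c σ).op with hT
  set g : Y → TraceClass K := fun y => (c' : ℂ) • damp c' (ρ y) with hg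
  -- `damp` is continuous only on positive operators, so `ρ` is first viewed as a map into that
  -- subtype.
  have hgm : StronglyMeasurable g := by
    have h1 : Continuous fun S : {S : TraceClass K // 0 ≤ S.op} => damp c' S.1 :=
      continuousOn_iff_continuous_domRestrict.1 (continuousOn_damp hc')
    have h2 : StronglyMeasurable fun y => (⟨ρ y, hpos y⟩ : {S : TraceClass K // 0 ≤ S.op}) :=
      (Embedding.comp_stronglyMeasurable_iff Topology.IsEmbedding.subtypeVal).1 hρ
    exact (h1.comp_stronglyMeasurable h2).fun_const_smul (c' : ℂ)
  have hgb : ∀ y, ‖g y‖ ≤ 1 := fun y => by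
    have h1 := norm_damp_le (hpos y) hc'
    rw [hnorm] at h1
    rw [hg]
    simp only
    rw [norm_smul, Complex.norm_real, Real.norm_of_nonneg hc'.le]
    calc c' * ‖damp c' (ρ y)‖ ≤ c' * (1 / c') := by gcongr
      _ = 1 := by field_simp
  have hgi : Integrable g μ := Integrable.of_bound hgm.aestronglyMeasurable 1
    (Eventually.of_forall hgb)
  -- `ρ = (1-T)ρ + T(ρ - g) + T g`, using that fluctuations are linear and commute with
  -- multiplication by the fixed operator `T`.
  have hdec : ∀ C : Fin M → Y, fluctuation μ ρ C
      = fluctuation μ (fun y => TraceClass.mulLeft (1 - T) (ρ y)) C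
        + TraceClass.mulLeft T (fluctuation μ (fun y => ρ y - g y) C)
        + TraceClass.mulLeft T (fluctuation μ g C) := by
    intro C
    have h0 := fluctuation_add μ (g := fun y => ρ y - g y) (hint.sub hgi) hgi C
    simp only [sub_add_cancel] at h0
    rw [← fluctuation_clm μ hint, add_assoc, ← map_add, ← h0]
    rw [map_sub, sub_apply, sub_add_cancel]
    exact TraceClass.op_injective (one_mul _).symm
  have hTn : ‖T‖ ≤ 1 := norm_op_damp_le hσ hc
  have h1 : ∫⁻ C : Fin M → Y, ‖fluctuation μ (fun y => TraceClass.mulLeft (1 - T) (ρ y)) C‖ₑ ∂ν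
      ≤ 2 * ENNReal.ofReal (Real.sqrt δ) := by
    refine (lintegral_enorm_fluctuation_le μ
      ((TraceClass.mulLeft (1 - T)).continuous.comp_stronglyMeasurable hρ) hM).trans ?_
    gcongr
    exact lintegral_enorm_mulLeft_one_sub_damp_le μ hρ hpos hnorm hσ b ha0 ha hc hδ hle
  have h2 : ∫⁻ C : Fin M → Y, ‖TraceClass.mulLeft T (fluctuation μ (fun y => ρ y - g y) C)‖ₑ ∂ν
      ≤ 2 * ENNReal.ofReal δ' := by
    calc _ ≤ ∫⁻ C : Fin M → Y, ‖fluctuation μ (fun y => ρ y - g y) C‖ₑ ∂ν := by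
          refine lintegral_mono fun C => ?_
          rw [enorm_le_iff_norm_le]
          refine (TraceClass.norm_mulLeft_le _ _).trans ?_
          exact mul_le_of_le_one_left (norm_nonneg _) hTn
      _ ≤ 2 * ∫⁻ y, ‖ρ y - g y‖ₑ ∂μ := lintegral_enorm_fluctuation_le μ (hρ.sub hgm) hM
      _ ≤ _ := by gcongr
  have h3 : ∫⁻ C : Fin M → Y, ‖TraceClass.mulLeft T (fluctuation μ g C)‖ₑ ∂ν
      ≤ ENNReal.ofReal (Real.sqrt (c' / (c * M))) := by
    -- With `‖T‖₂² ≤ 1/c` and a mean squared fluctuation of at most `c'/M`, this weight makes both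
    -- terms equal to `√(c'/(cM))`.
    set η : ℝ := c * Real.sqrt (c' / (c * M)) with hη
    have hsq : 0 < Real.sqrt (c' / (c * M)) := Real.sqrt_pos.2 (by positivity)
    have hη0 : 0 < η := by positivity
    have hTs : hsSq T ≤ ENNReal.ofReal (1 / c) :=
      (hsSq_damp_le hσ hc).trans (ENNReal.ofReal_le_ofReal (by gcongr))
    have hgs : ∀ y, hsSq (g y).op ≤ ENNReal.ofReal c' := fun y => by
      have h4 := hsSq_damp_le (hpos y) hc'
      rw [hnorm] at h4
      have h5 : (g y).op = (c' : ℂ) • (damp c' (ρ y)).op := rfl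
      rw [h5, hsSq_smul]
      calc ‖(c' : ℂ)‖ₑ ^ 2 * hsSq (damp c' (ρ y)).op
          ≤ ENNReal.ofReal (c' ^ 2) * ENNReal.ofReal (1 / c') := by
            gcongr
            rw [← ofReal_norm, ← ENNReal.ofReal_pow (norm_nonneg _), Complex.norm_real,
              Real.norm_of_nonneg hc'.le]
        _ = ENNReal.ofReal c' := by
            rw [← ENNReal.ofReal_mul (by positivity)]
            congr 1
            field_simp
    have hfl : ∫⁻ C : Fin M → Y, hsSq (fluctuation μ g C).op ∂ν ≤ ENNReal.ofReal (c' / M) := by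
      refine (lintegral_hsSq_fluctuation_le μ hgm hM hgb).trans ?_
      calc _ ≤ ENNReal.ofReal (1 / M) * ∫⁻ _, ENNReal.ofReal c' ∂μ := by
            gcongr with y
            exact hgs y
        _ = _ := by
            rw [lintegral_const, measure_univ, mul_one, ← ENNReal.ofReal_mul (by positivity)]
            congr 1
            ring
    have h6 : 2 * ∫⁻ C : Fin M → Y, ‖TraceClass.mulLeft T (fluctuation μ g C)‖ₑ ∂ν
        ≤ 2 * ENNReal.ofReal (Real.sqrt (c' / (c * M))) := by
      rw [← lintegral_const_mul' _ _ (by simp)]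
      calc _ ≤ ∫⁻ C : Fin M → Y, (ENNReal.ofReal η * hsSq T
            + ENNReal.ofReal (1 / η) * hsSq (fluctuation μ g C).op) ∂ν := by
            refine lintegral_mono fun C => ?_
            rw [← ofReal_norm, TraceClass.ofReal_norm_eq, TraceClass.op_mulLeft]
            exact traceNorm_mul_le_of_pos hη0 _ _
        _ = ENNReal.ofReal η * hsSq T
            + ENNReal.ofReal (1 / η) * ∫⁻ C : Fin M → Y, hsSq (fluctuation μ g C).op ∂ν := by
            rw [lintegral_add_left measurable_const, lintegral_const, measure_univ, mul_one,
              lintegral_const_mul' _ _ (by simp)]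
        _ ≤ ENNReal.ofReal η * ENNReal.ofReal (1 / c)
            + ENNReal.ofReal (1 / η) * ENNReal.ofReal (c' / M) := by gcongr
        _ = _ := by
            rw [← ENNReal.ofReal_mul hη0.le, ← ENNReal.ofReal_mul (by positivity), two_mul]
            congr 2
            · rw [hη]; field_simp
            · have h7 := Real.mul_self_sqrt (by positivity : 0 ≤ c' / (c * M))
              rw [one_div, inv_mul_eq_div, div_eq_iff hη0.ne', hη]
              have h8 : Real.sqrt (c' / (c * M)) * (c * Real.sqrt (c' / (c * M)))
                  = c * (Real.sqrt (c' / (c * M)) * Real.sqrt (c' / (c * M))) := by ring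
              rw [h8, h7]
              field_simp
    exact (ENNReal.mul_le_mul_iff_right (by simp) (by simp)).1 h6
  have hm1 : Measurable fun C : Fin M → Y =>
      ‖fluctuation μ (fun y => TraceClass.mulLeft (1 - T) (ρ y)) C‖ₑ :=
    (stronglyMeasurable_fluctuation μ
      ((TraceClass.mulLeft (1 - T)).continuous.comp_stronglyMeasurable hρ)).enorm
  have hm2 : Measurable fun C : Fin M → Y =>
      ‖TraceClass.mulLeft T (fluctuation μ (fun y => ρ y - g y) C)‖ₑ :=
    ((TraceClass.mulLeft T).continuous.comp_stronglyMeasurable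
      (stronglyMeasurable_fluctuation μ (hρ.sub hgm))).enorm
  calc ∫⁻ C : Fin M → Y, ‖fluctuation μ ρ C‖ₑ ∂ν
      ≤ ∫⁻ C : Fin M → Y, (‖fluctuation μ (fun y => TraceClass.mulLeft (1 - T) (ρ y)) C‖ₑ
        + ‖TraceClass.mulLeft T (fluctuation μ (fun y => ρ y - g y) C)‖ₑ
        + ‖TraceClass.mulLeft T (fluctuation μ g C)‖ₑ) ∂ν := by
        refine lintegral_mono fun C => ?_
        conv_lhs => rw [hdec C]
        exact (enorm_add_le _ _).trans (by gcongr; exact enorm_add_le _ _)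
    _ ≤ _ := by
        have e := lintegral_add_left (μ := ν) (hm1.add hm2)
          fun C => ‖TraceClass.mulLeft T (fluctuation μ g C)‖ₑ
        simp only [Pi.add_apply] at e
        rw [e, lintegral_add_left hm1]
        exact add_le_add (add_le_add h1 h2) h3

end OneShot

/-! ### Inequalities for eigenvalues: Taylor bounds, entropy bounds, cutoff bounds. -/

section ScalarInequalities

lemma exp_le_one_add_add_sq {y : ℝ} (hy : y ≤ 0) : Real.exp y ≤ 1 + y + y ^ 2 := by
  have h1 : (1 - y) * Real.exp y ≤ 1 := by
    have h2 := Real.add_one_le_exp (-y)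
    calc (1 - y) * Real.exp y ≤ Real.exp (-y) * Real.exp y := by
          gcongr; linarith
      _ = 1 := by rw [← Real.exp_add]; simp
  nlinarith [Real.add_one_le_exp y]

lemma exp_le_one_add_add_sq_mul {y : ℝ} (hy : 0 ≤ y) :
    Real.exp y ≤ 1 + y + y ^ 2 * Real.exp y := by
  have h1 : (1 - y) * Real.exp y ≤ 1 := by
    have h2 := Real.add_one_le_exp (-y)
    calc (1 - y) * Real.exp y ≤ Real.exp (-y) * Real.exp y := by
          gcongr; linarith
      _ = 1 := by rw [← Real.exp_add]; simp
  nlinarith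

lemma rpow_mul_log_sq_le {t β e : ℝ} (ht : 0 < t) (ht1 : t ≤ 1) (hβ : 0 < β) (he : β ≤ e) :
    t ^ e * Real.log t ^ 2 ≤ (2 / β) ^ 2 := by
  have h1 := (Real.abs_log_mul_self_rpow_lt t (β / 2) ht ht1 (by positivity)).le
  have h2 : t ^ β = (t ^ (β / 2)) ^ 2 := by
    rw [← Real.rpow_natCast, ← Real.rpow_mul ht.le]
    congr 1
    push_cast
    ring
  calc t ^ e * Real.log t ^ 2 ≤ t ^ β * Real.log t ^ 2 := by
        gcongr ?_ * _
        exact Real.rpow_le_rpow_of_exponent_ge ht ht1 he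
    _ = |Real.log t * t ^ (β / 2)| ^ 2 := by rw [sq_abs, h2]; ring
    _ ≤ (1 / (β / 2)) ^ 2 := by gcongr
    _ = (2 / β) ^ 2 := by rw [one_div_div]

/-- Second order expansion of `exp (s log t)`. The remainder `s² t log² t` is absorbed into `t^α`
because `t^(1-α) log² t` is bounded on `(0, 1]`. -/
lemma rpow_one_add_le {t α s : ℝ} (ht : t ∈ Set.Icc (0 : ℝ) 1) (hα : α ∈ Set.Ioo (0 : ℝ) 1)
    (hs : 0 < s) :
    t ^ (1 + s) ≤ t + s * (t * Real.log t) + s ^ 2 * (2 / ((1 - α) / 2)) ^ 2 * t ^ α := by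
  rcases ht.1.eq_or_lt with h | h
  · rw [← h, Real.zero_rpow (by linarith), Real.zero_rpow hα.1.ne']
    simp
  have hlog : Real.log t ≤ 0 := Real.log_nonpos ht.1 ht.2
  have h1 := exp_le_one_add_add_sq (y := s * Real.log t) (by nlinarith)
  have h2 : t ^ (1 + s) = t * Real.exp (s * Real.log t) := by
    rw [Real.rpow_add h, Real.rpow_one, Real.rpow_def_of_pos h, mul_comm s]
  have h3 := rpow_mul_log_sq_le (e := 1 - α) h ht.2 (β := (1 - α) / 2) (by linarith [hα.2])
    (by linarith [hα.2])
  have h4 : t = t ^ α * t ^ (1 - α) := by rw [← Real.rpow_add h]; simp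
  have h5 : t * Real.log t ^ 2 ≤ (2 / ((1 - α) / 2)) ^ 2 * t ^ α := by
    calc t * Real.log t ^ 2 = t ^ α * (t ^ (1 - α) * Real.log t ^ 2) := by
          rw [← mul_assoc, ← h4]
      _ ≤ t ^ α * (2 / ((1 - α) / 2)) ^ 2 := by gcongr
      _ = _ := mul_comm _ _
  rw [h2]
  calc t * Real.exp (s * Real.log t)
      ≤ t * (1 + s * Real.log t + (s * Real.log t) ^ 2) := by gcongr
    _ = t + s * (t * Real.log t) + s ^ 2 * (t * Real.log t ^ 2) := by ring
    _ ≤ t + s * (t * Real.log t) + s ^ 2 * ((2 / ((1 - α) / 2)) ^ 2 * t ^ α) := by gcongr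
    _ = _ := by ring

/-- Here the remainder carries `t^(1-s) log² t`. The restriction on `s` leaves the exponent `1 - s -
α ≥ (1-α)/2` to absorb the logarithm, which yields the same constant as for `1 + s`. -/
lemma rpow_one_sub_le {t α s : ℝ} (ht : t ∈ Set.Icc (0 : ℝ) 1) (hα : α ∈ Set.Ioo (0 : ℝ) 1)
    (hs : 0 < s) (hs1 : s ≤ (1 - α) / 2) :
    t ^ (1 - s) ≤ t - s * (t * Real.log t) + s ^ 2 * (2 / ((1 - α) / 2)) ^ 2 * t ^ α := by
  rcases ht.1.eq_or_lt with h | h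
  · rw [← h, Real.zero_rpow (by linarith [hα.1]), Real.zero_rpow hα.1.ne']
    simp
  have hlog : Real.log t ≤ 0 := Real.log_nonpos ht.1 ht.2
  have h1 := exp_le_one_add_add_sq_mul (y := -(s * Real.log t)) (by nlinarith)
  have h2 : t ^ (1 - s) = t * Real.exp (-(s * Real.log t)) := by
    rw [sub_eq_add_neg, Real.rpow_add h, Real.rpow_one, Real.rpow_def_of_pos h]
    congr 2
    ring
  have h3 := rpow_mul_log_sq_le (e := 1 - s - α) h ht.2 (β := (1 - α) / 2) (by linarith [hα.2])
    (by linarith [hα.2])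
  have h4 : t ^ (1 - s) = t ^ α * t ^ (1 - s - α) := by rw [← Real.rpow_add h]; congr 1; ring
  have h5 : t ^ (1 - s) * Real.log t ^ 2 ≤ (2 / ((1 - α) / 2)) ^ 2 * t ^ α := by
    calc t ^ (1 - s) * Real.log t ^ 2 = t ^ α * (t ^ (1 - s - α) * Real.log t ^ 2) := by
          rw [← mul_assoc, ← h4]
      _ ≤ t ^ α * (2 / ((1 - α) / 2)) ^ 2 := by gcongr
      _ = _ := mul_comm _ _
  calc t ^ (1 - s) = t * Real.exp (-(s * Real.log t)) := h2
    _ ≤ t * (1 + -(s * Real.log t) + (-(s * Real.log t)) ^ 2 * Real.exp (-(s * Real.log t))) := by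
        gcongr
    _ = t - s * (t * Real.log t)
        + s ^ 2 * (t * Real.exp (-(s * Real.log t)) * Real.log t ^ 2) := by ring
    _ ≤ t - s * (t * Real.log t) + s ^ 2 * ((2 / ((1 - α) / 2)) ^ 2 * t ^ α) := by
        rw [← h2]; gcongr
    _ = _ := by ring

lemma neg_mul_log_le {t α : ℝ} (ht : t ∈ Set.Icc (0 : ℝ) 1) (hα : α ∈ Set.Ioo (0 : ℝ) 1) :
    -(t * Real.log t) ≤ 1 / (1 - α) * t ^ α := by
  rcases ht.1.eq_or_lt with h | h
  · rw [← h, Real.zero_rpow hα.1.ne']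
    simp
  have h1 := (Real.abs_log_mul_self_rpow_lt t (1 - α) h ht.2 (by linarith [hα.2])).le
  have h4 : t = t ^ α * t ^ (1 - α) := by rw [← Real.rpow_add h]; simp
  calc -(t * Real.log t) = t ^ α * (-(Real.log t * t ^ (1 - α))) := by
        nth_rw 1 [h4]; ring
    _ ≤ t ^ α * (1 / (1 - α)) := by
        gcongr
        exact (neg_le_abs _).trans h1
    _ = _ := mul_comm _ _

/-- Tangent line at `r` of the convex function `t log t`. -/
lemma tangent_le_mul_log {t r : ℝ} (ht : 0 ≤ t) (hr : 0 < r) :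
    (1 + Real.log r) * t - r ≤ t * Real.log t := by
  rcases ht.eq_or_lt with h | h
  · rw [← h]; simp [hr.le]
  have h1 := Real.one_sub_inv_le_log_of_pos (div_pos h hr)
  rw [Real.log_div h.ne' hr.ne', inv_div] at h1
  have h2 : t * (1 - r / t) = t - r := by field_simp
  nlinarith

/-- The left side is at most `min(t, c)`, hence at most the interpolation `c^s t^(1-s)`. This is the
Chernoff bound for eigenvalues below the cutoff, in multiplicative form. -/
lemma sq_div_add_mul_le {c t s : ℝ} (hc : 0 < c) (ht : 0 ≤ t) (hs : s ∈ Set.Ioo (0 : ℝ) 1) :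
    (c / (t + c)) ^ 2 * t ≤ c ^ s * t ^ (1 - s) := by
  rcases ht.eq_or_lt with h | h
  · rw [← h, Real.zero_rpow (by linarith [hs.2])]
    simp
  have h0 : c / (t + c) ≤ 1 := by rw [div_le_one (by positivity)]; linarith
  have h0' : 0 ≤ c / (t + c) := by positivity
  rcases le_total t c with htc | htc
  · calc (c / (t + c)) ^ 2 * t ≤ 1 * t := by gcongr; nlinarith
      _ = t ^ s * t ^ (1 - s) := by rw [← Real.rpow_add h]; simp
      _ ≤ c ^ s * t ^ (1 - s) := by
          gcongr
          exact hs.1.le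
  · calc (c / (t + c)) ^ 2 * t ≤ (c / (t + c)) * t := by gcongr; nlinarith
      _ ≤ c := by
          rw [div_mul_eq_mul_div, div_le_iff₀ (by positivity)]
          nlinarith
      _ = c ^ s * c ^ (1 - s) := by rw [← Real.rpow_add hc]; simp
      _ ≤ c ^ s * t ^ (1 - s) := by
          gcongr
          linarith [hs.2]

/-- The left side is `t · t/(t+c)`, and `t/(t+c) ≤ min(1, t/c) ≤ (t/c)^s`: the Chernoff bound for
eigenvalues above the cutoff. -/
lemma sub_mul_div_add_le {c t s : ℝ} (hc : 0 < c) (ht : 0 ≤ t) (hs : s ∈ Set.Ioo (0 : ℝ) 1) :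
    t - c * (t / (t + c)) ≤ c ^ (-s) * t ^ (1 + s) := by
  rcases ht.eq_or_lt with h | h
  · rw [← h, Real.zero_rpow (by linarith [hs.1])]
    simp
  have h1 : t - c * (t / (t + c)) = t * (t / (t + c)) := by field_simp; ring
  have h2 : t / (t + c) ≤ (t / c) ^ s := by
    rcases le_total t c with htc | htc
    · calc t / (t + c) ≤ t / c := by gcongr; linarith
        _ = (t / c) ^ (1 : ℝ) := (Real.rpow_one _).symm
        _ ≤ (t / c) ^ s := by
          refine Real.rpow_le_rpow_of_exponent_ge (by positivity) ?_ hs.2.le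
          rwa [div_le_one hc]
    · calc t / (t + c) ≤ 1 := by rw [div_le_one (by positivity)]; linarith
        _ ≤ (t / c) ^ s := by
          refine Real.one_le_rpow ?_ hs.1.le
          rwa [one_le_div hc]
  rw [h1]
  calc t * (t / (t + c)) ≤ t * (t / c) ^ s := by gcongr
    _ = _ := by
      rw [Real.div_rpow ht hc.le, Real.rpow_add h, Real.rpow_one, Real.rpow_neg hc.le]
      ring

end ScalarInequalities

/-! ### Entropy and power sums of density operators through their eigenvalues. -/

section Entropy

variable {H : Type u} [NormedAddCommGroup H] [InnerProductSpace ℂ H] [CompleteSpace H]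

lemma hilbertBasis_ne_zero {ι : Type*} (b : HilbertBasis ι ℂ H) (i : ι) : b i ≠ 0 :=
  b.orthonormal.ne_zero i

lemma neg_mulLog_apply {T : H →L[ℂ] H} (hT : 0 ≤ T) {v : H} {p : ℝ} (hv : T v = (p : ℂ) • v)
    (hv0 : v ≠ 0) : (-mulLog T) v = ((-(p * Real.log p) : ℝ) : ℂ) • v := by
  rw [neg_apply, mulLog_apply_of_eigenvector hT hv hv0]
  push_cast
  rw [neg_smul]

lemma neg_mulLog_nonneg {T : TraceClass H} (hT : T ∈ densityOperators H) :
    0 ≤ -mulLog T.op := by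
  obtain ⟨ι, b, a, ha0, -, ha⟩ := exists_eigenbasis_of_mem_densityOperators hT
  refine nonneg_of_diag b (fun i => ?_) fun i =>
    neg_mulLog_apply hT.1 (ha i) (hilbertBasis_ne_zero b i)
  have := Real.mul_log_nonpos (ha0 i).1 (ha0 i).2
  linarith

lemma traceNorm_neg (A : H →L[ℂ] H) : traceNorm (-A) = traceNorm A := by
  have := traceNorm_smul (-1 : ℂ) A
  simpa using this

lemma neg_trace_mulLog_eq_norm {T : TraceClass H} (hT : T ∈ densityOperators H)
    (h : IsTraceClass (mulLog T.op)) :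
    -(toTraceClass (mulLog T.op)).trace.re = ‖toTraceClass (mulLog T.op)‖ := by
  have h1 : 0 ≤ (-toTraceClass (mulLog T.op)).op := by
    change 0 ≤ -(toTraceClass (mulLog T.op)).op
    rw [toTraceClass_op h]
    exact neg_mulLog_nonneg hT
  rw [← norm_neg, ← TraceClass.trace_re_eq_norm h1, ← TraceClass.traceL_apply,
    ← TraceClass.traceL_apply, map_neg, Complex.neg_re]

lemma neg_trace_mulLog_nonneg {T : TraceClass H} (hT : T ∈ densityOperators H)
    (h : IsTraceClass (mulLog T.op)) : 0 ≤ -(toTraceClass (mulLog T.op)).trace.re := by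
  rw [neg_trace_mulLog_eq_norm hT h]
  exact norm_nonneg _

lemma ofReal_neg_trace_mulLog {T : TraceClass H} (hT : T ∈ densityOperators H)
    (h : IsTraceClass (mulLog T.op)) :
    ENNReal.ofReal (-(toTraceClass (mulLog T.op)).trace.re) = posTrace (-mulLog T.op) := by
  rw [neg_trace_mulLog_eq_norm hT h, TraceClass.ofReal_norm_eq, toTraceClass_op h, ← traceNorm_neg,
    traceNorm_of_nonneg (neg_mulLog_nonneg hT)]

lemma hasSum_of_tsum_ofReal {ι : Type*} {f : ι → ℝ} (hf : ∀ i, 0 ≤ f i) {r : ℝ} (hr : 0 ≤ r)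
    (h : ∑' i, ENNReal.ofReal (f i) = ENNReal.ofReal r) : HasSum f r := by
  have h1 : Summable fun i => (ENNReal.ofReal (f i)).toReal :=
    ENNReal.summable_toReal (by rw [h]; simp)
  simp only [ENNReal.toReal_ofReal (hf _)] at h1
  have h2 := ENNReal.ofReal_tsum_of_nonneg hf h1
  rw [h, ENNReal.ofReal_eq_ofReal_iff (tsum_nonneg hf) hr] at h2
  exact h2 ▸ h1.hasSum

lemma hasSum_mul_log {T : TraceClass H} (hT : T ∈ densityOperators H)
    (h : IsTraceClass (mulLog T.op)) {ι : Type*} (b : HilbertBasis ι ℂ H) {a : ι → ℝ}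
    (ha0 : ∀ i, a i ∈ Set.Icc (0 : ℝ) 1) (ha : ∀ i, T.op (b i) = (a i : ℂ) • b i) :
    HasSum (fun i => a i * Real.log (a i)) (toTraceClass (mulLog T.op)).trace.re := by
  have h1 : HasSum (fun i => -(a i * Real.log (a i)))
      (-(toTraceClass (mulLog T.op)).trace.re) := by
    refine hasSum_of_tsum_ofReal (fun i => ?_) (neg_trace_mulLog_nonneg hT h) ?_
    · have := Real.mul_log_nonpos (ha0 i).1 (ha0 i).2
      linarith
    · rw [ofReal_neg_trace_mulLog hT h, ← traceNorm_of_nonneg (neg_mulLog_nonneg hT),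
        traceNorm_eq_tsum_of_diag b (neg_mulLog_nonneg hT)
        fun i => neg_mulLog_apply hT.1 (ha i) (hilbertBasis_ne_zero b i)]
  simpa using h1.neg

lemma hasSum_rpow {T : TraceClass H} (hT : T ∈ densityOperators H) {α : ℝ} (hα : 0 < α)
    (h : IsTraceClass (T.op ^ α)) {ι : Type*} (b : HilbertBasis ι ℂ H) {a : ι → ℝ}
    (ha0 : ∀ i, a i ∈ Set.Icc (0 : ℝ) 1) (ha : ∀ i, T.op (b i) = (a i : ℂ) • b i) :
    HasSum (fun i => a i ^ α) ‖toTraceClass (T.op ^ α)‖ := by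
  refine hasSum_of_tsum_ofReal (fun i => Real.rpow_nonneg (ha0 i).1 _) (norm_nonneg _) ?_
  rw [TraceClass.ofReal_norm_eq, toTraceClass_op h, traceNorm_eq_tsum_of_diag b CFC.rpow_nonneg
    fun i => rpow_apply_of_eigenvector hT.1 hα (ha i) (hilbertBasis_ne_zero b i)]

lemma tsum_rpow_one_add_le {T : TraceClass H} (hT : T ∈ densityOperators H) {α : ℝ}
    (hα : α ∈ Set.Ioo (0 : ℝ) 1) (h : IsTraceClass (T.op ^ α)) (hlog : IsTraceClass (mulLog T.op))
    {ι : Type*} (b : HilbertBasis ι ℂ H) {a : ι → ℝ} (ha0 : ∀ i, a i ∈ Set.Icc (0 : ℝ) 1)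
    (hsum : HasSum a 1) (ha : ∀ i, T.op (b i) = (a i : ℂ) • b i) {s : ℝ} (hs : 0 < s) :
    ∑' i, ENNReal.ofReal (a i ^ (1 + s)) ≤ ENNReal.ofReal
      (1 + s * (toTraceClass (mulLog T.op)).trace.re
        + s ^ 2 * (2 / ((1 - α) / 2)) ^ 2 * ‖toTraceClass (T.op ^ α)‖) := by
  have h1 := (hsum.add ((hasSum_mul_log hT hlog b ha0 ha).mul_left s)).add
    ((hasSum_rpow hT hα.1 h b ha0 ha).mul_left (s ^ 2 * (2 / ((1 - α) / 2)) ^ 2))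
  have h2 := fun i => rpow_one_add_le (ha0 i) hα hs
  rw [← h1.tsum_eq, ENNReal.ofReal_tsum_of_nonneg
    (fun i => (Real.rpow_nonneg (ha0 i).1 _).trans (h2 i)) h1.summable]
  exact ENNReal.tsum_le_tsum fun i => ENNReal.ofReal_le_ofReal (h2 i)

lemma tsum_rpow_one_sub_le {T : TraceClass H} (hT : T ∈ densityOperators H) {α : ℝ}
    (hα : α ∈ Set.Ioo (0 : ℝ) 1) (h : IsTraceClass (T.op ^ α)) (hlog : IsTraceClass (mulLog T.op))
    {ι : Type*} (b : HilbertBasis ι ℂ H) {a : ι → ℝ} (ha0 : ∀ i, a i ∈ Set.Icc (0 : ℝ) 1)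
    (hsum : HasSum a 1) (ha : ∀ i, T.op (b i) = (a i : ℂ) • b i) {s : ℝ} (hs : 0 < s)
    (hs1 : s ≤ (1 - α) / 2) :
    ∑' i, ENNReal.ofReal (a i ^ (1 - s)) ≤ ENNReal.ofReal
      (1 - s * (toTraceClass (mulLog T.op)).trace.re
        + s ^ 2 * (2 / ((1 - α) / 2)) ^ 2 * ‖toTraceClass (T.op ^ α)‖) := by
  have h1 := (hsum.sub ((hasSum_mul_log hT hlog b ha0 ha).mul_left s)).add
    ((hasSum_rpow hT hα.1 h b ha0 ha).mul_left (s ^ 2 * (2 / ((1 - α) / 2)) ^ 2))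
  have h2 := fun i => rpow_one_sub_le (ha0 i) hα hs hs1
  rw [← h1.tsum_eq, ENNReal.ofReal_tsum_of_nonneg
    (fun i => (Real.rpow_nonneg (ha0 i).1 _).trans (h2 i)) h1.summable]
  exact ENNReal.tsum_le_tsum fun i => ENNReal.ofReal_le_ofReal (h2 i)

lemma neg_trace_mulLog_le {T : TraceClass H} (hT : T ∈ densityOperators H) {α : ℝ}
    (hα : α ∈ Set.Ioo (0 : ℝ) 1) (h : IsTraceClass (T.op ^ α))
    (hlog : IsTraceClass (mulLog T.op)) :
    -(toTraceClass (mulLog T.op)).trace.re ≤ 1 / (1 - α) * ‖toTraceClass (T.op ^ α)‖ := by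
  obtain ⟨ι, b, a, ha0, -, ha⟩ := exists_eigenbasis_of_mem_densityOperators hT
  exact hasSum_le (fun i => neg_mul_log_le (ha0 i) hα) (hasSum_mul_log hT hlog b ha0 ha).neg
    ((hasSum_rpow hT hα.1 h b ha0 ha).mul_left _)

/-- Tangent line bound for the quadratic form of `-T log T`. -/
lemma neg_inner_mulLog_le {T : TraceClass H} (hT : T ∈ densityOperators H) {r : ℝ} (hr : 0 < r)
    {v : H} (hv : ‖v‖ = 1) :
    (⟪v, (-mulLog T.op) v⟫_ℂ).re ≤ r - (1 + Real.log r) * (⟪v, T.op v⟫_ℂ).re := by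
  obtain ⟨ι, b, a, ha0, -, ha⟩ := exists_eigenbasis_of_mem_densityOperators hT
  -- The scalar tangent inequality, applied to each eigenvalue, becomes an operator inequality
  -- because both sides are diagonal in the same basis.
  have h1 : 0 ≤ mulLog T.op - (((1 + Real.log r : ℝ) : ℂ) • T.op - ((r : ℝ) : ℂ) • 1) := by
    refine nonneg_of_diag b (a := fun i => a i * Real.log (a i) - ((1 + Real.log r) * a i - r))
      (fun i => sub_nonneg.2 (tangent_le_mul_log (ha0 i).1 hr)) fun i => ?_
    rw [sub_apply, sub_apply, smul_apply, smul_apply,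
      mulLog_apply_of_eigenvector hT.1 (ha i) (hilbertBasis_ne_zero b i), ha, one_apply_eq_self,
      smul_smul, ← sub_smul, ← sub_smul]
    push_cast
    rfl
  have h2 := ((ContinuousLinearMap.nonneg_iff_isPositive _).1 h1).re_inner_nonneg_right v
  rw [sub_apply, sub_apply, smul_apply, smul_apply, one_apply_eq_self, inner_sub_right,
    inner_sub_right, inner_smul_right, inner_smul_right, inner_self_eq_norm_sq_to_K, hv] at h2
  rw [neg_apply, inner_neg_right]
  simp at h2 ⊢
  linarith

/-- All density operators have spectrum in the fixed compact set `[0, 1]`, where the functional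
calculus is continuous in the operator. -/
lemma continuous_mulLog :
    Continuous fun T : densityOperators H => mulLog T.1.op := by
  have h : ContinuousOn (fun T : TraceClass H => mulLog T.op) (densityOperators H) := by
    have h1 := continuousOn_cfc (A := H →L[ℂ] H) (isCompact_Icc (a := (0 : ℝ)) (b := 1))
      (fun t : ℝ => t * Real.log t) Real.continuous_mul_log.continuousOn
    refine h1.comp TraceClass.opL.continuous.continuousOn fun T hT => ?_
    refine ⟨hT.1.isSelfAdjoint, fun t ht => ⟨spectrum_nonneg_of_nonneg hT.1 ht, ?_⟩⟩
    have h2 := spectrum.norm_le_norm_mul_of_mem ht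
    have h3 : ‖(1 : H →L[ℂ] H)‖ ≤ 1 := ContinuousLinearMap.norm_id_le
    have h4 := T.opNorm_le
    rw [norm_of_mem_densityOperators hT] at h4
    refine (Real.le_norm_self t).trans (h2.trans ?_)
    exact mul_le_one₀ h4 (norm_nonneg _) h3
  exact continuousOn_iff_continuous_domRestrict.1 h

end Entropy

/-! ### Integrability of the entropy of the outputs and nonnegativity of the information. -/

section ChannelEntropy

variable {X : Type v} [MeasurableSpace X] {H : Type u} [NormedAddCommGroup H]
  [InnerProductSpace ℂ H] [CompleteSpace H] [TopologicalSpace.SeparableSpace H]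
  {D : X → TraceClass H} (P : Measure X) [IsProbabilityMeasure P]

lemma integrable_channel (hD : Measurable D) (hDs : ∀ x, D x ∈ densityOperators H) :
    Integrable D P :=
  Integrable.of_bound hD.stronglyMeasurable.aestronglyMeasurable 1
    (Eventually.of_forall fun x => (norm_of_mem_densityOperators (hDs x)).le)

open scoped ComplexOrder in
lemma outputState_mem (hD : Measurable D) (hDs : ∀ x, D x ∈ densityOperators H) :
    outputState P D ∈ densityOperators H := by
  have hi := integrable_channel P hD hDs
  constructor
  · rw [ContinuousLinearMap.nonneg_iff_isPositive, ContinuousLinearMap.isPositive_iff_complex]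
    intro v
    have h1 : ∫ x, ⟪v, (D x).op v⟫_ℂ ∂P = ⟪v, (outputState P D).op v⟫_ℂ :=
      ContinuousLinearMap.integral_comp_comm (TraceClass.matrixElement v v) hi
    have h2 : ∀ x, (0 : ℂ) ≤ ⟪v, (D x).op v⟫_ℂ := fun x =>
      ((ContinuousLinearMap.nonneg_iff_isPositive _).1 (hDs x).1).inner_nonneg_right v
    have h3 : (0 : ℂ) ≤ ⟪v, (outputState P D).op v⟫_ℂ := by
      rw [← h1]
      have h4 : ∀ x, ⟪v, (D x).op v⟫_ℂ = (((⟪v, (D x).op v⟫_ℂ).re : ℝ) : ℂ) := fun x =>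
        Complex.ext rfl (by simpa using (Complex.le_def.1 (h2 x)).2.symm)
      rw [integral_congr_ae (Eventually.of_forall h4), integral_complex_ofReal,
        Complex.zero_le_real]
      exact integral_nonneg fun x => (Complex.le_def.1 (h2 x)).1
    rw [← inner_conj_symm, Complex.le_def, Complex.conj_re, Complex.conj_im] at h3
    obtain ⟨h4, h5⟩ := h3
    exact ⟨Complex.ext rfl (neg_eq_zero.1 h5.symm).symm, h4⟩
  · have h1 : ∫ x, (D x).trace ∂P = (outputState P D).trace :=
      ContinuousLinearMap.integral_comp_comm TraceClass.traceL hi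
    rw [← h1]
    simp [fun x => (hDs x).2]

lemma measurable_inner_neg_mulLog (hD : Measurable D) (hDs : ∀ x, D x ∈ densityOperators H)
    (v : H) : Measurable fun x => (⟪v, (-mulLog (D x).op) v⟫_ℂ).re := by
  have h1 : Continuous fun T : densityOperators H => (⟪v, (-mulLog T.1.op) v⟫_ℂ).re := by
    refine Complex.continuous_re.comp (continuous_const.inner ?_)
    exact (ContinuousLinearMap.apply ℂ H v).continuous.comp continuous_mulLog.neg
  exact h1.measurable.comp (hD.subtype_mk (h := hDs))

/-- Dominated by `‖D(x)^α‖ / (1-α)`. Measurability comes from writing the entropy as a countable sum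
of measurable diagonal matrix elements. -/
lemma integrable_trace_mulLog (hD : Measurable D) (hDs : ∀ x, D x ∈ densityOperators H)
    {α : ℝ} (hα : α ∈ Set.Ioo (0 : ℝ) 1) (hae : ∀ᵐ x ∂P, IsTraceClass ((D x).op ^ α))
    (hint : Integrable (fun x => toTraceClass ((D x).op ^ α)) P)
    (hlog : ∀ᵐ x ∂P, IsTraceClass (mulLog (D x).op)) :
    Integrable (fun x => (toTraceClass (mulLog (D x).op)).trace.re) P := by
  have hcount : Countable (BasisIndex H) := countable_of_hilbertBasis (stdBasis H)
  have hmeas : Measurable fun x => -(posTrace (-mulLog (D x).op)).toReal :=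
    (Measurable.tsum fun i =>
      (measurable_inner_neg_mulLog hD hDs (stdBasis H i)).ennreal_ofReal).ennreal_toReal.neg
  refine Integrable.mono' (hint.norm.const_mul (1 / (1 - α))) ⟨_, hmeas.stronglyMeasurable, ?_⟩ ?_
  · filter_upwards [hlog] with x hx
    rw [← ofReal_neg_trace_mulLog (hDs x) hx,
      ENNReal.toReal_ofReal (neg_trace_mulLog_nonneg (hDs x) hx), neg_neg]
  · filter_upwards [hlog, hae] with x hx hx'
    rw [← norm_neg, Real.norm_of_nonneg (neg_trace_mulLog_nonneg (hDs x) hx)]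
    exact neg_trace_mulLog_le (hDs x) hα hx' hx

/-- The Holevo information is nonnegative. -/
lemma trace_mulLog_outputState_le (hD : Measurable D) (hDs : ∀ x, D x ∈ densityOperators H)
    (hlog : ∀ᵐ x ∂P, IsTraceClass (mulLog (D x).op))
    (hlogP : IsTraceClass (mulLog (outputState P D).op))
    (hi : Integrable (fun x => (toTraceClass (mulLog (D x).op)).trace.re) P) :
    (toTraceClass (mulLog (outputState P D).op)).trace.re
      ≤ ∫ x, (toTraceClass (mulLog (D x).op)).trace.re ∂P := by
  have hDi := integrable_channel P hD hDs
  have hσ := outputState_mem P hD hDs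
  obtain ⟨ι, b, a, ha0, -, ha⟩ := exists_eigenbasis_of_mem_densityOperators hσ
  have hcount : Countable ι := countable_of_hilbertBasis b
  have hmi : ∀ i, Integrable (fun x => (⟪b i, (D x).op (b i)⟫_ℂ).re) P := fun i =>
    ((TraceClass.matrixElement (b i) (b i)).integrable_comp hDi).re
  have hmean : ∀ i, ∫ x, (⟪b i, (D x).op (b i)⟫_ℂ).re ∂P = a i := by
    intro i
    have h1 : ∫ x, (⟪b i, (D x).op (b i)⟫_ℂ).re ∂P = (∫ x, ⟪b i, (D x).op (b i)⟫_ℂ ∂P).re :=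
      integral_re ((TraceClass.matrixElement (b i) (b i)).integrable_comp hDi)
    have h2 : ∫ x, ⟪b i, (D x).op (b i)⟫_ℂ ∂P = ⟪b i, (outputState P D).op (b i)⟫_ℂ :=
      ContinuousLinearMap.integral_comp_comm (TraceClass.matrixElement (b i) (b i)) hDi
    rw [h1, h2, ha, inner_smul_right, inner_self_eq_norm_sq_to_K, b.orthonormal.1 i]
    simp
  have hkey : ∀ i (r : ℝ), 0 < r →
      ∫⁻ x, ENNReal.ofReal (⟪b i, (-mulLog (D x).op) (b i)⟫_ℂ).re ∂P
        ≤ ENNReal.ofReal (r - (1 + Real.log r) * a i) := by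
    intro i r hr
    have hle := fun x => neg_inner_mulLog_le (hDs x) hr (b.orthonormal.1 i)
    have hint : Integrable (fun x => r - (1 + Real.log r) * (⟪b i, (D x).op (b i)⟫_ℂ).re) P :=
      (integrable_const _).sub ((hmi i).const_mul _)
    have heq : r - (1 + Real.log r) * a i
        = ∫ x, (r - (1 + Real.log r) * (⟪b i, (D x).op (b i)⟫_ℂ).re) ∂P := by
      rw [integral_sub (integrable_const _) ((hmi i).const_mul _), integral_const_mul, hmean]
      simp
    rw [heq, ofReal_integral_eq_lintegral_ofReal hint]
    · exact lintegral_mono fun x => ENNReal.ofReal_le_ofReal (hle x)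
    · refine Eventually.of_forall fun x => le_trans ?_ (hle x)
      exact ((ContinuousLinearMap.nonneg_iff_isPositive _).1
        (neg_mulLog_nonneg (hDs x))).re_inner_nonneg_right _
  -- Concavity of the entropy in the eigenbasis of the mean state: take the tangent point `r = a i`,
  -- or let `r` tend to `0` when `a i = 0`.
  have hkey' : ∀ i, ∫⁻ x, ENNReal.ofReal (⟪b i, (-mulLog (D x).op) (b i)⟫_ℂ).re ∂P
      ≤ ENNReal.ofReal (-(a i * Real.log (a i))) := by
    intro i
    rcases (ha0 i).1.eq_or_lt with h | h
    · rw [← h]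
      simp only [zero_mul, neg_zero, ENNReal.ofReal_zero]
      refine le_of_forall_pos_le_add fun ε hε => ?_
      rw [zero_add]
      by_cases hε' : ε = ∞
      · rw [hε']; exact le_top
      have h1 := hkey i ε.toReal (ENNReal.toReal_pos hε.ne' hε')
      rwa [← h, mul_zero, sub_zero, ENNReal.ofReal_toReal hε'] at h1
    · refine (hkey i (a i) h).trans (ENNReal.ofReal_le_ofReal (le_of_eq ?_))
      ring
  have h1 : ENNReal.ofReal (∫ x, -(toTraceClass (mulLog (D x).op)).trace.re ∂P)
      ≤ ENNReal.ofReal (-(toTraceClass (mulLog (outputState P D).op)).trace.re) := by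
    have hin : Integrable (fun x => -(toTraceClass (mulLog (D x).op)).trace.re) P := hi.neg
    rw [ofReal_integral_eq_lintegral_ofReal hin]
    · calc _ = ∫⁻ x, ∑' i, ENNReal.ofReal (⟪b i, (-mulLog (D x).op) (b i)⟫_ℂ).re ∂P := by
            refine lintegral_congr_ae ?_
            filter_upwards [hlog] with x hx
            rw [← posTrace_eq_tsum b (neg_mulLog_nonneg (hDs x)),
              ← ofReal_neg_trace_mulLog (hDs x) hx]
        _ = ∑' i, ∫⁻ x, ENNReal.ofReal (⟪b i, (-mulLog (D x).op) (b i)⟫_ℂ).re ∂P :=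
            lintegral_tsum fun i =>
              (measurable_inner_neg_mulLog hD hDs (b i)).ennreal_ofReal.aemeasurable
        _ ≤ ∑' i, ENNReal.ofReal (-(a i * Real.log (a i))) := ENNReal.tsum_le_tsum hkey'
        _ = _ := by
            rw [ofReal_neg_trace_mulLog hσ hlogP, ← traceNorm_of_nonneg (neg_mulLog_nonneg hσ),
              traceNorm_eq_tsum_of_diag b (neg_mulLog_nonneg hσ)
              fun i => neg_mulLog_apply hσ.1 (ha i) (hilbertBasis_ne_zero b i)]
    · filter_upwards [hlog] with x hx using neg_trace_mulLog_nonneg (hDs x) hx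
  rw [ENNReal.ofReal_le_ofReal_iff (neg_trace_mulLog_nonneg hσ hlogP), integral_neg] at h1
  linarith

end ChannelEntropy

instance {H : Type u} [NormedAddCommGroup H] [InnerProductSpace ℂ H] [CompleteSpace H]
    [TopologicalSpace.SeparableSpace H] (n : ℕ) :
    TopologicalSpace.SeparableSpace (TensorPower H n) := by
  have hc : Countable (BasisIndex H) := countable_of_hilbertBasis (stdBasis H)
  set b := prodBasis fun _ : Fin n => stdBasis H
  have h1 : TopologicalSpace.IsSeparable
      ((Submodule.span ℂ (Set.range b)).topologicalClosure : Set (TensorPower H n)) := by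
    rw [Submodule.topologicalClosure_coe]
    exact ((Set.countable_range b).isSeparable.span (R := ℂ)).closure
  rw [b.dense_span, Submodule.top_coe] at h1
  exact TopologicalSpace.isSeparable_univ_iff.1 h1

/-! ### Chernoff bounds for the spectrum of product states. -/

section ProductSpectrum

variable {H : Type u} [NormedAddCommGroup H] [InnerProductSpace ℂ H] [CompleteSpace H]

/-- The second order bound for the sum of the powers `a ^ (1 + s)` of the eigenvalues of a density
operator. -/
def powerSumBound (T : TraceClass H) (α s : ℝ) : ℝ :=
  1 + s * (toTraceClass (mulLog T.op)).trace.re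
    + s ^ 2 * (2 / ((1 - α) / 2)) ^ 2 * ‖toTraceClass (T.op ^ α)‖

lemma powerSumBound_nonneg {T : TraceClass H} (hT : T ∈ densityOperators H) {α : ℝ}
    (hα : α ∈ Set.Ioo (0 : ℝ) 1) (h : IsTraceClass (T.op ^ α)) (hlog : IsTraceClass (mulLog T.op))
    {s : ℝ} (hs : 0 < s) : 0 ≤ powerSumBound T α s := by
  obtain ⟨ι, b, a, ha0, hsum, ha⟩ := exists_eigenbasis_of_mem_densityOperators hT
  have h1 := (hsum.add ((hasSum_mul_log hT hlog b ha0 ha).mul_left s)).add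
    ((hasSum_rpow hT hα.1 h b ha0 ha).mul_left (s ^ 2 * (2 / ((1 - α) / 2)) ^ 2))
  exact h1.nonneg fun i => (Real.rpow_nonneg (ha0 i).1 _).trans (rpow_one_add_le (ha0 i) hα hs)

/-- A power is multiplicative, so once `f` is dominated by a power the sum over the product spectrum
splits into one-letter sums. -/
lemma tsum_ofReal_mul_prod_rpow_le {n : ℕ} {ι : Fin n → Type*} {a : ∀ i, ι i → ℝ}
    (ha : ∀ i j, 0 ≤ a i j) {f : ℝ → ℝ} {k p : ℝ} (hk : 0 ≤ k)
    (hf : ∀ t, 0 ≤ t → f t ≤ k * t ^ p) {w : Fin n → ℝ}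
    (hw : ∀ i, ∑' j, ENNReal.ofReal (a i j ^ p) ≤ ENNReal.ofReal (w i)) :
    ∑' k : ∀ i, ι i, ENNReal.ofReal (f (∏ i, a i (k i)))
      ≤ ENNReal.ofReal k * ∏ i, ENNReal.ofReal (w i) := by
  calc _ ≤ ∑' j : ∀ i, ι i, ENNReal.ofReal k * ∏ i, ENNReal.ofReal (a i (j i) ^ p) := by
        refine ENNReal.tsum_le_tsum fun j => ?_
        rw [← ENNReal.ofReal_prod_of_nonneg fun i _ => Real.rpow_nonneg (ha i _) _,
          ← ENNReal.ofReal_mul hk, Real.finsetProd_rpow _ _ fun i _ => ha i _]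
        exact ENNReal.ofReal_le_ofReal (hf _ (Finset.prod_nonneg fun i _ => ha i _))
    _ = ENNReal.ofReal k * ∏ i, ∑' j, ENNReal.ofReal (a i j ^ p) := by
        rw [ENNReal.tsum_mul_left, tsum_pi_prod fun i j => ENNReal.ofReal (a i j ^ p)]
    _ ≤ _ := by
        gcongr with i
        exact hw i

lemma exists_eigenbasis_tensorTC_damping_le {n : ℕ} {T : TraceClass H}
    (hT : T ∈ densityOperators H) {α : ℝ} (hα : α ∈ Set.Ioo (0 : ℝ) 1)
    (h : IsTraceClass (T.op ^ α)) (hlog : IsTraceClass (mulLog T.op)) {s c : ℝ} (hs : 0 < s)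
    (hs1 : s ≤ (1 - α) / 2) (hc : 0 < c) :
    ∃ (ι : Type u) (b : HilbertBasis ι ℂ (TensorPower H n)) (a : ι → ℝ), (∀ i, 0 ≤ a i) ∧
      (∀ i, (tensorTC H n fun _ => T).op (b i) = (a i : ℂ) • b i) ∧
      ∑' i, ENNReal.ofReal ((c / (a i + c)) ^ 2 * a i)
        ≤ ENNReal.ofReal (c ^ s) * ENNReal.ofReal (1 - s * (toTraceClass (mulLog T.op)).trace.re
          + s ^ 2 * (2 / ((1 - α) / 2)) ^ 2 * ‖toTraceClass (T.op ^ α)‖) ^ n := by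
  obtain ⟨ι, a, b, ha0, hsum, hc', hb⟩ := exists_eigenbasis_tensorTC (n := n) fun _ => hT
  refine ⟨_, b, _, fun k => Finset.prod_nonneg fun i _ => (ha0 i _).1, hb, ?_⟩
  have hs2 : s ∈ Set.Ioo (0 : ℝ) 1 := ⟨hs, by linarith [hα.1]⟩
  refine (tsum_ofReal_mul_prod_rpow_le (fun i j => (ha0 i j).1) (Real.rpow_nonneg hc.le s)
    (f := fun t => (c / (t + c)) ^ 2 * t)
    (fun t ht => sq_div_add_mul_le hc ht hs2) fun i => ?_).trans
    (by rw [Finset.prod_const, Finset.card_fin])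
  obtain ⟨e, he⟩ := hc' i
  exact tsum_rpow_one_sub_le hT hα h hlog e (ha0 i) (hsum i) he hs hs1

/-- The difference is positive with eigenvalues `t²/(t+c)`, so its trace norm is their sum, to which
the upper-tail bound applies. -/
lemma enorm_tensorTC_sub_damp_le {n : ℕ} {A : Fin n → TraceClass H}
    (hA : ∀ i, A i ∈ densityOperators H) {α : ℝ} (hα : α ∈ Set.Ioo (0 : ℝ) 1)
    (h : ∀ i, IsTraceClass ((A i).op ^ α)) (hlog : ∀ i, IsTraceClass (mulLog (A i).op)) {s c : ℝ}
    (hs : s ∈ Set.Ioo (0 : ℝ) 1) (hc : 0 < c) :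
    ‖tensorTC H n A - (c : ℂ) • damp c (tensorTC H n A)‖ₑ
      ≤ ENNReal.ofReal (c ^ (-s)) * ∏ i, ENNReal.ofReal (powerSumBound (A i) α s) := by
  obtain ⟨ι, a, b, ha0, hsum, hc', hb⟩ := exists_eigenbasis_tensorTC hA
  have hpos : ∀ k : ∀ i, ι i, 0 ≤ ∏ i, a i (k i) :=
    fun k => Finset.prod_nonneg fun i _ => (ha0 i _).1
  have hdiag : ∀ k : ∀ i, ι i, (tensorTC H n A - (c : ℂ) • damp c (tensorTC H n A)).op (b k)
      = ((∏ i, a i (k i) - c * ((∏ i, a i (k i)) / (∏ i, a i (k i) + c)) : ℝ) : ℂ) • b k := by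
    intro k
    rw [TraceClass.op_sub, TraceClass.op_smul, sub_apply, smul_apply, hb,
      damp_op_apply (tensorTC_nonneg hA) hc (hpos k) (hb k), smul_smul, ← sub_smul]
    push_cast
    rfl
  have hnonneg : ∀ k : ∀ i, ι i,
      0 ≤ ∏ i, a i (k i) - c * ((∏ i, a i (k i)) / (∏ i, a i (k i) + c)) := by
    intro k
    have := hpos k
    have h1 : ∏ i, a i (k i) - c * ((∏ i, a i (k i)) / (∏ i, a i (k i) + c))
        = (∏ i, a i (k i)) ^ 2 / (∏ i, a i (k i) + c) := by field_simp; ring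
    rw [h1]
    positivity
  rw [← ofReal_norm, TraceClass.ofReal_norm_eq,
    traceNorm_eq_tsum_of_diag b (nonneg_of_diag b hnonneg hdiag) hdiag]
  refine tsum_ofReal_mul_prod_rpow_le (fun i j => (ha0 i j).1) (Real.rpow_nonneg hc.le (-s))
    (f := fun t => t - c * (t / (t + c))) (fun t ht => sub_mul_div_add_le hc ht hs) fun i => ?_
  obtain ⟨e, he⟩ := hc' i
  exact tsum_rpow_one_add_le (hA i) hα (h i) (hlog i) e (ha0 i) (hsum i) he hs.1

end ProductSpectrum

/-! ### Memoryless extension of the channel and averages over random codewords. -/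

section ProductChannel

variable {X : Type v} [MeasurableSpace X] (P : Measure X) [IsProbabilityMeasure P]

lemma ae_pi_forall {n : ℕ} {p : X → Prop} (hp : ∀ᵐ x ∂P, p x) :
    ∀ᵐ x : Fin n → X ∂(Measure.pi fun _ => P), ∀ i, p (x i) :=
  eventually_all.2 fun _ => Measure.tendsto_eval_ae_ae.eventually hp

lemma lintegral_prod_ofReal {n : ℕ} {u : X → ℝ} (hu : Integrable u P) (hu0 : ∀ᵐ x ∂P, 0 ≤ u x) :
    ∫⁻ x : Fin n → X, ∏ i, ENNReal.ofReal (u (x i)) ∂(Measure.pi fun _ => P)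
      = ENNReal.ofReal (∫ x, u x ∂P) ^ n := by
  have h1 := Integrable.fintype_prod (ι := Fin n) fun _ => hu
  have h2 := integral_fintype_prod_eq_pow (ι := Fin n) (μ := P) u
  rw [Fintype.card_fin] at h2
  rw [← ENNReal.ofReal_pow (integral_nonneg_of_ae hu0), ← h2,
    ofReal_integral_eq_lintegral_ofReal h1]
  · refine lintegral_congr_ae ?_
    filter_upwards [ae_pi_forall P hu0] with x hx
    rw [ENNReal.ofReal_prod_of_nonneg fun i _ => hx i]
  · filter_upwards [ae_pi_forall P hu0] with x hx using Finset.prod_nonneg fun i _ => hx i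

variable {H : Type u} [NormedAddCommGroup H] [InnerProductSpace ℂ H] [CompleteSpace H]
  [TopologicalSpace.SeparableSpace H] {D : X → TraceClass H}

/-- The `n`-fold memoryless extension of a channel. -/
def productChannel (D : X → TraceClass H) (n : ℕ) (x : Fin n → X) : TraceClass (TensorPower H n) :=
  tensorTC H n fun i => D (x i)

lemma stronglyMeasurable_productChannel (hD : Measurable D) (n : ℕ) :
    StronglyMeasurable (productChannel D n) := by
  have h : Measurable fun (x : Fin n → X) i => D (x i) :=
    measurable_pi_lambda _ fun i => hD.comp (measurable_pi_apply i)
  exact (tensorTC H n).cont.comp_stronglyMeasurable h.stronglyMeasurable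

lemma integral_productChannel (hD : Measurable D) (hDs : ∀ x, D x ∈ densityOperators H) (n : ℕ) :
    ∫ x, productChannel D n x ∂(Measure.pi fun _ => P) = tensorTC H n fun _ => outputState P D :=
  integral_tensorTC P (integrable_channel P hD hDs)
    (Integrable.of_bound (stronglyMeasurable_productChannel hD n).aestronglyMeasurable 1
      (Eventually.of_forall fun x => (norm_tensorTC fun i => hDs (x i)).le))

/-- Independence of the letters turns the mean of the product bound into an `n`-th power. As
`powerSumBound` is affine in the entropy term and in the `α`-power norm, only their means enter. -/
lemma lintegral_productChannel_sub_damp_le (hD : Measurable D)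
    (hDs : ∀ x, D x ∈ densityOperators H) {α : ℝ} (hα : α ∈ Set.Ioo (0 : ℝ) 1)
    (hae : ∀ᵐ x ∂P, IsTraceClass ((D x).op ^ α))
    (hint : Integrable (fun x => toTraceClass ((D x).op ^ α)) P)
    (hlog : ∀ᵐ x ∂P, IsTraceClass (mulLog (D x).op)) (n : ℕ) {s c : ℝ}
    (hs : s ∈ Set.Ioo (0 : ℝ) 1) (hc : 0 < c) :
    ∫⁻ x, ‖productChannel D n x - (c : ℂ) • damp c (productChannel D n x)‖ₑ
        ∂(Measure.pi fun _ => P)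
      ≤ ENNReal.ofReal (c ^ (-s)) * ENNReal.ofReal
        (1 + s * ∫ x, (toTraceClass (mulLog (D x).op)).trace.re ∂P
          + s ^ 2 * (2 / ((1 - α) / 2)) ^ 2 * ∫ x, ‖toTraceClass ((D x).op ^ α)‖ ∂P) ^ n := by
  have hi1 := (integrable_trace_mulLog P hD hDs hα hae hint hlog).const_mul s
  have hi2 := hint.norm.const_mul (s ^ 2 * (2 / ((1 - α) / 2)) ^ 2)
  have hi0 : Integrable (fun x => 1 + s * (toTraceClass (mulLog (D x).op)).trace.re) P :=
    (integrable_const 1).add hi1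
  have hi : Integrable (fun x => powerSumBound (D x) α s) P := hi0.add hi2
  have hu0 : ∀ᵐ x ∂P, 0 ≤ powerSumBound (D x) α s := by
    filter_upwards [hae, hlog] with x hx hx'
    exact powerSumBound_nonneg (hDs x) hα hx hx' hs.1
  have hmean : ∫ x, powerSumBound (D x) α s ∂P
      = 1 + s * ∫ x, (toTraceClass (mulLog (D x).op)).trace.re ∂P
          + s ^ 2 * (2 / ((1 - α) / 2)) ^ 2 * ∫ x, ‖toTraceClass ((D x).op ^ α)‖ ∂P := by
    unfold powerSumBound
    rw [integral_add hi0 hi2, integral_add (integrable_const 1) hi1, integral_const_mul,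
      integral_const_mul]
    simp
  rw [← hmean, ← lintegral_prod_ofReal P hi hu0, ← lintegral_const_mul' _ _ ENNReal.ofReal_ne_top]
  refine lintegral_mono_ae ?_
  filter_upwards [ae_pi_forall P hae, ae_pi_forall P hlog] with x hx hx'
  exact enorm_tensorTC_sub_damp_le (fun i => hDs (x i)) hα hx hx' hs hc

end ProductChannel

/-! ### From the expected fluctuation to a tail bound. -/

section Covering

variable {Y : Type*} [MeasurableSpace Y] (μ : Measure Y) [IsProbabilityMeasure μ]
  {K : Type u} [NormedAddCommGroup K] [InnerProductSpace ℂ K] [CompleteSpace K]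
  [TopologicalSpace.SeparableSpace K] {ρ : Y → TraceClass K}

lemma norm_fluctuation_le (hnorm : ∀ y, ‖ρ y‖ = 1) {M : ℕ} (hM : 0 < M) (C : Fin M → Y) :
    ‖fluctuation μ ρ C‖ ≤ 2 := by
  have hM' : (M : ℝ) ≠ 0 := by exact_mod_cast hM.ne'
  have h1 : ‖∫ y, ρ y ∂μ‖ ≤ 1 := by
    have := norm_integral_le_of_norm_le_const (μ := μ) (f := ρ) (C := 1)
      (Eventually.of_forall fun y => (hnorm y).le)
    simpa using this
  have h2 : ‖(1 / M : ℂ) • ∑ m, ρ (C m)‖ ≤ 1 := by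
    rw [norm_smul]
    calc _ ≤ ‖(1 / M : ℂ)‖ * ∑ m : Fin M, ‖ρ (C m)‖ := by gcongr; exact norm_sum_le _ _
      _ = 1 := by simp [hnorm, hM']
  calc _ ≤ _ := norm_sub_le _ _
    _ ≤ 2 := by linarith

lemma abs_norm_fluctuation_update_sub_le (hnorm : ∀ y, ‖ρ y‖ = 1) {M : ℕ} (C : Fin M → Y)
    (i : Fin M) (y : Y) :
    |‖fluctuation μ ρ (Function.update C i y)‖ - ‖fluctuation μ ρ C‖| ≤ 2 / M := by
  refine (abs_norm_sub_norm_le _ _).trans ?_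
  have h1 : fluctuation μ ρ (Function.update C i y) - fluctuation μ ρ C
      = (1 / M : ℂ) • (ρ y - ρ (C i)) := by
    have h2 : ∑ m, ρ (Function.update C i y m) - ∑ m, ρ (C m) = ρ y - ρ (C i) := by
      rw [← Finset.sum_sub_distrib, Finset.sum_eq_single i]
      · rw [Function.update_self]
      · intro m _ hm
        rw [Function.update_of_ne hm, sub_self]
      · simp
    rw [fluctuation, fluctuation, sub_sub_sub_cancel_right, ← smul_sub, h2]
  rw [h1, norm_smul]
  have h3 := norm_sub_le (ρ y) (ρ (C i))
  rw [hnorm, hnorm] at h3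
  calc ‖(1 / M : ℂ)‖ * ‖ρ y - ρ (C i)‖ ≤ ‖(1 / M : ℂ)‖ * 2 := by gcongr; linarith
    _ = _ := by simp; ring

lemma measureReal_le_norm_fluctuation_le (hρ : StronglyMeasurable ρ) (hnorm : ∀ y, ‖ρ y‖ = 1)
    {M : ℕ} (hM : 0 < M) {r s t : ℝ} (hr : 0 ≤ r) (hs : 0 ≤ s) (ht : r + s ≤ t)
    (hmean : ∫⁻ C : Fin M → Y, ‖fluctuation μ ρ C‖ₑ ∂(Measure.pi fun _ => μ) ≤ ENNReal.ofReal r) :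
    (Measure.pi fun _ : Fin M => μ).real {C | t ≤ ‖fluctuation μ ρ C‖}
      ≤ Real.exp (-(M * s ^ 2 / 8)) := by
  have hm := (stronglyMeasurable_fluctuation (M := M) μ hρ).norm
  have h1 : ∫ C : Fin M → Y, ‖fluctuation μ ρ C‖ ∂(Measure.pi fun _ => μ) ≤ r := by
    rw [integral_norm_eq_lintegral_enorm
      (stronglyMeasurable_fluctuation (M := M) μ hρ).aestronglyMeasurable]
    exact ENNReal.toReal_le_of_le_ofReal hr hmean
  refine (measureReal_mono fun C hC => ?_).trans
    (measureReal_ge_le_of_bounded_differences μ hM hm.measurable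
      (fun C => (abs_norm _).trans_le (norm_fluctuation_le μ hnorm hM C))
      (abs_norm_fluctuation_update_sub_le μ hnorm) hs)
  exact (by linarith : _ ≤ t).trans hC

end Covering

/-! ### Choice of exponents. -/

section Rates

lemma exists_small_exponent {α η a b : ℝ} (hα : α < 1) (hη : 0 < η) :
    ∃ s > 0, s ≤ (1 - α) / 2 ∧ s * a ≤ η / 2 ∧ s * b ≤ η / 2 := by
  set k := max (max a b) 0 + 1 with hk
  have hk0 : 0 < k := by positivity
  have ha : a ≤ k := by linarith [(le_max_left a b).trans (le_max_left (max a b) 0)]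
  have hb : b ≤ k := by linarith [(le_max_right a b).trans (le_max_left (max a b) 0)]
  have hs0 : 0 < min ((1 - α) / 2) (η / 2 / k) := lt_min (by linarith) (by positivity)
  have hsk : min ((1 - α) / 2) (η / 2 / k) * k ≤ η / 2 :=
    (mul_le_mul_of_nonneg_right (min_le_right _ _) hk0.le).trans (div_mul_cancel₀ _ hk0.ne').le
  exact ⟨_, hs0, min_le_left _ _, (mul_le_mul_of_nonneg_left ha hs0.le).trans hsk,
    (mul_le_mul_of_nonneg_left hb hs0.le).trans hsk⟩

/-- By `1 + x ≤ exp x`, the `n`-th power grows at most like `exp(n(s l + s η/2))`, while the cutoff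
contributes `exp(-n s (l + η))`; a margin `s η/2` per letter remains. -/
lemma ofReal_exp_rpow_mul_pow_le (n : ℕ) {l s η k : ℝ} (hs : 0 < s) (hk : s * k ≤ η / 2) :
    ENNReal.ofReal (Real.exp (-(n * (l + η))) ^ s) * ENNReal.ofReal (1 + s * l + s ^ 2 * k) ^ n
      ≤ ENNReal.ofReal (Real.exp (-(n * (s * η / 2)))) := by
  have h1 : 1 + s * l + s ^ 2 * k ≤ Real.exp (s * l + s * (η / 2)) := by
    have := Real.add_one_le_exp (s * l + s * (η / 2))
    nlinarith
  calc _ ≤ ENNReal.ofReal (Real.exp (-(n * (l + η))) ^ s)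
        * ENNReal.ofReal (Real.exp (s * l + s * (η / 2))) ^ n := by gcongr
    _ = _ := by
      rw [← ENNReal.ofReal_pow (Real.exp_nonneg _), ← ENNReal.ofReal_mul (by positivity),
        ← Real.exp_mul, ← Real.exp_nat_mul, ← Real.exp_add]
      congr 2
      ring

lemma eventually_exponential_bounds {θ R : ℝ} (hθ : 0 < θ) (hR : 0 < R) :
    ∃ γ₁ > (0 : ℝ), ∃ γ₂ > (0 : ℝ), ∀ᶠ n : ℕ in atTop, ∀ M : ℝ, Real.exp (n * R) ≤ M →
      5 * Real.exp (-(n * θ)) ≤ Real.exp (-γ₁ * n) / 2 ∧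
      Real.exp (-(M * (Real.exp (-γ₁ * n) / 2) ^ 2 / 8)) ≤ Real.exp (-Real.exp (γ₂ * n)) := by
  have hlim : ∀ r > (0 : ℝ), Tendsto (fun n : ℕ => Real.exp (n * r)) atTop atTop := fun r hr =>
    Real.tendsto_exp_atTop.comp (tendsto_natCast_atTop_atTop.atTop_mul_const hr)
  -- `γ ≤ θ/2` keeps the mean below half the threshold once `exp(nθ/2) ≥ 10`. `γ ≤ R/4` leaves `M
  -- exp(-2γn) ≥ exp(nR/2)`, half of whose exponent pays for the factor `32 = 4 · 8`.
  set γ := min (θ / 2) (R / 4) with hγ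
  have hγ0 : 0 < γ := lt_min (by linarith) (by linarith)
  refine ⟨γ, hγ0, R / 4, by linarith, ?_⟩
  filter_upwards [(hlim _ (half_pos hθ)).eventually_ge_atTop 10,
    (hlim (R / 4) (by linarith)).eventually_ge_atTop 32] with n h1 h2 M hM
  have hn : (0 : ℝ) ≤ n := n.cast_nonneg
  have hγθ : n * γ ≤ n * (θ / 2) := mul_le_mul_of_nonneg_left (min_le_left _ _) hn
  have hγR : n * γ ≤ n * (R / 4) := mul_le_mul_of_nonneg_left (min_le_right _ _) hn
  constructor
  · have h3 : Real.exp (n * (θ / 2)) * Real.exp (-(n * θ)) ≤ Real.exp (-γ * n) := by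
      rw [← Real.exp_add]
      exact Real.exp_le_exp.2 (by linarith)
    nlinarith [Real.exp_pos (-(n * θ))]
  · refine Real.exp_le_exp.2 (neg_le_neg ?_)
    have h3 : Real.exp (n * (R / 4)) * Real.exp (R / 4 * n)
        ≤ Real.exp (n * R) * Real.exp (-γ * n) ^ 2 := by
      rw [← Real.exp_nat_mul, ← Real.exp_add, ← Real.exp_add]
      exact Real.exp_le_exp.2 (by push_cast; linarith)
    have h4 : Real.exp (n * R) * Real.exp (-γ * n) ^ 2 ≤ M * Real.exp (-γ * n) ^ 2 := by gcongr
    nlinarith [Real.exp_pos (R / 4 * n)]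

end Rates

/-! ### Exponential decay of the expected distance, and the link to the codebook output. -/

section SoftCovering

variable {X : Type v} [MeasurableSpace X] (P : Measure X) [IsProbabilityMeasure P]
  {H : Type u} [NormedAddCommGroup H] [InnerProductSpace ℂ H] [CompleteSpace H]
  [TopologicalSpace.SeparableSpace H] {D : X → TraceClass H}

/-- Soft covering in expectation, with an exponential rate. -/
lemma exists_lintegral_enorm_fluctuation_productChannel_le (hD : Measurable D)
    (hDs : ∀ x, D x ∈ densityOperators H) {α : ℝ} (hα : α ∈ Set.Ioo (0 : ℝ) 1)
    (hout : IsTraceClass ((outputState P D).op ^ α))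
    (hae : ∀ᵐ x ∂P, IsTraceClass ((D x).op ^ α))
    (hint : Integrable (fun x => toTraceClass ((D x).op ^ α)) P)
    (hlog : ∀ᵐ x ∂P, IsTraceClass (mulLog (D x).op))
    (hlogP : IsTraceClass (mulLog (outputState P D).op)) {R : ℝ}
    (hR : ∫ x, (toTraceClass (mulLog (D x).op)).trace.re ∂P
      - (toTraceClass (mulLog (outputState P D).op)).trace.re < R) :
    ∃ θ > (0 : ℝ), ∀ n M : ℕ, Real.exp (n * R) ≤ M →
      ∫⁻ C : Fin M → Fin n → X, ‖fluctuation (Measure.pi fun _ => P) (productChannel D n) C‖ₑ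
          ∂(Measure.pi fun _ => Measure.pi fun _ => P)
        ≤ ENNReal.ofReal (5 * Real.exp (-(n * θ))) := by
  set E := ∫ x, (toTraceClass (mulLog (D x).op)).trace.re ∂P with hE
  set L := (toTraceClass (mulLog (outputState P D).op)).trace.re with hL
  -- Each cutoff spends one `η` of the gap between rate and information; the remaining `2η` makes
  -- `c'/(cM)` decay.
  set η := (R - (E - L)) / 4 with hη
  have hη0 : 0 < η := by linarith
  obtain ⟨s, hs0, hs1, hsa, hsb⟩ := exists_small_exponent
    (a := (2 / ((1 - α) / 2)) ^ 2 * ‖toTraceClass ((outputState P D).op ^ α)‖)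
    (b := (2 / ((1 - α) / 2)) ^ 2 * ∫ x, ‖toTraceClass ((D x).op ^ α)‖ ∂P) hα.2 hη0
  have hs : s ∈ Set.Ioo (0 : ℝ) 1 := ⟨hs0, by linarith [hα.1]⟩
  -- The slowest term is `√δ`, which halves the tail exponent `s η / 2`. The factor `5` is `2 + 2 +
  -- 1` from the three pieces.
  refine ⟨s * η / 4, by positivity, fun n M hM => ?_⟩
  have hM0 : 0 < M := by
    have := (Real.exp_pos _).trans_le hM
    exact_mod_cast this
  have hM' : (0 : ℝ) < M := by exact_mod_cast hM0
  have hσ := outputState_mem P hD hDs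
  have hmean := integral_productChannel P hD hDs n
  set c := Real.exp (-(n * (-L + η))) with hc
  set c' := Real.exp (n * (E + η)) with hc'
  obtain ⟨ι, b, a, ha0, ha, hle⟩ := exists_eigenbasis_tensorTC_damping_le (n := n) hσ hα hout hlogP
    hs0 hs1 (c := c) (Real.exp_pos _)
  have hδ : ∑' i, ENNReal.ofReal ((c / (a i + c)) ^ 2 * a i)
      ≤ ENNReal.ofReal (Real.exp (-(n * (s * η / 2)))) := by
    refine (hle.trans_eq ?_).trans (ofReal_exp_rpow_mul_pow_le n (l := -L) hs0 hsa)
    rw [← hc, ← hL]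
    ring_nf
  have hδ' : ∫⁻ x, ‖productChannel D n x - (c' : ℂ) • damp c' (productChannel D n x)‖ₑ
        ∂(Measure.pi fun _ => P) ≤ ENNReal.ofReal (Real.exp (-(n * (s * η / 2)))) := by
    refine ((lintegral_productChannel_sub_damp_le P hD hDs hα hae hint hlog n hs
      (Real.exp_pos _)).trans_eq ?_).trans (ofReal_exp_rpow_mul_pow_le n (l := E) hs0 hsb)
    rw [← hE, Real.rpow_neg (Real.exp_nonneg _), ← Real.inv_rpow (Real.exp_nonneg _),
      ← Real.exp_neg, mul_assoc (s ^ 2)]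
  refine (lintegral_enorm_fluctuation_le_of_damp (Measure.pi fun _ => P)
    (stronglyMeasurable_productChannel hD n) (fun x => tensorTC_nonneg fun i => hDs (x i))
    (fun x => norm_tensorTC fun i => hDs (x i)) (by rw [hmean]; exact tensorTC_nonneg fun _ => hσ)
    (by rw [hmean]; exact (norm_tensorTC fun _ => hσ).le) b ha0 (by rw [hmean]; exact ha)
    (Real.exp_pos _) (Real.exp_pos _) (Real.exp_pos _) hδ hδ' hM0).trans ?_
  have h1 : Real.sqrt (Real.exp (-(n * (s * η / 2)))) = Real.exp (-(n * (s * η / 4))) := by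
    rw [← Real.exp_half]
    congr 1
    ring
  have h2 : Real.exp (-(n * (s * η / 2))) ≤ Real.exp (-(n * (s * η / 4))) := by
    gcongr
    norm_num
  have h3 : Real.sqrt (c' / (c * M)) ≤ Real.exp (-(n * (s * η / 4))) := by
    rw [← h1]
    refine Real.sqrt_le_sqrt ?_
    rw [div_le_iff₀ (by positivity)]
    have hn : (0 : ℝ) ≤ n := n.cast_nonneg
    have hnsη : n * (s * η / 2) ≤ n * (2 * η) := by
      gcongr
      nlinarith [hs.2]
    calc c' ≤ Real.exp (-(n * (s * η / 2))) * (c * Real.exp (n * R)) := by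
          rw [hc', hc, ← Real.exp_add, ← Real.exp_add]
          refine Real.exp_le_exp.2 ?_
          have : R = E - L + 4 * η := by rw [hη]; ring
          rw [this]
          linarith
      _ ≤ _ := by gcongr
  rw [h1, ← ENNReal.ofReal_ofNat 2, ← ENNReal.ofReal_mul zero_le_two,
    ← ENNReal.ofReal_mul zero_le_two, ← ENNReal.ofReal_add (by positivity) (by positivity),
    ← ENNReal.ofReal_add (by positivity) (by positivity)]
  exact ENNReal.ofReal_le_ofReal (by linarith)

lemma traceNorm_codebookOutput_sub (hD : Measurable D) (hDs : ∀ x, D x ∈ densityOperators H)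
    {n M : ℕ} (C : Fin M → Fin n → X) :
    traceNorm (codebookOutput D C - tensorOp fun _ : Fin n => (outputState P D).op)
      = ENNReal.ofReal ‖fluctuation (Measure.pi fun _ => P) (productChannel D n) C‖ := by
  rw [TraceClass.ofReal_norm_eq, fluctuation, integral_productChannel P hD hDs, TraceClass.op_sub,
    TraceClass.op_smul, ← TraceClass.opL_apply (∑ m, _), map_sum]
  rfl

end SoftCovering

end CQ

end

/-! ### The covering theorem with doubly exponential probability bound. -/

theorem corollary1
    {H : Type*} [NormedAddCommGroup H] [InnerProductSpace ℂ H] [CompleteSpace H]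
    [TopologicalSpace.SeparableSpace H]
    {X : Type*} [MeasurableSpace X]
    (D : X → CQ.TraceClass H) (hD : Measurable D) (hDstate : ∀ x, D x ∈ CQ.densityOperators H)
    (P : Measure X) [IsProbabilityMeasure P]
    (R : ℝ) (hR : CQ.information P D < (R : EReal))
    (α : ℝ) (hα : α ∈ Set.Ioo (0 : ℝ) 1)
    (hout : CQ.IsTraceClass ((CQ.outputState P D).op ^ α))
    (hae : ∀ᵐ x ∂P, CQ.IsTraceClass ((D x).op ^ α))
    (hint : Integrable (fun x => CQ.toTraceClass ((D x).op ^ α)) P) :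
    ∃ γ₁ > (0 : ℝ), ∃ γ₂ > (0 : ℝ), ∀ᶠ n : ℕ in atTop, ∀ M : ℕ, Real.exp (n * R) ≤ M →
      (CQ.codebookLaw P n M).real
        {C | ENNReal.ofReal (Real.exp (-γ₁ * n)) ≤
          CQ.traceNorm (CQ.codebookOutput D C -
            CQ.tensorOp fun _ : Fin n => (CQ.outputState P D).op)}
        ≤ Real.exp (-Real.exp (γ₂ * n)) := by
  unfold CQ.information at hR
  split_ifs at hR with h
  · obtain ⟨hlog, hlogP⟩ := h
    rw [EReal.coe_lt_coe_iff] at hR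
    -- Without a positive rate `M` would not be forced to grow and concentration would give nothing.
    have hR0 : 0 < R := by
      have := CQ.trace_mulLog_outputState_le P hD hDstate hlog hlogP
        (CQ.integrable_trace_mulLog P hD hDstate hα hae hint hlog)
      linarith
    obtain ⟨θ, hθ, hmean⟩ := CQ.exists_lintegral_enorm_fluctuation_productChannel_le P hD hDstate
      hα hout hae hint hlog hlogP hR
    obtain ⟨γ₁, hγ₁, γ₂, hγ₂, hev⟩ := CQ.eventually_exponential_bounds hθ hR0
    refine ⟨γ₁, hγ₁, γ₂, hγ₂, hev.mono fun n hn M hM => ?_⟩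
    obtain ⟨h1, h2⟩ := hn M hM
    have hM0 : 0 < M := by
      have := (Real.exp_pos _).trans_le hM
      exact_mod_cast this
    -- The threshold `exp(-γ₁ n)` is split in two: one half bounds the mean, the other is the
    -- deviation `s`.
    refine le_trans ?_ ((CQ.measureReal_le_norm_fluctuation_le (Measure.pi fun _ => P)
      (CQ.stronglyMeasurable_productChannel hD n)
      (fun x => CQ.norm_tensorTC fun i => hDstate (x i)) hM0 (by positivity)
      (s := Real.exp (-γ₁ * n) / 2) (t := Real.exp (-γ₁ * n)) (by positivity) (by linarith)
      (hmean n M hM)).trans h2)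
    simp only [CQ.traceNorm_codebookOutput_sub P hD hDstate,
      ENNReal.ofReal_le_ofReal_iff (norm_nonneg _)]
    exact le_rfl
  -- If the entropies are not defined, the information is `⊤` by convention and cannot lie below
  -- `R`.
  · exact absurd hR not_top_lt
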